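/- Notation. For $\tau\in\mathcal H=\{\operatorname{Im}\tau>0\}$ and $\xi\in\mathbb C$ put $q=e^{2\pi i\tau}$, $x=e^{2\pi i\xi}$, $q^*=e^{-2\pi i/\tau}$, $x^*=e^{2\pi i\xi/\tau}$, $\log q=2\pi i\tau$, $q^{-1/24}=e^{-2\pi i\tau/24}$, and $(a;p)_\infty=\prod_{n\ge0}(1-ap^n)$ for $|p|<1$. Let $C=\mathbb C\setminus((-\infty,-1]\cup[1,\infty))$ and $D_\tau=\{\xi\in C:\ \xi/\tau\notin(-\infty,0]\}$, a simply connected domain containing the upper half-plane. For $\xi\in D_\tau$ let $$G(\tau,\xi)=-\log\Gamma\Bigl(\frac\xi\tau+1\Bigr)+\Bigl(\frac\xi\tau+\frac12\Bigr)\log\frac\xi\tau-\frac\xi\tau+\log\sqrt{2\pi}$$ (principal $\log$; $\log\Gamma$ is the holomorphic branch on $\mathbb C\setminus(-\infty,0]$ vanishing at $1$), and $G^*(\tau,\xi)=\frac12\bigl(G(\tau,\xi)-G(\tau,-\xi)\bigr)$ if $\xi/\tau\notin\mathbb R$. For $d\in(-\pi,0)$ let $$P^d(\tau,\xi)=\int_0^{\infty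 e^{id}}\frac{\sin(\xi t/\tau)}{e^{it/\tau}-1}\Bigl(\cot\frac t2-\frac2t\Bigr)\frac{dt}t,\qquad \Omega^d=\bigcup_{\sigma\in(0,\pi)}(0,\infty e^{i(d+\sigma)})\times\{\xi\in\mathbb C:|\operatorname{Im}(\xi e^{-i\sigma})|<\sin\sigma\}.$$ Theorem. (1) $P^d$ converges absolutely on $\Omega^d$ for every $d\in(-\pi,0)$, and the functions $P^d$ are the restrictions of one holomorphic function $P$ on $\bigcup_{d\in(-\pi,0)}\Omega^d$. Moreover $P$ has an extension, again written $P$ and unique modulo $2\pi i\mathbb Z$, to all $(\tau,\xi)$ with $\tau\in\mathcal H$, $\xi\in C$, $\xi\ne\pm(m+n\tau)$ $(m,n\ge1)$, such that $e^{P}$ is holomorphic there (the analytic continuation of the $P^d$). (2) For each $\tau\in\mathcal H$ there are holomorphic functions of $\xi\in D_\tau$, written $\mathrm{Li}_2(x)$ and $\sqrt{1-x}$, which for $\operatorname{Im}\xi>0$ (that is, $|x|<1$) are $\sum_{n\ge1}x^n/n^2$ and $e^{\frac12\log(1-x)}$ with the principal logarithm. With these, for every $\tau\in\mathcal H$ and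 every $\xi\in\mathbb C\setminus((-\infty,-1]\cup[1,\infty))$ with $\xi/\tau\notin(-\infty,0]$ and $\xi\ne\pm(m+n\tau)$ for all integers $m,n\ge1$, $$(x;q)_\infty=q^{-1/24}\sqrt{1-x}\,(x^*q^*;q^*)_\infty\exp\Bigl(\frac{\mathrm{Li}_2(x)}{\log q}+G(\tau,\xi)+P(\tau,\xi)\Bigr).$$ Equivalently, for such $(\tau,\xi)$ with $\xi/\tau\notin\mathbb R$, $(x;q)_\infty=K(q,x)\,(x^*;q^*)_\infty$, where $$K(q,x)=q^{-1/24}\,\kappa\,\exp\Bigl(\frac{\mathrm{Li}_2(x)}{\log q}+G^*(\tau,\xi)+P(\tau,\xi)\Bigr),\qquad \kappa=\begin{cases}\dfrac{\sqrt{1-x}}{\sqrt{1-x^*}}&\text{if }\operatorname{Im}(\xi/\tau)>0,\\[2mm]\dfrac{\sqrt{1-x}\,\sqrt{1-1/x^*}}{1-x^*}&\text{if }\operatorname{Im}(\xi/\tau)<0,\end{cases}$$ the roots $\sqrt{1-x^*}$ and $\sqrt{1-1/x^*}$ being principal. -/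

import Mathlib

noncomputable section

namespace QProduct

/-- `(x;q)_∞ = ∏_{n ≥ 0} (1 - x q^n)`. -/
def qPoch (x q : ℂ) : ℂ := ∏' n : ℕ, (1 - x * q ^ n)

/-- The dilogarithm `Li₂(x) = ∑_{n ≥ 0} x^(n+1)/(n+1)^2`, for `|x| ≤ 1`. -/
def dilog (x : ℂ) : ℂ := ∑' n : ℕ, x ^ (n + 1) / ((n : ℂ) + 1) ^ 2

/-- The holomorphic branch of `log Γ` on `ℂ ∖ (-∞, 0]` with `log Γ(1) = 0`: the integral of
`Γ'/Γ` over the segment from `1` to `w`. -/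
def logGamma (w : ℂ) : ℂ :=
  ∫ s in (0 : ℝ)..1, (w - 1) * Complex.digamma (1 + (s : ℂ) * (w - 1))

/-- `G(τ,ξ) = -log Γ(ξ/τ + 1) + (ξ/τ + 1/2) log(ξ/τ) - ξ/τ + log √(2π)`, for
`ξ/τ ∉ (-∞, 0]`. -/
def stirlingG (τ ξ : ℂ) : ℂ :=
  -logGamma (ξ / τ + 1) + (ξ / τ + 1 / 2) * Complex.log (ξ / τ) - ξ / τ
    + (Real.log (Real.sqrt (2 * Real.pi)) : ℂ)

/-- `G*(τ,ξ) = (G(τ,ξ) - G(τ,-ξ)) / 2`. -/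
def stirlingGStar (τ ξ : ℂ) : ℂ := (stirlingG τ ξ - stirlingG τ (-ξ)) / 2

/-- The integrand `sin(ξ t/τ) / (e^{it/τ} - 1) · (cot(t/2) - 2/t) / t`. -/
def kernelP (τ ξ t : ℂ) : ℂ :=
  Complex.sin (ξ / τ * t) / (Complex.exp (Complex.I * t / τ) - 1)
    * (Complex.cot (t / 2) - 2 / t) / t

/-- The pull-back of `kernelP τ ξ t dt` to `(0, ∞)` under `r ↦ t = r e^{id}`. -/
def rayKernel (d : ℝ) (τ ξ : ℂ) (r : ℝ) : ℂ :=
  kernelP τ ξ ((r : ℂ) * Complex.exp (Complex.I * (d : ℂ))) * Complex.exp (Complex.I * (d : ℂ))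

/-- `P^d(τ,ξ)`: the integral of `kernelP τ ξ` over the half line from `0` with argument `d`. -/
def rayP (d : ℝ) (τ ξ : ℂ) : ℂ := ∫ r in Set.Ioi (0 : ℝ), rayKernel d τ ξ r

/-- `Ω^d = ⋃_{σ ∈ (0,π)} (0, ∞ e^{i(d+σ)}) × {ξ : |Im(ξ e^{-iσ})| < sin σ}`. -/
def rayDomain (d : ℝ) : Set (ℂ × ℂ) :=
  {p | ∃ σ ∈ Set.Ioo (0 : ℝ) Real.pi,
    (∃ r : ℝ, 0 < r ∧ p.1 = (r : ℂ) * Complex.exp (Complex.I * ((d : ℂ) + (σ : ℂ)))) ∧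
    |(p.2 * Complex.exp (-(Complex.I * (σ : ℂ)))).im| < Real.sin σ}

/-- `ℂ ∖ ((-∞, -1] ∪ [1, ∞))`. -/
def cutPlane : Set ℂ := {ξ | ∀ r : ℝ, ξ = (r : ℂ) → -1 < r ∧ r < 1}

/-- The points `±(m + nτ)`, `m, n ≥ 1`. -/
def singularPoints (τ : ℂ) : Set ℂ :=
  {ξ | ∃ m n : ℕ, 1 ≤ m ∧ 1 ≤ n ∧
    (ξ = (m : ℂ) + (n : ℂ) * τ ∨ ξ = -((m : ℂ) + (n : ℂ) * τ))}

/-- Pairs `(τ, ξ)` with `Im τ > 0`, `ξ ∈ ℂ ∖ ((-∞, -1] ∪ [1, ∞))`, `ξ ≠ ±(m + nτ)`. -/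
def continuationDomain : Set (ℂ × ℂ) :=
  {p | 0 < p.1.im ∧ p.2 ∈ cutPlane ∧ p.2 ∉ singularPoints p.1}

/-- `{ξ ∈ ℂ ∖ ((-∞, -1] ∪ [1, ∞)) : ξ/τ ∉ (-∞, 0]}`. For `Im τ > 0` it is simply connected and
contains the upper half-plane. -/
def xiDomain (τ : ℂ) : Set ℂ := {ξ | ξ ∈ cutPlane ∧ ξ / τ ∈ Complex.slitPlane}

/-- `e^{2πiz}`. -/
def e2pi (z : ℂ) : ℂ := Complex.exp (2 * (Real.pi : ℂ) * Complex.I * z)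

/-- The principal square root `e^{(1/2) log z}`. -/
def psqrt (z : ℂ) : ℂ := Complex.exp (Complex.log z / 2)

/-- `P` is a determination of the analytic continuation of the integrals `P^d`, `-π < d < 0`: the
integrals converge absolutely on `Ω^d`, `P` equals `P^d` there and is holomorphic on the union of
the `Ω^d`, and `exp ∘ P` is holomorphic on the (connected) domain `continuationDomain`, so that
`P` is there, modulo `2πiℤ`, the analytic continuation of the `P^d`. -/
structure IsPMinus (P : ℂ × ℂ → ℂ) : Prop where
  integrable : ∀ d ∈ Set.Ioo (-Real.pi) 0, ∀ p ∈ rayDomain d,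
    MeasureTheory.IntegrableOn (rayKernel d p.1 p.2) (Set.Ioi (0 : ℝ))
  eq_rayP : ∀ d ∈ Set.Ioo (-Real.pi) 0, ∀ p ∈ rayDomain d, P p = rayP d p.1 p.2
  holomorphic : DifferentiableOn ℂ P (⋃ d ∈ Set.Ioo (-Real.pi) 0, rayDomain d)
  exp_holomorphic : DifferentiableOn ℂ (fun p => Complex.exp (P p)) continuationDomain

/-- `L` is the holomorphic function of `ξ` on `xiDomain τ` which is `Li₂(e^{2πiξ})` for
`Im ξ > 0`. -/
structure IsDilogBranch (τ : ℂ) (L : ℂ → ℂ) : Prop where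
  holomorphic : DifferentiableOn ℂ L (xiDomain τ)
  eq_dilog : ∀ ξ : ℂ, 0 < ξ.im → L ξ = dilog (e2pi ξ)

/-- `S` is the holomorphic function of `ξ` on `xiDomain τ` which is the principal value of
`√(1 - e^{2πiξ})` for `Im ξ > 0`. -/
structure IsSqrtBranch (τ : ℂ) (S : ℂ → ℂ) : Prop where
  holomorphic : DifferentiableOn ℂ S (xiDomain τ)
  eq_psqrt : ∀ ξ : ℂ, 0 < ξ.im → S ξ = psqrt (1 - e2pi ξ)

end QProduct

end

noncomputable section

namespace QProduct

open Complex Filter Topology MeasureTheory Set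

/-! ### Gudermann's series for the Binet function -/

/-! Let μ be the Binet function, log Γ(z) = (z - 1/2) log z - z + log √(2π) + μ(z). Every ingredient
of the theorem is a sum of values of μ.

G and P: the functional equation of Γ gives G(τ,ξ) = -μ(ξ/τ) (`stirlingG_eq_neg_binetMu`). Expanding
1/(e^{it/τ} - 1) geometrically under P^d leaves, for each k ≥ 1, a difference of two Binet integrals
along a rotated ray, so P^d = ∑_{k ≥ 1} (μ((k - ξ)/τ) - μ((k + ξ)/τ)), which no longer depends on d
(`integral_binet`, `rayP_eq_seriesP`). The exponential of a term is a quotient of Gamma values times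
elementary exponentials. Written with log w - log τ in place of log(w/τ), it continues to all ξ in
the cut plane, with zeros and poles only at ±(m + nτ). The tail of the product is the exponential of
a holomorphic series, so the product `prodE` is the continuation of e^P.

The q-product for Im ξ > 0: μ(z) = ∑_n g(z + n) (Gudermann), and g(z) - (1/z - 1/(z+1))/12 is small
enough to be absolutely summable over the half lattice (ξ + k)/τ + n, k ∈ ℤ, n ≥ 0. Summing over n
first gives μ(z) - 1/(12z) at z = (ξ + k)/τ. Summing over k first, by Lipschitz's formula, gives
-log(1 - xq^n) + V(xq^n) - V(xq^{n+1}), where V contains Li₂(X)/log q (`hasSum_row`). The rows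
telescope, and log (x;q)_∞ is V(x) minus the double sum (`qPoch_eq_exp_latticeSum`). Restoring the
terms 1/(12z), with k and -k paired, brings in the cotangent series and with it q^{-1/24}
(`qPoch_eq_exp_symmetricSum`).

Conclusion: for Im z > 0 reflection reads μ(z) + μ(-z) = -log(1 - e^{2πiz}). In exponential form at
z = (ξ - k)/τ it turns the symmetric sum into the series for P and the factors 1 - x^*q^{*k}
(`prodE_mul_qPoch`), provided also Im(ξ/τ) > 0. Both sides are meromorphic in ξ on the connected set
D_τ, so the identity persists there (`qPoch_eq_mul_prodE`). Reflection at ±ξ/τ exchanges G for G^*.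
-/

/-- `(z + 1/2) (log (z + 1) - log z) - 1`, the general term of Gudermann's series. -/
def gudermannTerm (z : ℂ) : ℂ := (z + 1 / 2) * (log (z + 1) - log z) - 1

/-- Gudermann's term after subtraction of its leading, telescoping, part. -/
def gudermannRem (z : ℂ) : ℂ := gudermannTerm z - 1 / 12 * (1 / z - 1 / (z + 1))

/-- The Binet function `log Γ(z) - (z - 1/2) log z + z - log √(2π)`. -/
def binetMu (z : ℂ) : ℂ := ∑' n : ℕ, gudermannTerm (z + n)

/-- The remainder `binetMu z - 1 / (12 z)`. -/
def binetRho (z : ℂ) : ℂ := ∑' n : ℕ, gudermannRem (z + n)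

/-- The kernel `-s (1 - s) (1 - 2 s) / 6`. -/
def bernoulliKernel (s : ℂ) : ℂ := -(s * (1 - s) * (1 - 2 * s)) / 6

lemma slitPlane_add_nonneg {z : ℂ} (hz : z ∈ slitPlane) {t : ℝ} (ht : 0 ≤ t) :
    z + t ∈ slitPlane := by
  rcases hz with h | h
  · left; simp; linarith
  · right; simpa using h

lemma slitPlane_add_nat {z : ℂ} (hz : z ∈ slitPlane) (n : ℕ) : z + n ∈ slitPlane := by
  simpa using slitPlane_add_nonneg hz (Nat.cast_nonneg (α := ℝ) n)

lemma hasDerivAt_log_const_add {z s : ℂ} (h : z + s ∈ slitPlane) :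
    HasDerivAt (fun s => log (z + s)) (1 / (z + s)) s := by
  simpa using ((hasDerivAt_id s).const_add z).clog h

lemma integral_of_hasDerivAt_ofReal {f F : ℂ → ℂ}
    (h : ∀ s ∈ uIcc (0 : ℝ) 1, HasDerivAt F (f s) (s : ℂ))
    (hf : ContinuousOn (fun s : ℝ => f s) (uIcc (0 : ℝ) 1)) :
    ∫ s in (0 : ℝ)..1, f s = F 1 - F 0 := by
  have := intervalIntegral.integral_eq_sub_of_hasDerivAt (f := fun s : ℝ => F s)
    (f' := fun s : ℝ => f s) (a := 0) (b := 1) (fun s hs => (h s hs).comp_ofReal)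
    hf.intervalIntegrable
  simpa using this

/-- The term is the error of the trapezoidal rule for `log` on [z, z + 1]; two integrations by parts
produce a kernel vanishing at both ends. -/
lemma gudermannTerm_eq_integral {z : ℂ} (hz : z ∈ slitPlane) :
    gudermannTerm z = ∫ s in (0 : ℝ)..1, (s : ℂ) * (1 - s) / 2 / (z + s) ^ 2 := by
  have hne : ∀ s ∈ uIcc (0 : ℝ) 1, z + s ∈ slitPlane := fun s hs => by
    rw [uIcc_of_le zero_le_one] at hs
    exact slitPlane_add_nonneg hz hs.1
  rw [integral_of_hasDerivAt_ofReal (f := fun s => s * (1 - s) / 2 / (z + s) ^ 2)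
    (F := fun s => (-s + (1 + 2 * z) * log (z + s) + z * (1 + z) / (z + s)) / 2)]
  · have h0 := slitPlane_ne_zero hz
    have h1 : z + 1 ≠ 0 := by
      simpa using slitPlane_ne_zero (slitPlane_add_nonneg hz zero_le_one)
    simp only [add_zero, gudermannTerm]
    field_simp
    ring
  · intro s hs
    have h1 := slitPlane_ne_zero (hne s hs)
    have h2 : HasDerivAt (fun s : ℂ => z + s) 1 (s : ℂ) := (hasDerivAt_id _).const_add z
    convert! ((((hasDerivAt_id (s : ℂ)).neg).add
      ((hasDerivAt_log_const_add (hne s hs)).const_mul (1 + 2 * z))).add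
      ((hasDerivAt_const (s : ℂ) (z * (1 + z))).div h2 h1)).div_const 2 using 1
    field_simp
    ring
  · apply ContinuousOn.div (by fun_prop) (by fun_prop)
    intro s hs
    exact pow_ne_zero _ (slitPlane_ne_zero (hne s hs))

/-- The weight s(1 - s)/2 has mean 1/12, so removing the telescoping part makes it mean-free. Its
primitive then vanishes at both ends, being half of `bernoulliKernel`, and one more integration by
parts gains a power of z + s. -/
lemma gudermannRem_eq_integral {z : ℂ} (hz : z ∈ slitPlane) :
    gudermannRem z = ∫ s in (0 : ℝ)..1, bernoulliKernel s / (z + s) ^ 3 := by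
  have hne : ∀ s ∈ uIcc (0 : ℝ) 1, z + s ∈ slitPlane := fun s hs => by
    rw [uIcc_of_le zero_le_one] at hs
    exact slitPlane_add_nonneg hz hs.1
  rw [integral_of_hasDerivAt_ofReal (f := fun s => bernoulliKernel s / (z + s) ^ 3)
    (F := fun s => -(2 * s - (6 * z + 3) * log (z + s) - (6 * z ^ 2 + 6 * z + 1) / (z + s)
      + (2 * z ^ 3 + 3 * z ^ 2 + z) / (2 * (z + s) ^ 2)) / 6)]
  · have h0 := slitPlane_ne_zero hz
    have h1 : z + 1 ≠ 0 := by
      simpa using slitPlane_ne_zero (slitPlane_add_nonneg hz zero_le_one)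
    simp only [add_zero, gudermannTerm, gudermannRem]
    field_simp
    ring
  · intro s hs
    have h1 := slitPlane_ne_zero (hne s hs)
    have h2 : HasDerivAt (fun s : ℂ => z + s) 1 (s : ℂ) := (hasDerivAt_id _).const_add z
    have h3 : (2 : ℂ) * (z + s) ^ 2 ≠ 0 := mul_ne_zero two_ne_zero (pow_ne_zero _ h1)
    convert! (((((((hasDerivAt_id (s : ℂ)).const_mul 2).sub
      ((hasDerivAt_log_const_add (hne s hs)).const_mul (6 * z + 3))).sub
      ((hasDerivAt_const (s : ℂ) (6 * z ^ 2 + 6 * z + 1)).div h2 h1)).add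
      ((hasDerivAt_const (s : ℂ) (2 * z ^ 3 + 3 * z ^ 2 + z)).div
        ((h2.pow 2).const_mul 2) h3))).neg).div_const 6 using 1
    simp only [bernoulliKernel, Pi.pow_apply]
    field_simp
    ring
  · unfold bernoulliKernel
    apply ContinuousOn.div (by fun_prop) (by fun_prop)
    intro s hs
    exact pow_ne_zero _ (slitPlane_ne_zero (hne s hs))

lemma norm_bernoulliKernel_le {s : ℝ} (h0 : 0 ≤ s) (h1 : s ≤ 1) : ‖bernoulliKernel s‖ ≤ 1 := by
  have : bernoulliKernel s = ((-(s * (1 - s) * (1 - 2 * s)) / 6 : ℝ) : ℂ) := by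
    simp [bernoulliKernel]
  rw [this, norm_real, Real.norm_eq_abs, abs_le]
  have := mul_nonneg h0 (sub_nonneg.2 h1)
  constructor <;> nlinarith

lemma norm_gudermannRem_le {z : ℂ} (hz : z ∈ slitPlane) {δ : ℝ} (hδ : 0 < δ)
    (h : ∀ s : ℝ, 0 ≤ s → δ ≤ ‖z + s‖) : ‖gudermannRem z‖ ≤ 1 / δ ^ 3 := by
  rw [gudermannRem_eq_integral hz]
  refine (intervalIntegral.norm_integral_le_of_norm_le_const (C := 1 / δ ^ 3) ?_).trans (by simp)
  intro s hs
  rw [uIoc_of_le zero_le_one] at hs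
  rw [norm_div, norm_pow]
  gcongr
  · exact norm_bernoulliKernel_le hs.1.le hs.2
  · exact h s hs.1.le

lemma norm_gudermannTerm_le {z : ℂ} (hz : z ∈ slitPlane) {δ : ℝ} (hδ : 0 < δ)
    (h : ∀ s : ℝ, 0 ≤ s → δ ≤ ‖z + s‖) : ‖gudermannTerm z‖ ≤ 1 / δ ^ 2 := by
  rw [gudermannTerm_eq_integral hz]
  refine (intervalIntegral.norm_integral_le_of_norm_le_const (C := 1 / δ ^ 2) ?_).trans (by simp)
  intro s hs
  rw [uIoc_of_le zero_le_one] at hs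
  rw [norm_div, norm_pow]
  gcongr
  · have : (s : ℂ) * (1 - s) / 2 = ((s * (1 - s) / 2 : ℝ) : ℂ) := by simp
    rw [this, norm_real, Real.norm_eq_abs, abs_le]
    constructor <;> nlinarith [hs.1, hs.2, mul_nonneg hs.1.le (sub_nonneg.2 hs.2)]
  · exact h s hs.1.le

/-- Points near a point of the slit plane lie uniformly in a sector around the positive axis. -/
lemma eventually_sector {z : ℂ} (hz : z ∈ slitPlane) :
    ∃ c : ℝ, 0 < c ∧ ∀ᶠ w : ℂ in 𝓝 z, ∀ a t : ℝ, 0 ≤ a → 0 ≤ t →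
      c * (a + t) ≤ ‖(a : ℂ) * w + t‖ := by
  -- After division by a + t, the points a z + t fill the segment from z to 1, which avoids 0. Half
  -- of the minimal modulus is spent on the perturbation of z.
  have hcont : ContinuousOn (fun l : ℝ => ‖(1 - l : ℂ) * z + l‖) (Icc 0 1) := by fun_prop
  obtain ⟨l₀, hl₀, hmin⟩ := isCompact_Icc.exists_isMinOn ⟨0, by simp⟩ hcont
  set m := ‖(1 - l₀ : ℂ) * z + l₀‖ with hm
  have hmpos : 0 < m := by
    rw [hm, norm_pos_iff]
    rcases hl₀.2.lt_or_eq with h | h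
    · intro h0
      have : z = -((l₀ / (1 - l₀) : ℝ) : ℂ) := by
        have h1 : (1 - l₀ : ℂ) ≠ 0 := by
          exact_mod_cast (sub_pos.2 h).ne'
        push_cast
        field_simp
        linear_combination h0
      rw [this, ← ofReal_neg, ofReal_mem_slitPlane] at hz
      have : 0 ≤ l₀ / (1 - l₀) := div_nonneg hl₀.1 (sub_pos.2 h).le
      linarith
    · simp [h]
  refine ⟨m / 2, by positivity, ?_⟩
  filter_upwards [Metric.ball_mem_nhds z (half_pos hmpos)] with w hw a t ha ht
  rcases (add_nonneg ha ht).eq_or_lt with h | h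
  · rw [← h]; simp
  · have h1 := hmin (a := t / (a + t)) ⟨by positivity, by rw [div_le_one h]; linarith⟩
    have h2 : (1 - (t / (a + t) : ℝ) : ℂ) * z + (t / (a + t) : ℝ) = (a * z + t) / (a + t : ℝ) := by
      have : ((a + t : ℝ) : ℂ) ≠ 0 := by exact_mod_cast h.ne'
      push_cast at this ⊢
      field_simp
      ring
    simp only [mem_ofPred_eq] at h1
    rw [h2, norm_div, norm_real, Real.norm_of_nonneg h.le, le_div_iff₀ h, ← hm] at h1
    have h3 : ‖(a : ℂ) * (z - w)‖ ≤ a * (m / 2) := by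
      rw [norm_mul, norm_real, Real.norm_of_nonneg ha]
      gcongr
      rw [Metric.mem_ball, dist_comm, dist_eq_norm] at hw
      exact hw.le
    have h4 : ‖(a : ℂ) * z + t‖ ≤ ‖(a : ℂ) * w + t‖ + ‖(a : ℂ) * (z - w)‖ := by
      refine le_trans (le_of_eq ?_) (norm_add_le _ _)
      congr 1; ring
    nlinarith [mul_nonneg hmpos.le ht]

lemma differentiableAt_gudermannTerm {z : ℂ} (hz : z ∈ slitPlane) :
    DifferentiableAt ℂ gudermannTerm z := by
  have h1 : z + 1 ∈ slitPlane := by simpa using slitPlane_add_nat hz 1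
  unfold gudermannTerm
  fun_prop (disch := assumption)

lemma summable_one_div_one_add_sq : Summable fun n : ℕ => 1 / ((1 : ℝ) + n) ^ 2 := by
  have := (summable_nat_add_iff 1).2 (Real.summable_one_div_nat_pow.2 one_lt_two)
  refine this.congr fun n => ?_
  push_cast
  rw [add_comm (1 : ℝ)]

lemma sector_of_slitPlane {z : ℂ} (hz : z ∈ slitPlane) :
    ∃ c : ℝ, 0 < c ∧ ∀ᶠ w in 𝓝 z, w ∈ slitPlane ∧ ∀ t : ℝ, 0 ≤ t → c * (1 + t) ≤ ‖w + t‖ := by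
  obtain ⟨c, hc, h⟩ := eventually_sector hz
  refine ⟨c, hc, ?_⟩
  filter_upwards [h, isOpen_slitPlane.mem_nhds hz] with w hw hs
  exact ⟨hs, fun t ht => by simpa using hw 1 t zero_le_one ht⟩

lemma norm_gudermannTerm_add_nat_le {z : ℂ} (hz : z ∈ slitPlane) {c : ℝ} (hc : 0 < c)
    (h : ∀ t : ℝ, 0 ≤ t → c * (1 + t) ≤ ‖z + t‖) (n : ℕ) :
    ‖gudermannTerm (z + n)‖ ≤ 1 / c ^ 2 * (1 / ((1 : ℝ) + n) ^ 2) := by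
  refine (norm_gudermannTerm_le (slitPlane_add_nat hz n) (δ := c * (1 + n)) (by positivity)
    fun s hs => ?_).trans (le_of_eq (by field_simp))
  have := h (n + s) (by positivity)
  push_cast at this
  rw [add_assoc]
  exact le_trans (by nlinarith) this

lemma summable_gudermannTerm {z : ℂ} (hz : z ∈ slitPlane) :
    Summable fun n : ℕ => gudermannTerm (z + n) := by
  obtain ⟨c, hc, h⟩ := sector_of_slitPlane hz
  exact .of_norm_bounded (summable_one_div_one_add_sq.mul_left (1 / c ^ 2))
    (norm_gudermannTerm_add_nat_le hz hc h.self_of_nhds.2)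

lemma differentiableAt_binetMu {z : ℂ} (hz : z ∈ slitPlane) : DifferentiableAt ℂ binetMu z := by
  obtain ⟨c, hc, h⟩ := sector_of_slitPlane hz
  obtain ⟨U, hU, hUo, hzU⟩ := eventually_nhds_iff.1 h
  refine (differentiableOn_tsum_of_summable_norm
    (summable_one_div_one_add_sq.mul_left (1 / c ^ 2)) (U := U) (fun n w hw => ?_) hUo
    fun n w hw => norm_gudermannTerm_add_nat_le (hU w hw).1 hc (hU w hw).2 n).differentiableAt
    (hUo.mem_nhds hzU)
  exact (DifferentiableAt.comp (f := fun w : ℂ => w + n) w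
    (differentiableAt_gudermannTerm (slitPlane_add_nat (hU w hw).1 n))
    (by fun_prop)).differentiableWithinAt

lemma binetMu_sub_add_one {z : ℂ} (hz : z ∈ slitPlane) :
    binetMu z - binetMu (z + 1) = gudermannTerm z := by
  have := (summable_gudermannTerm hz).tsum_eq_zero_add
  rw [binetMu, this, binetMu]
  simp only [Nat.cast_add, Nat.cast_one, Nat.cast_zero, add_zero]
  have h2 : ∀ n : ℕ, z + (n + 1 : ℂ) = z + 1 + n := fun n => by ring
  simp only [h2]
  ring

lemma hasSum_telescope {f : ℕ → ℂ} (hf : Tendsto f atTop (𝓝 0))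
    (hs : Summable fun n => f n - f (n + 1)) : HasSum (fun n => f n - f (n + 1)) (f 0) := by
  rw [hs.hasSum_iff_tendsto_nat]
  simp only [Finset.sum_range_sub']
  simpa using hf.const_sub (f 0)

lemma tendsto_one_div_add_nat (z : ℂ) :
    Tendsto (fun n : ℕ => 1 / (z + n)) atTop (𝓝 0) := by
  simp only [one_div]
  refine tendsto_inv₀_cobounded.comp ?_
  rw [← tendsto_norm_atTop_iff_cobounded]
  refine tendsto_atTop_mono (f := fun n : ℕ => (n : ℝ) - ‖z‖) (fun n => ?_)
    (tendsto_atTop_add_const_right _ _ tendsto_natCast_atTop_atTop)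
  have := norm_sub_le (z + n) z
  simp only [add_sub_cancel_left, norm_natCast] at this
  linarith

/-- Splits cubic decay evenly between two indices, so that double series are dominated by a product
of two convergent series. -/
lemma rpow_three_halves_mul_le {a n : ℝ} (ha : 0 ≤ a) (hn : 0 ≤ n) :
    1 / (1 + a + n) ^ 3 ≤ (1 + a) ^ (-(3 / 2) : ℝ) * (1 + n) ^ (-(3 / 2) : ℝ) := by
  have h1 : 1 / (1 + a + n) ^ 3 =
      (1 + a + n) ^ (-(3 / 2) : ℝ) * (1 + a + n) ^ (-(3 / 2) : ℝ) := by
    rw [← Real.rpow_add (by positivity)]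
    norm_num
  rw [h1]
  gcongr ?_ * ?_
  · exact Real.rpow_le_rpow_of_nonpos (by positivity) (by linarith) (by norm_num)
  · exact Real.rpow_le_rpow_of_nonpos (by positivity) (by linarith) (by norm_num)

lemma summable_one_add_rpow : Summable fun n : ℕ => ((1 : ℝ) + n) ^ (-(3 / 2) : ℝ) := by
  have := (summable_nat_add_iff 1).2 (Real.summable_nat_rpow (p := -(3 / 2)) |>.2 (by norm_num))
  refine this.congr fun n => ?_
  push_cast
  rw [add_comm (1 : ℝ)]

lemma norm_gudermannRem_add_nat_le {z : ℂ} (hz : z ∈ slitPlane) {c a : ℝ} (hc : 0 < c)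
    (ha : 0 ≤ a) (h : ∀ t : ℝ, 0 ≤ t → c * (1 + a + t) ≤ ‖z + t‖) (n : ℕ) :
    ‖gudermannRem (z + n)‖ ≤
      1 / c ^ 3 * (1 + a) ^ (-(3 / 2) : ℝ) * ((1 : ℝ) + n) ^ (-(3 / 2) : ℝ) := by
  refine (norm_gudermannRem_le (slitPlane_add_nat hz n) (δ := c * (1 + a + n)) (by positivity)
    fun s hs => ?_).trans ?_
  · have := h (n + s) (by positivity)
    push_cast at this
    rw [add_assoc z]
    exact le_trans (by nlinarith) this
  · rw [mul_pow, ← one_div_mul_one_div, mul_assoc]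
    gcongr
    exact rpow_three_halves_mul_le ha n.cast_nonneg

lemma summable_gudermannRem {z : ℂ} (hz : z ∈ slitPlane) :
    Summable fun n : ℕ => gudermannRem (z + n) := by
  obtain ⟨c, hc, h⟩ := sector_of_slitPlane hz
  refine .of_norm_bounded (summable_one_add_rpow.mul_left (1 / c ^ 3)) fun n => ?_
  simpa using norm_gudermannRem_add_nat_le hz hc le_rfl
    (by simpa using h.self_of_nhds.2) n

lemma binetMu_eq_add_binetRho {z : ℂ} (hz : z ∈ slitPlane) :
    binetMu z = 1 / (12 * z) + binetRho z := by
  have h0 : Summable fun n : ℕ => 1 / (z + n) - 1 / (z + (n + 1 : ℕ)) := by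
    refine (((summable_gudermannTerm hz).sub (summable_gudermannRem hz)).mul_left 12).congr
      fun n => ?_
    simp only [gudermannRem]
    push_cast
    rw [add_assoc]
    ring
  have h1 := hasSum_telescope (tendsto_one_div_add_nat z) h0
  have h2 := (h1.mul_left (1 / 12)).add (summable_gudermannRem hz).hasSum
  rw [binetMu, binetRho]
  refine (h2.congr_fun fun n => ?_).tsum_eq.trans ?_
  · simp only [gudermannRem]
    push_cast
    rw [← add_assoc]
    ring
  · have := slitPlane_ne_zero hz
    simp
    ring

/-- The constant in the bound for `binetRho`. -/
def rhoConst : ℝ := ∑' n : ℕ, ((1 : ℝ) + n) ^ (-(3 / 2) : ℝ)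

lemma norm_binetRho_le {z : ℂ} (hz : z ∈ slitPlane) {c a : ℝ} (hc : 0 < c)
    (ha : 0 ≤ a) (h : ∀ t : ℝ, 0 ≤ t → c * (1 + a + t) ≤ ‖z + t‖) :
    ‖binetRho z‖ ≤ 1 / c ^ 3 * rhoConst * (1 + a) ^ (-(3 / 2) : ℝ) := by
  refine (tsum_of_norm_bounded (summable_one_add_rpow.hasSum.mul_left _)
    (norm_gudermannRem_add_nat_le hz hc ha h)).trans (le_of_eq ?_)
  rw [rhoConst]
  ring

/-! ### Stirling's formula for `log Γ` -/

/-- `log √(2π)`. -/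
def stirlingConst : ℂ := (Real.log (Real.sqrt (2 * Real.pi)) : ℂ)

/-- The branch of `log Γ` on the slit plane, through the Binet function. -/
def logGammaBinet (w : ℂ) : ℂ := binetMu w + (w - 1 / 2) * log w - w + stirlingConst

lemma sum_gudermannTerm (w : ℂ) (N : ℕ) :
    ∑ m ∈ Finset.range N, gudermannTerm (w + m) = (w + N - 1 / 2) * log (w + N)
      - (w - 1 / 2) * log w - ∑ m ∈ Finset.range N, log (w + m) - N := by
  induction N with
  | zero => simp
  | succ N ih =>
    rw [Finset.sum_range_succ, ih, Finset.sum_range_succ, gudermannTerm]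
    push_cast
    rw [add_assoc w]
    ring_nf

lemma exp_stirlingConst : exp stirlingConst = (Real.sqrt (2 * Real.pi) : ℂ) := by
  rw [stirlingConst, ← ofReal_exp, Real.exp_log (by positivity)]

lemma tendsto_natCast_mul_log (w : ℂ) :
    Tendsto (fun N : ℕ => (w + N + 1 / 2) * log (1 + w / N)) atTop (𝓝 w) := by
  have h1 : Tendsto (fun N : ℕ => w / (N : ℂ)) atTop (𝓝 0) :=
    tendsto_const_div_atTop_nhds_zero_nat w
  have h2 : Tendsto (fun N : ℕ => (N : ℂ) * log (1 + w / N)) atTop (𝓝 w) := by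
    refine tendsto_nat_mul_log_one_add_of_tendsto (tendsto_const_nhds.congr' ?_)
    filter_upwards [eventually_ne_atTop 0] with N hN
    field_simp
  have h3 : Tendsto (fun N : ℕ => log (1 + w / N)) atTop (𝓝 0) := by
    have := (continuousAt_clog (x := 1) (by simp)).tendsto.comp
      (by simpa using h1.const_add 1 : Tendsto (fun N : ℕ => 1 + w / (N : ℂ)) atTop (𝓝 1))
    simpa [Function.comp_def] using this
  have := h2.add (h3.const_mul (w + 1 / 2))
  simp only [mul_zero, add_zero] at this
  refine this.congr fun N => by ring_nf

lemma factorial_eq_stirlingSeq {N : ℕ} (hN : N ≠ 0) :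
    (N.factorial : ℂ) = (Stirling.stirlingSeq N / Real.sqrt Real.pi : ℝ) *
      exp (stirlingConst + (N + 1 / 2) * log N - N) := by
  have hN' : (0 : ℝ) < N := by positivity
  have h2 : exp (stirlingConst + (N + 1 / 2) * log N - N) =
      ((Real.sqrt (2 * Real.pi) * (N ^ N * Real.sqrt N) * Real.exp (-N) : ℝ) : ℂ) := by
    rw [sub_eq_add_neg, exp_add, exp_add, exp_stirlingConst, add_mul, exp_add]
    push_cast
    congr 3
    · rw [exp_nat_mul, exp_log (by exact_mod_cast hN'.ne')]
    · rw [Real.sqrt_eq_rpow, ofReal_cpow hN'.le, cpow_def_of_ne_zero (by exact_mod_cast hN'.ne')]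
      push_cast
      rw [mul_comm]
  rw [h2]
  have h3 : (N.factorial : ℂ) = ((N.factorial : ℝ) : ℂ) := by simp
  rw [h3, ← ofReal_mul]
  congr 1
  rw [Stirling.stirlingSeq, Real.sqrt_mul (by positivity), Real.sqrt_mul (by positivity), div_pow,
    Real.exp_neg, ← Real.exp_nat_mul]
  simp only [mul_one]
  field_simp

/-- Exponentiated partial sums of Gudermann's series differ from Euler's approximants `GammaSeq w N`
by a factor tending to 1, by Stirling's formula for N!. -/
theorem exp_logGammaBinet {w : ℂ} (hw : w ∈ slitPlane) :
    exp (logGammaBinet w) = Gamma w := by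
  refine tendsto_nhds_unique ?_ (GammaSeq_tendsto_Gamma w)
  have h1 : Tendsto (fun N : ℕ => exp ((w + N + 1 / 2) * log (1 + w / N) - w) *
      (Real.sqrt Real.pi / Stirling.stirlingSeq N : ℝ)) atTop (𝓝 1) := by
    have h2 := (tendsto_natCast_mul_log w).sub_const w |>.cexp
    have h3 : Tendsto (fun N : ℕ => ((Real.sqrt Real.pi / Stirling.stirlingSeq N : ℝ) : ℂ)) atTop
        (𝓝 1) := by
      have hpi : Real.sqrt Real.pi ≠ 0 := by positivity
      have := (tendsto_const_nhds (x := Real.sqrt Real.pi)).div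
        Stirling.tendsto_stirlingSeq_sqrt_pi hpi
      rw [div_self hpi] at this
      exact_mod_cast (continuous_ofReal.tendsto 1).comp this
    simpa using h2.mul h3
  have h4 : Tendsto (fun N : ℕ => exp (∑ m ∈ Finset.range N, gudermannTerm (w + m) +
      ((w - 1 / 2) * log w - w + stirlingConst))) atTop (𝓝 (exp (logGammaBinet w))) := by
    have := (((summable_gudermannTerm hw).hasSum.tendsto_sum_nat).add_const
      ((w - 1 / 2) * log w - w + stirlingConst)).cexp
    convert! this using 2
    simp [logGammaBinet, binetMu]
    ring_nf
  have h5 := h4.div h1 one_ne_zero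
  rw [div_one] at h5
  refine h5.congr' ?_
  filter_upwards [eventually_ne_atTop 0] with N hN
  have hN' : (0 : ℝ) < N := by positivity
  have hne : ∀ m : ℕ, w + m ≠ 0 := fun m => slitPlane_ne_zero (slitPlane_add_nat hw m)
  have hlog : log (1 + w / N) = log (w + N) - log N := by
    have : w + N = ((N : ℝ) : ℂ) * (1 + w / N) := by
      push_cast
      field_simp
      ring
    rw [this, log_ofReal_mul hN']
    · simp [natCast_log]
    · intro h0
      rw [h0, mul_zero] at this
      exact hne N this
  have hprod : ∀ M : ℕ, exp (∑ m ∈ Finset.range M, log (w + m)) = ∏ m ∈ Finset.range M, (w + m) := by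
    intro M
    rw [exp_sum]
    exact Finset.prod_congr rfl fun m _ => exp_log (hne m)
  have hst : Stirling.stirlingSeq N ≠ 0 := by
    obtain ⟨n, rfl⟩ := Nat.exists_eq_succ_of_ne_zero hN
    exact (Stirling.stirlingSeq'_pos n).ne'
  rw [Pi.div_apply, GammaSeq, factorial_eq_stirlingSeq hN, ← hprod, Finset.sum_range_succ, sum_gudermannTerm,
    hlog, cpow_def_of_ne_zero (by exact_mod_cast hN'.ne')]
  have hpi : ((Real.sqrt Real.pi : ℝ) : ℂ) ≠ 0 := by
    exact_mod_cast (by positivity : Real.sqrt Real.pi ≠ 0)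
  have hst' : (Stirling.stirlingSeq N : ℂ) ≠ 0 := by exact_mod_cast hst
  push_cast
  field_simp
  simp only [← exp_add]
  congr 1
  ring

lemma differentiableAt_logGammaBinet {w : ℂ} (hw : w ∈ slitPlane) :
    DifferentiableAt ℂ logGammaBinet w := by
  have := differentiableAt_binetMu hw
  unfold logGammaBinet
  fun_prop (disch := assumption)

lemma deriv_logGammaBinet {w : ℂ} (hw : w ∈ slitPlane) :
    deriv logGammaBinet w = digamma w := by
  have h1 : Gamma =ᶠ[𝓝 w] fun w => exp (logGammaBinet w) := by
    filter_upwards [isOpen_slitPlane.mem_nhds hw] with z hz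
    exact (exp_logGammaBinet hz).symm
  rw [digamma_def, logDeriv_apply, h1.deriv_eq, ← exp_logGammaBinet hw,
    (differentiableAt_logGammaBinet hw).hasDerivAt.cexp.deriv]
  field_simp

/-- Every term is real at 1, so exp = Γ(1) = 1 leaves no multiple of 2πi undetermined. -/
lemma logGammaBinet_one : logGammaBinet 1 = 0 := by
  have h1 := exp_logGammaBinet (w := 1) (by simp)
  have h2 : ∀ n : ℕ, gudermannTerm (1 + n) =
      (((1 + n : ℝ) + 1 / 2) * (Real.log (1 + n + 1) - Real.log (1 + n)) - 1 : ℝ) := by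
    intro n
    rw [gudermannTerm]
    push_cast
    rw [ofReal_log (by positivity), ofReal_log (by positivity)]
    push_cast
    rfl
  have h3 : logGammaBinet 1 = ((∑' n : ℕ, (((1 + n : ℝ) + 1 / 2) *
      (Real.log (1 + n + 1) - Real.log (1 + n)) - 1 : ℝ) - 1 +
      Real.log (Real.sqrt (2 * Real.pi)) : ℝ) : ℂ) := by
    rw [logGammaBinet, binetMu, tsum_congr h2, ← ofReal_tsum, stirlingConst]
    simp
  rw [h3] at h1 ⊢
  rw [Gamma_one, ← ofReal_exp, ofReal_eq_one, Real.exp_eq_one_iff] at h1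
  rw [h1, ofReal_zero]

theorem logGamma_eq_logGammaBinet {w : ℂ} (hw : w ∈ slitPlane) :
    logGamma w = logGammaBinet w := by
  have hseg : ∀ s ∈ uIcc (0 : ℝ) 1, 1 + (s : ℂ) * (w - 1) ∈ slitPlane := by
    intro s hs
    rw [uIcc_of_le zero_le_one] at hs
    have := starConvex_one_slitPlane hw (sub_nonneg.2 hs.2) hs.1 (by ring)
    convert this using 1
    simp
    ring
  have hd : DifferentiableOn ℂ (deriv logGammaBinet) slitPlane :=
    DifferentiableOn.deriv (fun z hz => (differentiableAt_logGammaBinet hz).differentiableWithinAt)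
      isOpen_slitPlane
  rw [logGamma, integral_of_hasDerivAt_ofReal
    (f := fun s => (w - 1) * digamma (1 + s * (w - 1)))
    (F := fun s => logGammaBinet (1 + s * (w - 1)))]
  · simp [logGammaBinet_one]
  · intro s hs
    have h2 : HasDerivAt (fun s : ℂ => 1 + s * (w - 1)) (w - 1) (s : ℂ) := by
      simpa using ((hasDerivAt_id (s : ℂ)).mul_const (w - 1)).const_add 1
    have h3 := (differentiableAt_logGammaBinet (hseg s hs)).hasDerivAt.comp (s : ℂ) h2
    rw [deriv_logGammaBinet (hseg s hs), mul_comm] at h3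
    exact h3
  · refine ContinuousOn.mul continuousOn_const ?_
    have : ContinuousOn (fun s : ℝ => deriv logGammaBinet (1 + s * (w - 1))) (uIcc 0 1) :=
      hd.continuousOn.comp (by fun_prop) hseg
    exact this.congr fun s hs => (deriv_logGammaBinet (hseg s hs)).symm

/-- In G the function log Γ is taken at ξ/τ + 1; stepping back to ξ/τ costs exactly one Gudermann
term. -/
theorem stirlingG_eq_neg_binetMu {τ ξ : ℂ} (h : ξ / τ ∈ slitPlane) :
    stirlingG τ ξ = -binetMu (ξ / τ) := by
  have h1 : ξ / τ + 1 ∈ slitPlane := by simpa using slitPlane_add_nat h 1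
  rw [stirlingG, logGamma_eq_logGammaBinet h1, logGammaBinet]
  have := binetMu_sub_add_one h
  rw [gudermannTerm] at this
  rw [stirlingConst]
  linear_combination this

/-! ### The reflection formula -/

lemma exp_binetMu {z : ℂ} (hz : z ∈ slitPlane) :
    exp (binetMu z) = Gamma z * exp (z + (1 / 2 - z) * log z) / Real.sqrt (2 * Real.pi) := by
  rw [← exp_logGammaBinet hz, ← exp_stirlingConst, ← exp_add, ← exp_sub, logGammaBinet]
  congr 1
  ring

lemma mem_slitPlane_of_im_pos {z : ℂ} (hz : 0 < z.im) : z ∈ slitPlane := Or.inr hz.ne'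

lemma exp_neg_two_pi_lt_one {z : ℂ} (hz : 0 < z.im) : ‖e2pi z‖ < 1 := by
  rw [e2pi, norm_exp, Real.exp_lt_one_iff]
  simp
  positivity

lemma one_sub_e2pi_ne_zero {z : ℂ} (hz : 0 < z.im) : 1 - e2pi z ≠ 0 := by
  intro h
  have := exp_neg_two_pi_lt_one hz
  rw [← sub_eq_zero.1 h] at this
  simp at this

lemma log_neg_of_im_pos {z : ℂ} (hz : 0 < z.im) : log (-z) = log z - Real.pi * I := by
  rw [log, log, norm_neg, arg_neg_eq_arg_sub_pi_of_im_pos hz]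
  push_cast
  ring

/-- Euler's reflection formula for Γ(z) Γ(-z). As log(-z) = log z - πi in the upper half-plane, the
Stirling factors combine to -iz e^{-πiz}. -/
theorem exp_binetMu_add_neg {z : ℂ} (hz : 0 < z.im) :
    exp (binetMu z + binetMu (-z)) * (1 - e2pi z) = 1 := by
  have hz0 : z ≠ 0 := by rintro rfl; simp at hz
  have hz2 : -z ∈ slitPlane := Or.inr (by simpa using hz.ne')
  have hG : Gamma z * Gamma (-z) = -(Real.pi / sin (Real.pi * z)) / z := by
    have h1 := Gamma_mul_Gamma_one_sub z
    have h2 := Gamma_add_one (-z) (neg_ne_zero.2 hz0)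
    rw [show 1 - z = -z + 1 by ring, h2] at h1
    rw [← h1]
    field_simp
  have hs : sin (Real.pi * z) ≠ 0 := by
    intro h
    rw [sin_eq_zero_iff] at h
    obtain ⟨k, hk⟩ := h
    rw [mul_comm, mul_left_inj' (by exact_mod_cast Real.pi_ne_zero)] at hk
    rw [hk] at hz
    simp at hz
  have hE : exp (z + (1 / 2 - z) * log z) * exp (-z + (1 / 2 - -z) * log (-z)) =
      z * (-I * exp (-(Real.pi * z * I))) := by
    rw [log_neg_of_im_pos hz, ← exp_neg_pi_div_two_mul_I, ← exp_add, ← exp_add]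
    have : z * exp (-Real.pi / 2 * I + -(Real.pi * z * I)) =
        exp (log z + (-Real.pi / 2 * I + -(Real.pi * z * I))) := by
      rw [exp_add (log z), exp_log hz0]
    rw [this]
    congr 1
    ring
  have hpi : ((Real.sqrt (2 * Real.pi) : ℝ) : ℂ) * ((Real.sqrt (2 * Real.pi) : ℝ) : ℂ) =
      2 * Real.pi := by
    rw [← ofReal_mul, Real.mul_self_sqrt (by positivity)]
    push_cast; rfl
  have he : e2pi z = exp (Real.pi * z * I) * exp (Real.pi * z * I) := by
    rw [e2pi, ← exp_add]; congr 1; ring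
  have hsin : sin (Real.pi * z) = (exp (-(Real.pi * z * I)) - exp (Real.pi * z * I)) * I / 2 := by
    rw [sin]; ring_nf
  have hee : exp (-(Real.pi * z * I)) * exp (Real.pi * z * I) = 1 := by
    rw [← exp_add]; simp
  rw [exp_add, exp_binetMu (mem_slitPlane_of_im_pos hz), exp_binetMu hz2]
  calc _ = (Gamma z * Gamma (-z)) * (exp (z + (1 / 2 - z) * log z) *
      exp (-z + (1 / 2 - -z) * log (-z))) / (((Real.sqrt (2 * Real.pi) : ℝ) : ℂ) *
      ((Real.sqrt (2 * Real.pi) : ℝ) : ℂ)) * (1 - e2pi z) := by ring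
    _ = 1 := by
      rw [hG, hE, hpi]
      have hpi0 : (Real.pi : ℂ) ≠ 0 := by exact_mod_cast Real.pi_ne_zero
      have : I * exp (-(Real.pi * z * I)) * (1 - e2pi z) = 2 * sin (Real.pi * z) := by
        rw [hsin, he]
        linear_combination -I * exp (Real.pi * z * I) * hee
      field_simp
      linear_combination this

/-- Differentiating exp(g) = 1 gives g' = 0. This is what removes the ambiguity in 2πiℤ when
identities are lifted to logarithms. -/
lemma const_of_exp_eq_one {U : Set ℂ} (hU : IsOpen U) (hU' : IsPreconnected U) {g : ℂ → ℂ}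
    (hg : DifferentiableOn ℂ g U) (h : ∀ z ∈ U, exp (g z) = 1) {x y : ℂ} (hx : x ∈ U)
    (hy : y ∈ U) : g x = g y := by
  refine hU.is_const_of_deriv_eq_zero hU' hg (fun z hz => ?_) hx hy
  have h1 := ((hg z hz).differentiableAt (hU.mem_nhds hz)).hasDerivAt.cexp
  have h2 : HasDerivAt (fun z => exp (g z)) 0 z := by
    refine (hasDerivAt_const z (1 : ℂ)).congr_of_eventuallyEq ?_
    filter_upwards [hU.mem_nhds hz] with w hw using h w hw
  have := h1.unique h2
  simpa [h z hz] using this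

lemma isOpen_upperHalf : IsOpen {z : ℂ | 0 < z.im} := isOpen_lt continuous_const continuous_im

lemma isPreconnected_upperHalf : IsPreconnected {z : ℂ | 0 < z.im} :=
  (convex_halfSpace_im_gt 0).isPreconnected

lemma tendsto_binetMu_mul_I {ε : ℝ} (hε : ε ^ 2 = 1) :
    Tendsto (fun n : ℕ => binetMu (((1 + n : ℝ) : ℂ) * ε * I)) atTop (𝓝 0) := by
  have hε0 : ε ≠ 0 := by rintro rfl; simp at hε
  have h0 : ∀ n : ℕ, ((1 + n : ℝ) : ℂ) * ε * I ∈ slitPlane := fun n => by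
    right
    simp [hε0]
    positivity
  have h1 : ∀ n : ℕ, ‖binetRho (((1 + n : ℝ) : ℂ) * ε * I)‖ ≤
      1 / (1 / 2) ^ 3 * rhoConst * (1 + n : ℝ) ^ (-(3 / 2) : ℝ) := fun n => by
    refine norm_binetRho_le (h0 n) (by norm_num) n.cast_nonneg fun t ht => ?_
    have h2 := (le_abs_self _).trans (abs_re_le_norm (((1 + n : ℝ) : ℂ) * ε * I + t))
    have h3 := abs_im_le_norm (((1 + n : ℝ) : ℂ) * ε * I + t)
    have h4 : |ε| = 1 := by rwa [← sq_eq_sq₀ (abs_nonneg _) zero_le_one, sq_abs, one_pow]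
    simp [-ofReal_add, abs_mul, h4] at h2 h3
    rw [abs_of_nonneg (by positivity)] at h3
    linarith
  have h2 : Tendsto (fun n : ℕ => (1 + n : ℝ) ^ (-(3 / 2) : ℝ)) atTop (𝓝 0) :=
    (tendsto_rpow_neg_atTop (by norm_num)).comp
      (tendsto_atTop_add_const_left _ _ tendsto_natCast_atTop_atTop)
  have h3 := squeeze_zero_norm h1 (by simpa only [mul_zero] using h2.const_mul _)
  have h4 : Tendsto (fun n : ℕ => 1 / (12 * (((1 + n : ℝ) : ℂ) * ε * I))) atTop (𝓝 0) := by
    have := (tendsto_one_div_add_nat 1).const_mul (1 / (12 * ε * I))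
    rw [mul_zero] at this
    refine this.congr fun n => ?_
    push_cast
    field_simp
  have := h4.add h3
  rw [add_zero] at this
  exact this.congr fun n => (binetMu_eq_add_binetRho (h0 n)).symm

/-- The exponentiated formula fixes the difference of both sides up to a constant, and that constant
is 0 because both sides vanish at infinity along the positive imaginary axis. -/
theorem binetMu_add_neg {z : ℂ} (hz : 0 < z.im) :
    binetMu z + binetMu (-z) = -log (1 - e2pi z) := by
  have hslit : ∀ w : ℂ, 0 < w.im → 1 - e2pi w ∈ slitPlane := fun w hw => by
    left
    have := (abs_re_le_norm (e2pi w)).trans_lt (exp_neg_two_pi_lt_one hw)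
    rw [abs_lt] at this
    simp
    linarith
  set g : ℂ → ℂ := fun w => binetMu w + binetMu (-w) + log (1 - e2pi w) with hg
  have hd : DifferentiableOn ℂ g {z : ℂ | 0 < z.im} := fun w hw => by
    have h1 := differentiableAt_binetMu (mem_slitPlane_of_im_pos hw)
    have h2 : DifferentiableAt ℂ (fun w => binetMu (-w)) w :=
      DifferentiableAt.comp (f := fun w : ℂ => -w) w
        (differentiableAt_binetMu (Or.inr (by simpa using ne_of_gt hw))) (by fun_prop)
    have h3 := hslit w hw
    have h4 : DifferentiableAt ℂ (fun w => 1 - e2pi w) w := by unfold e2pi; fun_prop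
    exact ((h1.add h2).add (h4.clog h3)).differentiableWithinAt
  have hexp : ∀ w ∈ {z : ℂ | 0 < z.im}, exp (g w) = 1 := fun w hw => by
    rw [hg]
    simp only
    rw [exp_add, exp_log (one_sub_e2pi_ne_zero hw), exp_binetMu_add_neg hw]
  have hconst : ∀ n : ℕ, g (((1 + n : ℝ) : ℂ) * (1 : ℝ) * I) = g z := fun n =>
    const_of_exp_eq_one isOpen_upperHalf isPreconnected_upperHalf hd hexp
      (by simp; positivity) hz
  have hlim : Tendsto (fun n : ℕ => g (((1 + n : ℝ) : ℂ) * (1 : ℝ) * I)) atTop (𝓝 0) := by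
    have h1 := tendsto_binetMu_mul_I (ε := 1) (by norm_num)
    have h2 := tendsto_binetMu_mul_I (ε := -1) (by norm_num)
    have h3 : Tendsto (fun n : ℕ => e2pi (((1 + n : ℝ) : ℂ) * (1 : ℝ) * I)) atTop (𝓝 0) := by
      rw [tendsto_zero_iff_norm_tendsto_zero]
      have hlin : Tendsto (fun n : ℕ => 2 * Real.pi * (1 + n : ℝ)) atTop atTop :=
        (tendsto_atTop_add_const_left _ _ tendsto_natCast_atTop_atTop).const_mul_atTop
          (by positivity)
      refine (Real.tendsto_exp_neg_atTop_nhds_zero.comp hlin).congr fun n => ?_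
      simp [e2pi, norm_exp]
    have h4 := (h3.const_sub 1).clog (by simp)
    have := (h1.add h2).add h4
    simp only [sub_zero, log_one, add_zero] at this
    refine this.congr fun n => ?_
    simp only [hg]
    congr 3
    push_cast
    ring
  have : g z = 0 := tendsto_nhds_unique (tendsto_const_nhds.congr fun n => (hconst n).symm) hlim
  linear_combination this

/-! ### Binet's integral along rays -/

/-- Besides termwise integration this yields integrability of the sum, which is the absolute
convergence claimed for P^d. -/
lemma integrable_and_hasSum_integral {α : Type*} [MeasurableSpace α] {μ : Measure α}
    {F : ℕ → α → ℂ} {f : α → ℂ} {u : ℕ → ℝ} (hF : ∀ n, Integrable (F n) μ) (hu : Summable u)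
    (hFu : ∀ n, ∫ a, ‖F n a‖ ∂μ ≤ u n) (h : ∀ᵐ a ∂μ, HasSum (fun n => F n a) (f a)) :
    Integrable f μ ∧ HasSum (fun n => ∫ a, F n a ∂μ) (∫ a, f a ∂μ) := by
  have hs : Summable fun n => ∫ a, ‖F n a‖ ∂μ :=
    hu.of_nonneg_of_le (fun n => integral_nonneg fun a => norm_nonneg _) hFu
  have h1 := hasSum_integral_of_summable_integral_norm hF hs
  have h2 : (fun a => ∑' n, F n a) =ᵐ[μ] f := h.mono fun a ha => ha.tsum_eq
  rw [integral_congr_ae h2] at h1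
  refine ⟨⟨aestronglyMeasurable_of_tendsto_ae atTop
    (f := fun N a => ∑ n ∈ Finset.range N, F n a)
    (fun N => Finset.aestronglyMeasurable_fun_sum _ fun n _ => (hF n).1)
    (h.mono fun a ha => ha.tendsto_sum_nat), ?_⟩, h1⟩
  have h3 : ∫⁻ a, ‖f a‖ₑ ∂μ ≤ ∫⁻ a, ∑' n, ‖F n a‖ₑ ∂μ := by
    refine lintegral_mono_ae (h.mono fun a ha => ?_)
    rw [← ha.tsum_eq]
    exact enorm_tsum_le_tsum_enorm
  refine h3.trans_lt ?_
  rw [lintegral_tsum fun n => (hF n).1.enorm]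
  have h4 : ∀ n, ∫⁻ a, ‖F n a‖ₑ ∂μ = ENNReal.ofReal (∫ a, ‖F n a‖ ∂μ) := fun n =>
    (ofReal_integral_norm_eq_lintegral_enorm (hF n)).symm
  simp only [h4]
  exact hs.tsum_ofReal_lt_top

lemma integrableOn_mul_exp_neg {c : ℝ} (hc : 0 < c) :
    IntegrableOn (fun r : ℝ => r * Real.exp (-(c * r))) (Ioi 0) := by
  have := integrableOn_rpow_mul_exp_neg_mul_rpow (s := 1) (p := 1) (by norm_num) one_pos hc
  refine this.congr_fun (fun r _ => by simp) measurableSet_Ioi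

lemma integral_mul_exp_neg {c : ℝ} (hc : 0 < c) :
    ∫ r in Ioi (0 : ℝ), r * Real.exp (-(c * r)) = 1 / c ^ 2 := by
  have := Real.integral_rpow_mul_exp_neg_mul_Ioi (a := 2) two_pos hc
  norm_num at this
  simpa using this

lemma norm_exp_neg_mul (c : ℂ) (r : ℝ) : ‖exp (-(c * r))‖ = Real.exp (-(c.re * r)) := by
  simp [norm_exp]

lemma integrableOn_mul_cexp_neg {c : ℂ} (hc : 0 < c.re) :
    IntegrableOn (fun r : ℝ => (r : ℂ) * exp (-(c * r))) (Ioi 0) := by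
  refine (integrableOn_mul_exp_neg hc).mono' (by fun_prop) ?_
  refine (ae_restrict_iff' measurableSet_Ioi).2 (ae_of_all _ fun r hr => ?_)
  rw [norm_mul, norm_real, norm_exp_neg_mul, Real.norm_of_nonneg (le_of_lt hr)]

lemma integral_mul_cexp_neg {c : ℂ} (hc : 0 < c.re) :
    ∫ r in Ioi (0 : ℝ), (r : ℂ) * exp (-(c * r)) = 1 / c ^ 2 := by
  have hc0 : c ≠ 0 := by rintro rfl; simp at hc
  have hd : ∀ r ∈ Ici (0 : ℝ), HasDerivAt (fun r : ℝ => -((r : ℂ) / c + 1 / c ^ 2) * exp (-(c * r)))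
      ((r : ℂ) * exp (-(c * r))) r := by
    intro r _
    have h1 : HasDerivAt (fun w : ℂ => -(w / c + 1 / c ^ 2)) (-(1 / c)) (r : ℂ) :=
      (((hasDerivAt_id (r : ℂ)).div_const c).add_const (1 / c ^ 2)).neg
    have h2 : HasDerivAt (fun w : ℂ => -(c * w)) (-c) (r : ℂ) := by
      convert! ((hasDerivAt_id (r : ℂ)).const_mul c).neg using 1
      ring
    have h3 := (h1.mul h2.cexp).comp_ofReal
    convert! h3 using 1
    field_simp
    ring
  have hlim : Tendsto (fun r : ℝ => -((r : ℂ) / c + 1 / c ^ 2) * exp (-(c * r))) atTop (𝓝 0) := by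
    rw [tendsto_zero_iff_norm_tendsto_zero]
    have h1 : Tendsto (fun r : ℝ => (r / ‖c‖ + 1 / ‖c‖ ^ 2) * Real.exp (-(c.re * r))) atTop
        (𝓝 0) := by
      have h2 := tendsto_rpow_mul_exp_neg_mul_atTop_nhds_zero 1 c.re hc
      have h3 := tendsto_rpow_mul_exp_neg_mul_atTop_nhds_zero 0 c.re hc
      have := (h2.mul_const (1 / ‖c‖)).add (h3.mul_const (1 / ‖c‖ ^ 2))
      simp only [Real.rpow_one, Real.rpow_zero, zero_mul, add_zero] at this
      refine this.congr fun r => ?_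
      rw [neg_mul]
      ring
    refine squeeze_zero' (Eventually.of_forall fun r => norm_nonneg _) ?_ h1
    filter_upwards [eventually_ge_atTop 0] with r hr
    rw [norm_mul, norm_exp_neg_mul, norm_neg]
    gcongr
    refine (norm_add_le _ _).trans (le_of_eq ?_)
    rw [norm_div, norm_div, norm_pow, norm_one, norm_real, Real.norm_of_nonneg hr]
  rw [integral_Ioi_of_hasDerivAt_of_tendsto' hd (integrableOn_mul_cexp_neg hc) hlim]
  simp

/-- The function `1/2 + 1/(e^u - 1) - 1/u` of Binet's first integral. -/
def binetKernel (u : ℂ) : ℂ := 1 / 2 + 1 / (exp u - 1) - 1 / u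

/-- Multiplication by 1 - e^{-u} turns the kernel into a Laplace transform of the weight s(1 - s)/2
from `gudermannTerm_eq_integral`. It also yields bounds that remain good as u → 0. -/
lemma binetKernel_mul_one_sub_exp {u : ℂ} (hu : 0 < u.re) :
    (1 - exp (-u)) * binetKernel u =
      u ^ 2 * ∫ s in (0 : ℝ)..1, (s : ℂ) * (1 - s) / 2 * exp (-(u * s)) := by
  have hu0 : u ≠ 0 := by rintro rfl; simp at hu
  have he : exp u - 1 ≠ 0 := by
    intro h
    have h1 : ‖exp u‖ = 1 := by rw [sub_eq_zero.1 h, norm_one]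
    rw [norm_exp, Real.exp_eq_one_iff] at h1
    exact hu.ne' h1
  rw [integral_of_hasDerivAt_ofReal (f := fun s => s * (1 - s) / 2 * exp (-(u * s)))
    (F := fun s => (s ^ 2 / (2 * u) + (1 / u ^ 2 - 1 / (2 * u)) * s + (1 / u ^ 3 - 1 / (2 * u ^ 2)))
      * exp (-(u * s)))]
  · have h1 : exp (-u) * exp u = 1 := by rw [← exp_add]; simp
    have h2 : (1 - exp (-u)) * (1 / (exp u - 1)) = exp (-u) := by
      field_simp
      linear_combination -h1
    rw [binetKernel]
    have h3 : (1 - exp (-u)) * (1 / 2 + 1 / (exp u - 1) - 1 / u) =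
      (1 - exp (-u)) * (1 / (exp u - 1)) + (1 - exp (-u)) * (1 / 2 - 1 / u) := by ring
    rw [h3, h2]
    simp
    field_simp
    ring
  · intro s _
    have h2 : HasDerivAt (fun w : ℂ => -(u * w)) (-u) (s : ℂ) := by
      convert! ((hasDerivAt_id (s : ℂ)).const_mul u).neg using 1
      ring
    have h3 : HasDerivAt (fun w : ℂ => w ^ 2 / (2 * u) + (1 / u ^ 2 - 1 / (2 * u)) * w +
        (1 / u ^ 3 - 1 / (2 * u ^ 2))) (2 * s / (2 * u) + (1 / u ^ 2 - 1 / (2 * u))) (s : ℂ) := by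
      convert! ((((hasDerivAt_id (s : ℂ)).pow 2).div_const (2 * u)).add
        ((hasDerivAt_id (s : ℂ)).const_mul (1 / u ^ 2 - 1 / (2 * u)))).add_const
          (1 / u ^ 3 - 1 / (2 * u ^ 2)) using 1
      simp
    convert! h3.mul h2.cexp using 1
    field_simp
    ring
  · fun_prop

lemma norm_binetKernel_mul_le {u : ℂ} (hu : 0 < u.re) :
    ‖(1 - exp (-u)) * binetKernel u‖ ≤ ‖u‖ ^ 2 := by
  rw [binetKernel_mul_one_sub_exp hu, norm_mul, norm_pow]
  refine mul_le_of_le_one_right (by positivity) ?_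
  refine (intervalIntegral.norm_integral_le_of_norm_le_const (C := 1) ?_).trans (by simp)
  intro s hs
  rw [uIoc_of_le zero_le_one] at hs
  have h1 : (s : ℂ) * (1 - s) / 2 = ((s * (1 - s) / 2 : ℝ) : ℂ) := by simp
  rw [norm_mul, norm_exp_neg_mul, h1, norm_real, Real.norm_eq_abs]
  refine mul_le_one₀ ?_ (Real.exp_nonneg _) ?_
  · rw [abs_le]
    constructor <;> nlinarith [hs.1, hs.2, mul_nonneg hs.1.le (sub_nonneg.2 hs.2)]
  · rw [Real.exp_le_one_iff]
    have := mul_nonneg hu.le hs.1.le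
    linarith

lemma norm_one_sub_exp_neg_ge {u : ℂ} (hu : 0 < u.re) :
    u.re / (1 + u.re) ≤ ‖1 - exp (-u)‖ := by
  have h1 : 1 - Real.exp (-u.re) ≤ ‖1 - exp (-u)‖ := by
    have := norm_sub_norm_le (1 : ℂ) (exp (-u))
    rwa [norm_one, norm_exp, neg_re] at this
  refine le_trans ?_ h1
  have h2 : Real.exp (-u.re) ≤ 1 / (1 + u.re) := by
    rw [Real.exp_neg, ← one_div]
    exact one_div_le_one_div_of_le (by positivity) (by linarith [Real.add_one_le_exp u.re])
  have h3 : u.re / (1 + u.re) = 1 - 1 / (1 + u.re) := by field_simp; ring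
  linarith

lemma one_add_le_exp {ε x a : ℝ} (hε : 0 < ε) (hx : 0 ≤ x) (ha : 0 ≤ a) :
    1 + a * x ≤ (1 + a / ε) * Real.exp (ε * x) := by
  have h1 := Real.add_one_le_exp (ε * x)
  have h2 : a * x = a / ε * (ε * x) := by field_simp
  have h3 : 0 ≤ a / ε := by positivity
  have h4 : 0 ≤ ε * x := by positivity
  nlinarith [mul_nonneg h3 h4]

lemma norm_binetKernel_div_le {ω : ℂ} (hω : 0 < ω.re) {ε : ℝ} (hε : 0 < ε) :
    ∃ K : ℝ, 0 ≤ K ∧ ∀ r : ℝ, 0 < r → ‖binetKernel (ω * r) / r‖ ≤ K * Real.exp (ε * r) := by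
  -- Dividing the bound ‖u‖² by |1 - e^{-u}| ≥ Re u/(1 + Re u), with u = ωr, leaves linear growth in
  -- r; the last factor trades it for e^{εr}.
  refine ⟨‖ω‖ ^ 2 / ω.re * (1 + ω.re / ε), by positivity, fun r hr => ?_⟩
  have hre : (ω * r).re = ω.re * r := by simp
  have hu : 0 < (ω * r).re := by rw [hre]; positivity
  have h1 := norm_binetKernel_mul_le hu
  have h2 := norm_one_sub_exp_neg_ge hu
  rw [norm_mul] at h1
  rw [hre] at h2
  have h3 := (mul_le_mul_of_nonneg_right h2 (norm_nonneg _)).trans h1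
  rw [div_mul_eq_mul_div, div_le_iff₀ (by positivity), norm_mul, norm_real,
    Real.norm_of_nonneg hr.le] at h3
  rw [norm_div, norm_real, Real.norm_of_nonneg hr.le]
  have h4 := one_add_le_exp hε hr.le hω.le
  have h5 : ‖binetKernel (ω * r)‖ / r ≤ ‖ω‖ ^ 2 / ω.re * (1 + ω.re * r) := by
    rw [div_le_iff₀ hr, div_mul_eq_mul_div, div_mul_eq_mul_div, le_div_iff₀ hω]
    refine le_of_mul_le_mul_right ?_ hr
    calc _ = ω.re * r * ‖binetKernel (ω * r)‖ := by ring
      _ ≤ _ := h3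
      _ = _ := by ring
  refine h5.trans ?_
  rw [mul_assoc]
  gcongr

lemma slitPlane_of_re_mul_pos {ω z : ℂ} (hω : 0 < ω.re) (hz : 0 < (ω * z).re) :
    z ∈ slitPlane := by
  by_contra h
  rw [mem_slitPlane_iff, not_or, not_lt, not_not] at h
  rw [mul_re, h.2, mul_zero, sub_zero] at hz
  nlinarith [h.1]

lemma measurable_binetKernel : Measurable binetKernel := by
  unfold binetKernel
  fun_prop

lemma re_mul_add_pos {ω z : ℂ} (hω : 0 < ω.re) (hz : 0 < (ω * z).re) {t : ℝ} (ht : 0 ≤ t) :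
    0 < (ω * (z + t)).re := by
  have : (ω * (z + t)).re = (ω * z).re + ω.re * t := by simp [mul_add]
  rw [this]
  positivity

/-- Fubini: for c = ω(z + s) the inner integral of r e^{-cr} is 1/c², which restores the integral
form of Gudermann's term. -/
lemma integral_ray_gudermannTerm {ω z : ℂ} (hω : 0 < ω.re) (hz : 0 < (ω * z).re) :
    ∫ r in Ioi (0 : ℝ), exp (-(ω * z * r)) * ((1 - exp (-(ω * r))) * binetKernel (ω * r)) / r =
      gudermannTerm z := by
  have hω0 : ω ≠ 0 := by rintro rfl; simp at hω
  have h1 : ∀ r ∈ Ioi (0 : ℝ),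
      exp (-(ω * z * r)) * ((1 - exp (-(ω * r))) * binetKernel (ω * r)) / r =
      ∫ s in (0 : ℝ)..1, (s : ℂ) * (1 - s) / 2 * (ω ^ 2 * (r * exp (-(ω * (z + s) * r)))) := by
    intro r hr
    have hr0 : (r : ℂ) ≠ 0 := by exact_mod_cast (ne_of_gt hr)
    have hre : 0 < (ω * r).re := by simpa using mul_pos hω hr
    rw [binetKernel_mul_one_sub_exp hre, ← intervalIntegral.integral_const_mul,
      ← intervalIntegral.integral_const_mul, ← intervalIntegral.integral_div]
    congr 1 with s
    have : exp (-(ω * (z + s) * r)) = exp (-(ω * z * r)) * exp (-(ω * r * s)) := by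
      rw [← exp_add]; congr 1; ring
    rw [this]
    field_simp
  rw [setIntegral_congr_fun measurableSet_Ioi h1]
  rw [← MeasureTheory.intervalIntegral_integral_swap]
  · rw [gudermannTerm_eq_integral (slitPlane_of_re_mul_pos hω hz)]
    refine intervalIntegral.integral_congr fun s hs => ?_
    rw [uIcc_of_le zero_le_one] at hs
    have h2 := re_mul_add_pos hω hz hs.1
    rw [integral_const_mul, integral_const_mul, integral_mul_cexp_neg h2]
    have : z + s ≠ 0 := by rintro h; rw [h] at h2; simp at h2
    field_simp
  · have hb : Integrable (fun p : ℝ × ℝ => ‖ω‖ ^ 2 * (p.2 * Real.exp (-((ω * z).re * p.2))))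
        ((volume.restrict (uIoc (0 : ℝ) 1)).prod (volume.restrict (Ioi (0 : ℝ)))) := by
      have : IsFiniteMeasure (volume.restrict (uIoc (0 : ℝ) 1)) := by
        rw [uIoc_of_le zero_le_one]; infer_instance
      simpa using (integrable_const (1 : ℝ)).mul_prod
        ((integrableOn_mul_exp_neg hz).const_mul (‖ω‖ ^ 2))
    refine hb.mono' (Continuous.aestronglyMeasurable ?_) ?_
    · unfold Function.uncurry
      fun_prop
    · rw [Measure.prod_restrict]
      refine (ae_restrict_iff' (measurableSet_uIoc.prod measurableSet_Ioi)).2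
        (ae_of_all _ fun p hp => ?_)
      obtain ⟨hs, hr⟩ := hp
      rw [uIoc_of_le zero_le_one] at hs
      have h1 : (p.1 : ℂ) * (1 - p.1) / 2 = ((p.1 * (1 - p.1) / 2 : ℝ) : ℂ) := by simp
      have h2 : ‖((p.1 * (1 - p.1) / 2 : ℝ) : ℂ)‖ ≤ 1 := by
        rw [norm_real, Real.norm_eq_abs, abs_le]
        constructor <;> nlinarith [hs.1, hs.2, mul_nonneg hs.1.le (sub_nonneg.2 hs.2)]
      simp only [Function.uncurry]
      have hr' : 0 ≤ p.2 := le_of_lt hr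
      rw [h1, norm_mul, norm_mul, norm_pow, norm_mul, norm_exp_neg_mul, norm_real p.2,
        Real.norm_of_nonneg hr']
      have h3 : (ω * (z + p.1)).re = (ω * z).re + ω.re * p.1 := by simp [mul_add]
      refine (mul_le_of_le_one_left (by positivity) h2).trans ?_
      rw [h3]
      gcongr
      nlinarith [mul_nonneg hω.le hs.1.le]

lemma aestronglyMeasurable_ray (ω z : ℂ) (g : ℝ → ℂ) (hg : Measurable g) :
    AEStronglyMeasurable (fun r : ℝ => exp (-(ω * z * r)) * (g r * (binetKernel (ω * r) / r)))
      (volume.restrict (Ioi 0)) := by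
  have := measurable_binetKernel
  apply Measurable.aestronglyMeasurable
  fun_prop

theorem integrableOn_binet {ω z : ℂ} (hω : 0 < ω.re) (hz : 0 < (ω * z).re) :
    IntegrableOn (fun r : ℝ => exp (-(ω * z * r)) * (binetKernel (ω * r) / r)) (Ioi 0) := by
  obtain ⟨K, hK, h⟩ := norm_binetKernel_div_le hω (half_pos hz)
  have hb : IntegrableOn (fun r : ℝ => K * Real.exp (-((ω * z).re / 2) * r)) (Ioi 0) :=
    (integrableOn_exp_mul_Ioi (by linarith) 0).const_mul K
  refine hb.mono' (by simpa using aestronglyMeasurable_ray ω z 1 measurable_one) ?_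
  refine (ae_restrict_iff' measurableSet_Ioi).2 (ae_of_all _ fun r hr => ?_)
  rw [norm_mul, norm_exp_neg_mul]
  refine (mul_le_mul_of_nonneg_left (h r hr) (Real.exp_nonneg _)).trans (le_of_eq ?_)
  rw [mul_left_comm, ← Real.exp_add]
  congr 2
  ring

/-- Binet's first formula, along the ray with direction `ω`. -/
theorem integral_binet {ω z : ℂ} (hω : 0 < ω.re) (hz : 0 < (ω * z).re) :
    ∫ r in Ioi (0 : ℝ), exp (-(ω * z * r)) * (binetKernel (ω * r) / r) = binetMu z := by
  have hω0 : ω ≠ 0 := by rintro rfl; simp at hω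
  -- The geometric series of 1/(1 - e^{-ωr}): the n-th piece integrates to Gudermann's term at z +
  -- n.
  set F : ℕ → ℝ → ℂ := fun n r =>
    exp (-(ω * (z + n) * r)) * ((1 - exp (-(ω * r))) * binetKernel (ω * r)) / r with hF
  have hpos : ∀ n : ℕ, 0 < (ω * (z + n)).re := fun n => by
    simpa using re_mul_add_pos hω hz n.cast_nonneg
  have hbound : ∀ n : ℕ, ∀ r ∈ Ioi (0 : ℝ),
      ‖F n r‖ ≤ ‖ω‖ ^ 2 * (r * Real.exp (-((ω * (z + n)).re * r))) := by
    intro n r hr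
    have hr' : 0 < r := hr
    have hre : 0 < (ω * r).re := by simpa using mul_pos hω hr'
    have h1 := norm_binetKernel_mul_le hre
    rw [hF]
    simp only
    rw [norm_div, norm_mul, norm_exp_neg_mul, norm_real, Real.norm_of_nonneg hr'.le,
      div_le_iff₀ hr']
    rw [norm_mul ω, norm_real, Real.norm_of_nonneg hr'.le] at h1
    calc _ ≤ Real.exp (-((ω * (z + n)).re * r)) * (‖ω‖ * r) ^ 2 := by gcongr
      _ = _ := by ring
  have hint : ∀ n, IntegrableOn (F n) (Ioi 0) := by
    intro n
    refine ((integrableOn_mul_exp_neg (hpos n)).const_mul (‖ω‖ ^ 2)).mono' ?_ ?_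
    · have := aestronglyMeasurable_ray ω (z + n) (fun r => 1 - exp (-(ω * r))) (by fun_prop)
      refine this.congr (ae_of_all _ fun r => ?_)
      simp only [hF]
      ring
    · exact (ae_restrict_iff' measurableSet_Ioi).2 (ae_of_all _ (hbound n))
  set c := min (ω * z).re ω.re with hc
  have hc0 : 0 < c := lt_min hz hω
  have hle : ∀ n, ∫ r in Ioi (0 : ℝ), ‖F n r‖ ≤ ‖ω‖ ^ 2 * (1 / c ^ 2) * (1 / (1 + n : ℝ) ^ 2) := by
    intro n
    refine (setIntegral_mono_on (hint n).norm
      ((integrableOn_mul_exp_neg (hpos n)).const_mul (‖ω‖ ^ 2)) measurableSet_Ioi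
      (hbound n)).trans ?_
    rw [integral_const_mul, integral_mul_exp_neg (hpos n), mul_assoc, one_div_mul_one_div,
      ← mul_pow]
    gcongr
    have : (ω * (z + n)).re = (ω * z).re + ω.re * n := by simp [mul_add]
    rw [this, mul_add, mul_one]
    gcongr
    · exact min_le_left _ _
    · exact min_le_right _ _
  have := (integrable_and_hasSum_integral hint
    (summable_one_div_one_add_sq.mul_left _) hle (f := fun r : ℝ =>
      exp (-(ω * z * r)) * (binetKernel (ω * r) / r)) ?_).2
  · rw [← this.tsum_eq, binetMu]
    exact tsum_congr fun n => integral_ray_gudermannTerm hω (hpos n)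
  · refine (ae_restrict_iff' measurableSet_Ioi).2 (ae_of_all _ fun r hr => ?_)
    have hre : 0 < (ω * r).re := by simpa using mul_pos hω hr
    have hq : ‖exp (-(ω * r))‖ < 1 := by
      rw [norm_exp, Real.exp_lt_one_iff, neg_re]
      linarith
    have h1 := (hasSum_geometric_of_norm_lt_one hq).mul_left
      (exp (-(ω * z * r)) * ((1 - exp (-(ω * r))) * binetKernel (ω * r)) / r)
    have hne : 1 - exp (-(ω * r)) ≠ 0 := by
      intro h
      rw [← sub_eq_zero.1 h, norm_one] at hq
      exact lt_irrefl _ hq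
    convert! h1 using 1
    · ext n
      rw [hF]
      simp only
      rw [← exp_nat_mul]
      have : exp (-(ω * (z + n) * r)) = exp (-(ω * z * r)) * exp (n * -(ω * r)) := by
        rw [← exp_add]; congr 1; ring
      rw [this]
      ring
    · field_simp

/-! ### The integrals along rays as a series -/

/-- The terms of the expansion of the ray integrals. -/
def pairTerm (k : ℕ) (p : ℂ × ℂ) : ℂ :=
  binetMu ((k + 1 - p.2) / p.1) - binetMu ((k + 1 + p.2) / p.1)

/-- The series `∑_{k ≥ 1} (μ((k - ξ)/τ) - μ((k + ξ)/τ))`. -/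
def seriesP (p : ℂ × ℂ) : ℂ := ∑' k : ℕ, pairTerm k p

/-- The condition on a direction `ω` for the ray integral to converge. -/
def RayAdmissible (ω τ ξ : ℂ) : Prop :=
  0 < ω.re ∧ 0 < (ω / τ).re ∧ |(ω * ξ / τ).re| < (ω / τ).re

/-- Mean value inequality on a vertical strip. The factor ‖v‖, proportional to r in the application,
makes the k-th integral O(1/k²) and not merely O(1/k). -/
lemma norm_exp_sub_exp_neg_le (v : ℂ) :
    ‖exp v - exp (-v)‖ ≤ 2 * ‖v‖ * Real.exp |v.re| := by
  have hconv : Convex ℝ {z : ℂ | |z.re| ≤ |v.re|} := by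
    have : {z : ℂ | |z.re| ≤ |v.re|} = Complex.reLm ⁻¹' (Icc (-|v.re|) |v.re|) := by
      ext z
      simp [abs_le]
    rw [this]
    exact (convex_Icc _ _).linear_preimage _
  have := hconv.norm_image_sub_le_of_norm_deriv_le (𝕜 := ℂ) (f := exp) (C := Real.exp |v.re|)
    (x := -v) (y := v) (fun z _ => differentiableAt_exp) (fun z hz => by
      rw [Complex.deriv_exp, norm_exp]
      exact Real.exp_le_exp.2 ((le_abs_self _).trans hz)) (by simp) (by simp)
  refine this.trans (le_of_eq ?_)
  rw [sub_neg_eq_add, ← two_mul, norm_mul]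
  simp
  ring

lemma RayAdmissible.re_pos {ω τ ξ : ℂ} (h : RayAdmissible ω τ ξ) (k : ℕ) :
    0 < (ω * ((k + 1 - ξ) / τ)).re ∧ 0 < (ω * ((k + 1 + ξ) / τ)).re := by
  obtain ⟨-, h1, h2⟩ := h
  have e1 : ω * ((k + 1 - ξ) / τ) = ((k + 1 : ℝ) : ℂ) * (ω / τ) - ω * ξ / τ := by
    push_cast; ring
  have e2 : ω * ((k + 1 + ξ) / τ) = ((k + 1 : ℝ) : ℂ) * (ω / τ) + ω * ξ / τ := by
    push_cast; ring
  rw [abs_lt] at h2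
  rw [e1, e2, sub_re, add_re, re_ofReal_mul]
  have hk : (0 : ℝ) ≤ k := k.cast_nonneg
  have := mul_nonneg hk h1.le
  constructor <;> nlinarith [h2.1, h2.2]

/-- Geometric expansion of 1/(e^{ωr/τ} - 1); each term is a difference of two Binet integrals in the
direction ω, at (k + 1 ∓ ξ)/τ. -/
lemma RayAdmissible.integrable_and_hasSum {ω τ ξ : ℂ} (h : RayAdmissible ω τ ξ) :
    IntegrableOn (fun r : ℝ => (exp (ω * ξ / τ * r) - exp (-(ω * ξ / τ * r))) /
      (exp (ω / τ * r) - 1) * (binetKernel (ω * r) / r)) (Ioi 0) ∧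
    HasSum (fun k => pairTerm k (τ, ξ))
      (∫ r in Ioi (0 : ℝ), (exp (ω * ξ / τ * r) - exp (-(ω * ξ / τ * r))) /
      (exp (ω / τ * r) - 1) * (binetKernel (ω * r) / r)) := by
  have hre := h.re_pos
  obtain ⟨hω, ha, hb⟩ := h
  set a := (ω / τ).re with hadef
  set v := ω * ξ / τ with hv
  set b := |v.re| with hbdef
  -- The kernel may grow at a rate of half the gap a - b; the other half remains as exponential
  -- decay.
  obtain ⟨K, hK, hker⟩ := norm_binetKernel_div_le hω (half_pos (sub_pos.2 hb))
  set F : ℕ → ℝ → ℂ := fun k r =>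
    exp (-(ω * ((k + 1 - ξ) / τ) * r)) * (binetKernel (ω * r) / r) -
    exp (-(ω * ((k + 1 + ξ) / τ) * r)) * (binetKernel (ω * r) / r) with hF
  have hFalt : ∀ (k : ℕ) (r : ℝ), F k r = exp (-(((k + 1 : ℝ) : ℂ) * (ω / τ) * r)) *
      (exp (v * r) - exp (-(v * r))) * (binetKernel (ω * r) / r) := by
    intro k r
    have e1 : exp (-(ω * ((k + 1 - ξ) / τ) * r)) =
        exp (-(((k + 1 : ℝ) : ℂ) * (ω / τ) * r)) * exp (v * r) := by
      rw [← exp_add]; congr 1; rw [hv]; push_cast; ring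
    have e2 : exp (-(ω * ((k + 1 + ξ) / τ) * r)) =
        exp (-(((k + 1 : ℝ) : ℂ) * (ω / τ) * r)) * exp (-(v * r)) := by
      rw [← exp_add]; congr 1; rw [hv]; push_cast; ring
    simp only [hF]
    rw [e1, e2]
    ring
  have hint : ∀ k, IntegrableOn (F k) (Ioi 0) := fun k =>
    (integrableOn_binet hω (hre k).1).sub (integrableOn_binet hω (hre k).2)
  have hFint : ∀ k, ∫ r in Ioi (0 : ℝ), F k r = pairTerm k (τ, ξ) := fun k => by
    rw [pairTerm, ← integral_binet hω (hre k).1, ← integral_binet hω (hre k).2]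
    exact integral_sub (integrableOn_binet hω (hre k).1) (integrableOn_binet hω (hre k).2)
  set c := (a - b) / 2 with hc
  have hc0 : 0 < c := half_pos (sub_pos.2 hb)
  have hbound : ∀ k : ℕ, ∀ r ∈ Ioi (0 : ℝ),
      ‖F k r‖ ≤ 2 * ‖v‖ * K * (r * Real.exp (-((c * (1 + k)) * r))) := by
    intro k r hr
    have hr' : 0 < r := hr
    have h1 : ‖exp (v * r) - exp (-(v * r))‖ ≤ 2 * (‖v‖ * r) * Real.exp (b * r) := by
      refine (norm_exp_sub_exp_neg_le _).trans (le_of_eq ?_)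
      rw [norm_mul, norm_real, Real.norm_of_nonneg hr'.le, re_mul_ofReal, abs_mul,
        abs_of_pos hr']
    have h2 : ‖exp (-(((k + 1 : ℝ) : ℂ) * (ω / τ) * r))‖ = Real.exp (-((k + 1) * a * r)) := by
      rw [norm_exp_neg_mul, re_ofReal_mul]
    rw [hFalt, norm_mul, norm_mul, h2]
    have h3 : (k + 1) * a - b - c ≥ c * (1 + k) := by
      rw [hc]
      have hk : (0 : ℝ) ≤ k := k.cast_nonneg
      have hb0 : 0 ≤ b := abs_nonneg _
      nlinarith [mul_nonneg hk ha.le, mul_nonneg hk hb0]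
    calc _ ≤ Real.exp (-((k + 1) * a * r)) * (2 * (‖v‖ * r) * Real.exp (b * r)) *
          (K * Real.exp (c * r)) := by
          gcongr
          exact hker r hr'
      _ = 2 * ‖v‖ * K * (r * Real.exp (-((k + 1) * a - b - c) * r)) := by
          have : Real.exp (-((k + 1) * a - b - c) * r) =
              Real.exp (-((k + 1) * a * r)) * Real.exp (b * r) * Real.exp (c * r) := by
            rw [← Real.exp_add, ← Real.exp_add]; congr 1; ring
          rw [this]
          ring
      _ ≤ _ := by
          gcongr
          nlinarith
  have hle : ∀ k : ℕ, ∫ r in Ioi (0 : ℝ), ‖F k r‖ ≤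
      2 * ‖v‖ * K * (1 / c ^ 2) * (1 / (1 + k : ℝ) ^ 2) := by
    intro k
    have hck : 0 < c * (1 + k) := by positivity
    refine (setIntegral_mono_on (hint k).norm
      ((integrableOn_mul_exp_neg hck).const_mul _) measurableSet_Ioi (hbound k)).trans ?_
    rw [integral_const_mul, integral_mul_exp_neg hck, mul_assoc _ (1 / c ^ 2),
      one_div_mul_one_div, ← mul_pow]
  have := integrable_and_hasSum_integral hint
    (summable_one_div_one_add_sq.mul_left (2 * ‖v‖ * K * (1 / c ^ 2))) hle
    (f := fun r : ℝ => (exp (v * r) - exp (-(v * r))) / (exp (ω / τ * r) - 1) *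
      (binetKernel (ω * r) / r)) ?_
  · simp only [hFint] at this
    exact this
  · refine (ae_restrict_iff' measurableSet_Ioi).2 (ae_of_all _ fun r hr => ?_)
    have hq : ‖exp (-(ω / τ * r))‖ < 1 := by
      rw [norm_exp_neg_mul, Real.exp_lt_one_iff]
      have := mul_pos ha hr
      linarith
    have h1 := (hasSum_geometric_of_norm_lt_one hq).mul_left
      (exp (-(ω / τ * r)) * (exp (v * r) - exp (-(v * r))) * (binetKernel (ω * r) / r))
    have hne : 1 - exp (-(ω / τ * r)) ≠ 0 := by
      intro h
      rw [← sub_eq_zero.1 h, norm_one] at hq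
      exact lt_irrefl _ hq
    have he : exp (ω / τ * r) * exp (-(ω / τ * r)) = 1 := by rw [← exp_add]; simp
    have hne2 : exp (ω / τ * r) - 1 ≠ 0 := by
      intro h
      rw [sub_eq_zero.1 h, one_mul] at he
      rw [he] at hne
      simp at hne
    convert! h1 using 1
    · ext k
      rw [hFalt, ← exp_nat_mul]
      have : exp (-(((k + 1 : ℝ) : ℂ) * (ω / τ) * r)) =
          exp (-(ω / τ * r)) * exp (k * -(ω / τ * r)) := by
        rw [← exp_add]; congr 1; push_cast; ring
      rw [this]
      ring
    · have : (exp (ω / τ * r) - 1)⁻¹ = exp (-(ω / τ * r)) * (1 - exp (-(ω / τ * r)))⁻¹ := by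
        rw [inv_eq_iff_eq_inv, mul_inv, inv_inv, eq_comm, inv_mul_eq_div, div_eq_iff (exp_ne_zero _)]
        linear_combination -he
      rw [div_eq_mul_inv, this]
      ring

/-- The direction `i e^{id}`. -/
def rayDirection (d : ℝ) : ℂ := I * exp (I * d)

/-- With u = it one has cot(t/2) - 2/t = 2i `binetKernel u`, and this 2i cancels the denominator of
the sine. -/
lemma rayKernel_eq {d : ℝ} (τ ξ : ℂ) {r : ℝ} (hr : 0 < r) (hd : 0 < (rayDirection d).re) :
    rayKernel d τ ξ r =
      (exp (rayDirection d * ξ / τ * r) - exp (-(rayDirection d * ξ / τ * r))) /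
      (exp (rayDirection d / τ * r) - 1) * (binetKernel (rayDirection d * r) / r) := by
  have hr0 : (r : ℂ) ≠ 0 := by exact_mod_cast hr.ne'
  set e := exp (I * d) with he
  have he0 : e ≠ 0 := exp_ne_zero _
  have hu : 0 < (rayDirection d * r).re := by simpa using mul_pos hd hr
  have hne : exp (rayDirection d * r) - 1 ≠ 0 := by
    intro h
    have h1 : ‖exp (rayDirection d * r)‖ = 1 := by rw [sub_eq_zero.1 h, norm_one]
    rw [norm_exp, Real.exp_eq_one_iff] at h1
    exact hu.ne' h1
  have hne' : 1 - exp (rayDirection d * r) ≠ 0 := by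
    intro h; apply hne; linear_combination -h
  rw [rayKernel, kernelP, Complex.cot_eq_exp_ratio, sin, ← he]
  have e1 : -(ξ / τ * (r * e)) * I = -(rayDirection d * ξ / τ * r) := by
    rw [rayDirection, ← he]; ring
  have e2 : ξ / τ * (r * e) * I = rayDirection d * ξ / τ * r := by
    rw [rayDirection, ← he]; ring
  have e3 : I * (r * e) / τ = rayDirection d / τ * r := by
    rw [rayDirection, ← he]; ring
  have e4 : 2 * I * (r * e / 2) = rayDirection d * r := by
    rw [rayDirection, ← he]; ring
  rw [e1, e2, e3, e4, binetKernel]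
  have e5 : e = -I * rayDirection d := by
    rw [rayDirection, ← he, ← mul_assoc]; simp
  have hd0 : rayDirection d ≠ 0 := by intro h; rw [h] at hd; simp at hd
  rw [e5]
  set w := rayDirection d with hw
  set A := exp (w * ξ / τ * r) with hA
  set B := exp (-(w * ξ / τ * r)) with hB
  set D := exp (w / τ * r) - 1 with hD
  set U := exp (w * r) with hU
  have key : (B - A) * I / 2 * ((U + 1) / (I * (1 - U)) - 2 / (r * (-I * w))) =
      (A - B) * (1 / 2 + 1 / (U - 1) - 1 / (w * r)) := by
    have h2 : 1 / (1 - U) = -(1 / (U - 1)) := by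
      rw [← neg_sub, one_div_neg_eq_neg_one_div]
    have h3 : (U + 1) * (1 / (U - 1)) = 1 + 2 * (1 / (U - 1)) := by field_simp; ring
    have h4 : (U + 1) / (I * (1 - U)) = I * (1 + 2 * (1 / (U - 1))) := by
      rw [← h3, div_eq_mul_one_div, ← one_div_mul_one_div, h2, one_div I, inv_I]
      ring
    have h5 : 2 / (r * (-I * w)) = 2 * I * (1 / (w * r)) := by
      field_simp
      linear_combination -I_sq
    rw [h4, h5]
    linear_combination (B - A) / 2 * (1 + 2 * (1 / (U - 1)) - 2 * (1 / (w * r))) * I_sq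
  have hI : (-I * w) / (r * (-I * w)) = 1 / r := by field_simp
  calc _ = (B - A) * I / 2 * ((U + 1) / (I * (1 - U)) - 2 / (r * (-I * w))) / D *
        ((-I * w) / (r * (-I * w))) := by ring
    _ = _ := by rw [key, hI]; ring

lemma rayDirection_re (d : ℝ) : (rayDirection d).re = -Real.sin d := by
  rw [rayDirection, mul_comm I (d : ℂ), exp_mul_I, ← ofReal_cos, ← ofReal_sin]
  simp [-ofReal_sin, -ofReal_cos]

/-- As τ has direction e^{i(d+σ)}, the quotient ω/τ is a positive multiple of i e^{-iσ}, whose real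
part is sin σ. The condition on Im(ξ e^{-iσ}) is then the remaining inequality. -/
lemma rayAdmissible_of_mem {d : ℝ} (hd : d ∈ Ioo (-Real.pi) 0) {p : ℂ × ℂ}
    (hp : p ∈ rayDomain d) : RayAdmissible (rayDirection d) p.1 p.2 := by
  obtain ⟨σ, hσ, ⟨r, hr, hτ⟩, him⟩ := hp
  have h1 : 0 < (rayDirection d).re := by
    rw [rayDirection_re]
    have := Real.sin_neg_of_neg_of_neg_pi_lt hd.2 hd.1
    linarith
  have hr0 : (r : ℂ) ≠ 0 := by exact_mod_cast hr.ne'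
  have h2 : rayDirection d / p.1 = ((1 / r : ℝ) : ℂ) * (I * exp (-(I * σ))) := by
    rw [hτ, rayDirection, mul_add, exp_add, exp_neg]
    push_cast
    field_simp
  have h3 : rayDirection d * p.2 / p.1 = ((1 / r : ℝ) : ℂ) * (I * (p.2 * exp (-(I * σ)))) := by
    rw [mul_div_right_comm, h2]
    ring
  have h4 : (I * exp (-(I * σ))).re = Real.sin σ := by
    have : -(I * (σ : ℂ)) = ((-σ : ℝ) : ℂ) * I := by push_cast; ring
    rw [this, exp_mul_I, ← ofReal_cos, ← ofReal_sin]
    simp [-ofReal_sin, -ofReal_cos]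
  have h5 : 0 < Real.sin σ := Real.sin_pos_of_mem_Ioo hσ
  refine ⟨h1, ?_, ?_⟩
  · rw [h2, re_ofReal_mul, h4]; positivity
  · rw [h3, h2, re_ofReal_mul, re_ofReal_mul, h4, I_mul_re, abs_mul, abs_neg, abs_of_pos
      (by positivity : 0 < 1 / r)]
    gcongr

theorem integrableOn_rayKernel {d : ℝ} (hd : d ∈ Ioo (-Real.pi) 0) {p : ℂ × ℂ}
    (hp : p ∈ rayDomain d) : IntegrableOn (rayKernel d p.1 p.2) (Ioi (0 : ℝ)) := by
  have h := rayAdmissible_of_mem hd hp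
  exact h.integrable_and_hasSum.1.congr_fun
    (fun r hr => (rayKernel_eq p.1 p.2 hr h.1).symm) measurableSet_Ioi

theorem rayP_eq_seriesP {d : ℝ} (hd : d ∈ Ioo (-Real.pi) 0) {p : ℂ × ℂ}
    (hp : p ∈ rayDomain d) : rayP d p.1 p.2 = seriesP p := by
  have h := rayAdmissible_of_mem hd hp
  rw [rayP, seriesP, h.integrable_and_hasSum.2.tsum_eq]
  exact setIntegral_congr_fun measurableSet_Ioi fun r hr => rayKernel_eq p.1 p.2 hr h.1

/-! ### Holomorphy of the series and of the associated product -/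

/-- Weierstrass's theorem without restriction to one variable: Cauchy's estimate on complex lines
bounds `fderiv` of the k-th term by u k / r on a smaller ball, so the differentiated series
converges uniformly. -/
lemma differentiableAt_tsum_of_eventually {E : Type*} [NormedAddCommGroup E] [NormedSpace ℂ E]
    {f : ℕ → E → ℂ} {u : ℕ → ℝ} (hu : Summable u) {p : E}
    (h : ∀ᶠ q in 𝓝 p, ∀ k, DifferentiableAt ℂ (f k) q ∧ ‖f k q‖ ≤ u k) :
    DifferentiableAt ℂ (fun q => ∑' k, f k q) p := by
  obtain ⟨R, hR, hball⟩ := Metric.eventually_nhds_iff_ball.1 h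
  set r := R / 2 with hr
  have hr0 : 0 < r := half_pos hR
  have hp : p ∈ Metric.ball p r := Metric.mem_ball_self hr0
  have hsub : ∀ q ∈ Metric.ball p r, ∀ w : E, ‖w‖ ≤ r → q + w ∈ Metric.ball p R := by
    intro q hq w hw
    rw [Metric.mem_ball, dist_eq_norm] at hq ⊢
    calc ‖q + w - p‖ = ‖(q - p) + w‖ := by congr 1; abel
      _ ≤ ‖q - p‖ + ‖w‖ := norm_add_le _ _
      _ < R := by linarith
  have hd : ∀ k, ∀ q ∈ Metric.ball p r, HasFDerivAt (f k) (fderiv ℂ (f k) q) q := fun k q hq =>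
    (by simpa using (hball (q + 0) (hsub q hq 0 (by simpa using hr0.le)) k).1 :
      DifferentiableAt ℂ (f k) q).hasFDerivAt
  have hb : ∀ k, ∀ q ∈ Metric.ball p r, ‖fderiv ℂ (f k) q‖ ≤ u k / r := by
    intro k q hq
    have huk : 0 ≤ u k :=
      (norm_nonneg _).trans (hball p (Metric.mem_ball_self hR) k).2
    refine ContinuousLinearMap.opNorm_le_bound _ (by positivity) fun v => ?_
    rcases eq_or_ne v 0 with rfl | hv
    · simp
    · have hv0 : 0 < ‖v‖ := norm_pos_iff.2 hv
      have hin : ∀ t ∈ Metric.closedBall (0 : ℂ) (r / ‖v‖), q + t • v ∈ Metric.ball p R := by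
        intro t ht
        refine hsub q hq _ ?_
        rw [mem_closedBall_zero_iff, le_div_iff₀ hv0] at ht
        rwa [norm_smul]
      have hdiff : ∀ t ∈ Metric.closedBall (0 : ℂ) (r / ‖v‖),
          DifferentiableAt ℂ (fun t : ℂ => f k (q + t • v)) t := fun t ht =>
        DifferentiableAt.comp (f := fun t : ℂ => q + t • v) t (hball _ (hin t ht) k).1
          (by fun_prop)
      have h1 := norm_deriv_le_of_forall_mem_sphere_norm_le (f := fun t : ℂ => f k (q + t • v))
        (c := 0) (R := r / ‖v‖) (C := u k) (by positivity)
        (DifferentiableOn.diffContOnCl_ball (U := Metric.closedBall 0 (r / ‖v‖))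
          (fun t ht => (hdiff t ht).differentiableWithinAt) subset_rfl)
        (fun t ht => (hball _ (hin t (Metric.sphere_subset_closedBall ht)) k).2)
      have h2 : HasDerivAt (fun t : ℂ => f k (q + t • v)) (fderiv ℂ (f k) q v) 0 := by
        have h3 : HasDerivAt (fun t : ℂ => q + t • v) v 0 := by
          simpa using ((hasDerivAt_id (0 : ℂ)).smul_const v).const_add q
        have h4 : HasFDerivAt (f k) (fderiv ℂ (f k) q) (q + (0 : ℂ) • v) := by
          simpa using hd k q hq
        exact h4.comp_hasDerivAt 0 h3
      rw [h2.deriv] at h1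
      refine h1.trans (le_of_eq ?_)
      field_simp
  refine (hasFDerivAt_tsum_of_isPreconnected (hu.div_const r) Metric.isOpen_ball
    (convex_ball p r).isPreconnected hd hb hp ?_ hp).differentiableAt
  exact .of_norm_bounded hu fun k => (hball p (Metric.mem_ball_self hR) k).2

lemma slitPlane_of_forall_add_ne {z : ℂ} (h : ∀ t : ℝ, 0 ≤ t → z + t ≠ 0) : z ∈ slitPlane := by
  by_contra hz
  rw [mem_slitPlane_iff, not_or, not_lt, not_not] at hz
  refine h (-z.re) (by linarith [hz.1]) ?_
  apply Complex.ext <;> simp [hz.2]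

lemma slitPlane_inv {z : ℂ} (hz : z ∈ slitPlane) : z⁻¹ ∈ slitPlane := by
  have h0 := normSq_pos.2 (slitPlane_ne_zero hz)
  rcases hz with h | h
  · left
    rw [inv_re]
    positivity
  · right
    rw [inv_im]
    exact div_ne_zero (neg_ne_zero.2 h) h0.ne'

/-- Each of the two values of μ is only O(1/k), but the leading parts 1/(12z) cancel to O(1/k²) in
the difference, and the remainders are controlled by `norm_binetRho_le`. -/
lemma norm_pairTerm_le {c T M : ℝ} (hc : 0 < c) (hT : 0 < T) (hM : 0 < M) {p : ℂ × ℂ}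
    (hτ0 : p.1 ≠ 0) (hτ : ‖p.1‖ ≤ T) (hξ : ‖p.2‖ ≤ M)
    (hsec : ∀ a t : ℝ, 0 ≤ a → 0 ≤ t → c * (a + t) ≤ ‖(a : ℂ) * p.1 + t‖) {k : ℕ}
    (hk1 : M ≤ c / 2 * (1 + k)) (hk2 : M ≤ 1 / 2 * (1 + k)) :
    (k + 1 - p.2) / p.1 ∈ slitPlane ∧ (k + 1 + p.2) / p.1 ∈ slitPlane ∧
    ‖pairTerm k p‖ ≤ (T * M + 2 * (1 / (c / (2 * T)) ^ 3 * rhoConst)) *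
      ((1 : ℝ) + k) ^ (-(3 / 2) : ℝ) := by
  obtain ⟨τ, ξ⟩ := p
  simp only at *
  have hτpos : 0 < ‖τ‖ := norm_pos_iff.2 hτ0
  have hk : (0 : ℝ) ≤ k := k.cast_nonneg
  have hc' : 0 < c / (2 * T) := by positivity
  have key : ∀ ζ : ℂ, ‖ζ‖ ≤ M → ∀ t : ℝ, 0 ≤ t →
      c / (2 * T) * (1 + k + t) ≤ ‖(k + 1 + ζ) / τ + t‖ := by
    intro ζ hζ t ht
    -- Clearing the denominator puts the weight t on τ, where `hsec` applies; `hk1` then absorbs ζ.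
    have h1 : (k + 1 + ζ) / τ + t = (((t : ℂ) * τ + (k + 1 : ℝ)) + ζ) / τ := by
      push_cast
      field_simp
      ring
    have h2 := hsec t (k + 1) ht (by positivity)
    have h3 : ‖(t : ℂ) * τ + (k + 1 : ℝ)‖ - ‖ζ‖ ≤ ‖((t : ℂ) * τ + (k + 1 : ℝ)) + ζ‖ := by
      have := norm_sub_le ((t : ℂ) * τ + (k + 1 : ℝ) + ζ) ζ
      rw [add_sub_cancel_right] at this
      linarith
    rw [h1, norm_div, le_div_iff₀ hτpos]
    have h4 : c / (2 * T) * (1 + k + t) * ‖τ‖ ≤ c / (2 * T) * (1 + k + t) * T := by gcongr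
    have h5 : c / (2 * T) * (1 + k + t) * T = c / 2 * (1 + k + t) := by field_simp
    nlinarith
  have hslit : ∀ ζ : ℂ, ‖ζ‖ ≤ M → (k + 1 + ζ) / τ ∈ slitPlane := by
    refine fun ζ hζ => slitPlane_of_forall_add_ne fun t ht h0 => ?_
    have := key ζ hζ t ht
    rw [h0, norm_zero] at this
    have : 0 < c / (2 * T) * (1 + k + t) := by positivity
    linarith
  have hne : ∀ ζ : ℂ, ‖ζ‖ ≤ M → (1 + k) / 2 ≤ ‖k + 1 + ζ‖ := by
    intro ζ hζ
    have h1 := norm_sub_le (k + 1 + ζ) ζ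
    rw [add_sub_cancel_right] at h1
    have h2 : ‖(k : ℂ) + 1‖ = k + 1 := by
      rw [← Nat.cast_add_one, norm_natCast]; push_cast; rfl
    linarith
  have hξ' : ‖-ξ‖ ≤ M := by rwa [norm_neg]
  have hs1 := hslit _ hξ'
  have hs2 := hslit _ hξ
  have hb1 := norm_binetRho_le hs1 hc' hk (key _ hξ')
  have hb2 := norm_binetRho_le hs2 hc' hk (key _ hξ)
  have hn1 := hne _ hξ'
  have hn2 := hne _ hξ
  rw [← sub_eq_add_neg] at hs1 hb1 hn1
  refine ⟨hs1, hs2, ?_⟩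
  have hz1 : (k : ℂ) + 1 - ξ ≠ 0 := norm_pos_iff.1 (lt_of_lt_of_le (by positivity) hn1)
  have hz2 : (k : ℂ) + 1 + ξ ≠ 0 := norm_pos_iff.1 (lt_of_lt_of_le (by positivity) hn2)
  have e1 : pairTerm k (τ, ξ) = τ * ξ / (6 * ((k + 1 - ξ) * (k + 1 + ξ))) +
      (binetRho ((k + 1 - ξ) / τ) - binetRho ((k + 1 + ξ) / τ)) := by
    rw [pairTerm, binetMu_eq_add_binetRho hs1, binetMu_eq_add_binetRho hs2]
    field_simp
    ring
  have e2 : ‖τ * ξ / (6 * ((k + 1 - ξ) * (k + 1 + ξ)))‖ ≤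
      T * M * ((1 : ℝ) + k) ^ (-(3 / 2) : ℝ) := by
    rw [norm_div, norm_mul, norm_mul, norm_mul]
    have h6 : ‖(6 : ℂ)‖ = 6 := by simp
    rw [h6]
    have h7 : (1 + (k : ℝ)) ^ 2 ≤ 6 * (‖(k : ℂ) + 1 - ξ‖ * ‖(k : ℂ) + 1 + ξ‖) := by
      have := mul_le_mul hn1 hn2 (by positivity) (norm_nonneg _)
      nlinarith
    have h8 : 1 / (1 + (k : ℝ)) ^ 2 ≤ ((1 : ℝ) + k) ^ (-(3 / 2) : ℝ) := by
      rw [one_div, ← Real.rpow_natCast, ← Real.rpow_neg (by positivity)]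
      exact Real.rpow_le_rpow_of_exponent_le (by linarith) (by norm_num)
    calc _ ≤ T * M / (1 + (k : ℝ)) ^ 2 := by gcongr
      _ = T * M * (1 / (1 + (k : ℝ)) ^ 2) := by ring
      _ ≤ _ := by gcongr
  rw [e1]
  refine (norm_add_le _ _).trans ?_
  have := norm_sub_le (binetRho ((k + 1 - ξ) / τ)) (binetRho ((k + 1 + ξ) / τ))
  linarith

lemma differentiableAt_pairTerm {k : ℕ} {p : ℂ × ℂ} (h0 : p.1 ≠ 0)
    (h1 : (k + 1 - p.2) / p.1 ∈ slitPlane) (h2 : (k + 1 + p.2) / p.1 ∈ slitPlane) :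
    DifferentiableAt ℂ (pairTerm k) p :=
  (DifferentiableAt.comp (f := fun p : ℂ × ℂ => (k + 1 - p.2) / p.1) p
    (differentiableAt_binetMu h1) (by fun_prop (disch := assumption))).sub
  (DifferentiableAt.comp (f := fun p : ℂ × ℂ => (k + 1 + p.2) / p.1) p
    (differentiableAt_binetMu h2) (by fun_prop (disch := assumption)))

/-- The tail of `seriesP`. -/
def tailP (K : ℕ) (p : ℂ × ℂ) : ℂ := ∑' k : ℕ, pairTerm (k + K) p

/-- Near `p₀` only finitely many terms can meet a branch cut; beyond them the estimate is uniform.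
-/
lemma exists_tail_bound {p₀ : ℂ × ℂ} (hτ : p₀.1 ∈ slitPlane) (K₀ : ℕ) :
    ∃ K ≥ K₀, ∃ C : ℝ, ∀ᶠ p : ℂ × ℂ in 𝓝 p₀, ∀ k : ℕ, K ≤ k →
      p.1 ≠ 0 ∧ (k + 1 - p.2) / p.1 ∈ slitPlane ∧ (k + 1 + p.2) / p.1 ∈ slitPlane ∧
      ‖pairTerm k p‖ ≤ C * ((1 : ℝ) + k) ^ (-(3 / 2) : ℝ) := by
  obtain ⟨c, hc, hsec⟩ := eventually_sector hτ
  set T := ‖p₀.1‖ + 1 with hT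
  set M := ‖p₀.2‖ + 1 with hM
  have hT0 : 0 < T := by positivity
  have hM0 : 0 < M := by positivity
  obtain ⟨K₁, hK₁⟩ := exists_nat_ge (M / (c / 2))
  obtain ⟨K₂, hK₂⟩ := exists_nat_ge (M / (1 / 2))
  refine ⟨max K₀ (max K₁ K₂), le_max_left _ _,
    T * M + 2 * (1 / (c / (2 * T)) ^ 3 * rhoConst), ?_⟩
  have ev1 : ∀ᶠ p : ℂ × ℂ in 𝓝 p₀, ‖p.1‖ < T :=
    (continuous_fst.norm.tendsto p₀).eventually_lt_const (by simp [hT])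
  have ev2 : ∀ᶠ p : ℂ × ℂ in 𝓝 p₀, ‖p.2‖ < M :=
    (continuous_snd.norm.tendsto p₀).eventually_lt_const (by simp [hM])
  have ev3 : ∀ᶠ p : ℂ × ℂ in 𝓝 p₀, p.1 ≠ 0 :=
    continuous_fst.continuousAt.eventually_ne (slitPlane_ne_zero hτ)
  filter_upwards [ev1, ev2, ev3, (continuous_fst.tendsto p₀).eventually hsec]
    with p h1 h2 h3 h4 k hk
  have hk1 : (K₁ : ℝ) ≤ k :=
    Nat.cast_le.2 (((le_max_left _ _).trans (le_max_right _ _)).trans hk)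
  have hk2 : (K₂ : ℝ) ≤ k :=
    Nat.cast_le.2 (((le_max_right _ _).trans (le_max_right _ _)).trans hk)
  refine ⟨h3, norm_pairTerm_le hc hT0 hM0 h3 h1.le h2.le h4 ?_ ?_⟩
  · rw [div_le_iff₀ (by positivity)] at hK₁
    nlinarith
  · rw [div_le_iff₀ (by positivity)] at hK₂
    nlinarith

lemma exists_tailP {p₀ : ℂ × ℂ} (hτ : p₀.1 ∈ slitPlane) (K₀ : ℕ) :
    ∃ K ≥ K₀, (∀ᶠ p : ℂ × ℂ in 𝓝 p₀, DifferentiableAt ℂ (tailP K) p) ∧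
      ∀ᶠ p : ℂ × ℂ in 𝓝 p₀, Summable (fun k => pairTerm (k + K) p) ∧ ∀ k : ℕ, K ≤ k →
        (k + 1 - p.2) / p.1 ∈ slitPlane ∧ (k + 1 + p.2) / p.1 ∈ slitPlane := by
  obtain ⟨K, hK, C, h⟩ := exists_tail_bound hτ K₀
  have hu : Summable fun k : ℕ => C * ((1 : ℝ) + (k + K : ℕ)) ^ (-(3 / 2) : ℝ) :=
    ((summable_nat_add_iff K).2 summable_one_add_rpow).mul_left C
  refine ⟨K, hK, h.eventually_nhds.mono fun p₁ hp₁ => ?_, ?_⟩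
  · refine differentiableAt_tsum_of_eventually hu ?_
    filter_upwards [hp₁] with p hp k
    obtain ⟨h0, h1, h2, h3⟩ := hp (k + K) (by omega)
    exact ⟨differentiableAt_pairTerm h0 h1 h2, h3⟩
  · filter_upwards [h] with p hp
    exact ⟨.of_norm_bounded hu fun k => (hp (k + K) (by omega)).2.2.2,
      fun k hk => ⟨(hp k hk).2.1, (hp k hk).2.2.1⟩⟩

lemma seriesP_eq_sum_add_tailP {K : ℕ} {p : ℂ × ℂ}
    (hp : Summable (fun k => pairTerm (k + K) p)) :
    seriesP p = ∑ k ∈ Finset.range K, pairTerm k p + tailP K p := by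
  have h1 : Summable fun k => pairTerm k p := (summable_nat_add_iff K).1 hp
  exact (h1.sum_add_tsum_nat_add K).symm

lemma differentiableAt_sum_add_tailP {p₀ : ℂ × ℂ} {K : ℕ} (hτ : p₀.1 ∈ slitPlane)
    (hd : DifferentiableAt ℂ (tailP K) p₀)
    (h : ∀ k : ℕ, (k + 1 - p₀.2) / p₀.1 ∈ slitPlane ∧ (k + 1 + p₀.2) / p₀.1 ∈ slitPlane) :
    DifferentiableAt ℂ (fun p => ∑ k ∈ Finset.range K, pairTerm k p + tailP K p) p₀ := by
  refine DifferentiableAt.add ?_ hd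
  exact DifferentiableAt.fun_sum fun k _ =>
    differentiableAt_pairTerm (slitPlane_ne_zero hτ) (h k).1 (h k).2

theorem differentiableAt_seriesP {p₀ : ℂ × ℂ} (hτ : p₀.1 ∈ slitPlane)
    (h : ∀ k : ℕ, (k + 1 - p₀.2) / p₀.1 ∈ slitPlane ∧ (k + 1 + p₀.2) / p₀.1 ∈ slitPlane) :
    DifferentiableAt ℂ seriesP p₀ := by
  obtain ⟨K, -, hd, hs⟩ := exists_tailP hτ 0
  have h1 := differentiableAt_sum_add_tailP hτ hd.self_of_nhds h
  have h2 : seriesP =ᶠ[𝓝 p₀] fun p => ∑ k ∈ Finset.range K, pairTerm k p + tailP K p :=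
    hs.mono fun p hp => seriesP_eq_sum_add_tailP hp.1
  exact h1.congr_of_eventuallyEq h2

/-! ### The product continuing exp P to the whole domain. -/

/-- `exp (binetMu (w/τ))`, continued in `w` to the slit plane. -/
def stirlingRatio (w τ : ℂ) : ℂ :=
  Gamma (w / τ) * exp (w / τ + (1 / 2 - w / τ) * (log w - log τ)) / Real.sqrt (2 * Real.pi)

/-- The factors of the product expansion of `exp P`. -/
def ratioFactor (k : ℕ) (p : ℂ × ℂ) : ℂ :=
  stirlingRatio (k + 1 - p.2) p.1 / stirlingRatio (k + 1 + p.2) p.1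

/-- The analytic continuation of `exp P`. -/
def prodE (p : ℂ × ℂ) : ℂ := ∏' k : ℕ, ratioFactor k p

lemma stirlingRatio_eq_exp {w τ : ℂ} (h : w / τ ∈ slitPlane)
    (hlog : log w - log τ = log (w / τ)) : stirlingRatio w τ = exp (binetMu (w / τ)) := by
  rw [stirlingRatio, hlog, exp_binetMu h]

lemma ratioFactor_eq_exp {k : ℕ} {p : ℂ × ℂ} (h1 : (k + 1 - p.2) / p.1 ∈ slitPlane)
    (h2 : (k + 1 + p.2) / p.1 ∈ slitPlane)
    (h3 : log (k + 1 - p.2) - log p.1 = log ((k + 1 - p.2) / p.1))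
    (h4 : log (k + 1 + p.2) - log p.1 = log ((k + 1 + p.2) / p.1)) :
    ratioFactor k p = exp (pairTerm k p) := by
  rw [ratioFactor, stirlingRatio_eq_exp h1 h3, stirlingRatio_eq_exp h2 h4, ← exp_sub, pairTerm]

lemma log_sub_log_of_arg {w τ : ℂ} (hw : w ≠ 0) (hτ : τ ≠ 0)
    (h : arg (w / τ) + arg τ ∈ Ioc (-Real.pi) Real.pi) : log w - log τ = log (w / τ) := by
  rw [sub_eq_iff_eq_add, ← Complex.log_mul (div_ne_zero hw hτ) hτ h, div_mul_cancel₀ _ hτ]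

lemma log_sub_log_of_im_neg {w τ : ℂ} (hτ : 0 < τ.im) (h : (w / τ).im < 0) :
    log w - log τ = log (w / τ) := by
  have hτ0 : τ ≠ 0 := by rintro rfl; simp at hτ
  have hw : w ≠ 0 := by rintro rfl; simp at h
  have h1 := arg_neg_iff.2 h
  have h2 := neg_pi_lt_arg (w / τ)
  have h3 := arg_nonneg_iff.2 hτ.le
  have h4 := arg_le_pi τ
  exact log_sub_log_of_arg hw hτ0 ⟨by linarith, by linarith⟩

lemma log_sub_log_of_im_pos {w τ : ℂ} (hτ : 0 < τ.im) (h : 0 < w.im) :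
    log w - log τ = log (w / τ) := by
  have hτ0 : τ ≠ 0 := by rintro rfl; simp at hτ
  have hw : w ≠ 0 := by rintro rfl; simp at h
  have h1 := arg_nonneg_iff.2 h.le
  have h2 := arg_lt_pi_iff.2 (Or.inr h.ne')
  have h3 := arg_nonneg_iff.2 hτ.le
  have h4 := arg_lt_pi_iff.2 (Or.inr hτ.ne')
  have h5 : arg τ⁻¹ = -arg τ := by rw [arg_inv, if_neg h4.ne]
  rw [div_eq_mul_inv, Complex.log_mul hw (inv_ne_zero hτ0)
    (by rw [h5]; exact ⟨by linarith, by linarith⟩), Complex.log_inv _ h4.ne, sub_eq_add_neg]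

lemma re_rayDirection_mul (d : ℝ) (z : ℂ) :
    (rayDirection d * z).re = -(‖z‖ * Real.sin (d + arg z)) := by
  have h : rayDirection d * z = ((‖z‖ : ℝ) : ℂ) * (I * exp (((d + arg z : ℝ) : ℂ) * I)) := by
    nth_rewrite 1 [← norm_mul_exp_arg_mul_I z]
    rw [rayDirection]
    push_cast
    rw [add_mul, exp_add, mul_comm I (d : ℂ)]
    ring
  rw [h, re_ofReal_mul, exp_mul_I, ← ofReal_cos, ← ofReal_sin]
  simp [-ofReal_sin, -ofReal_cos]

/-- The angle d + arg z lies in (-2π, π) and has negative sine, hence lies in (-π, 0). -/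
lemma rayDirection_arg_bounds {d : ℝ} (hd : d ∈ Ioo (-Real.pi) 0) {z : ℂ}
    (hz : 0 < (rayDirection d * z).re) (harg : arg z < Real.pi) :
    -Real.pi < d + arg z ∧ d + arg z < 0 := by
  rw [re_rayDirection_mul] at hz
  have hs : Real.sin (d + arg z) < 0 := by
    by_contra h
    have := mul_nonneg (norm_nonneg z) (not_lt.1 h)
    linarith
  have h1 := neg_pi_lt_arg z
  constructor
  · by_contra h
    have := Real.sin_nonneg_of_nonneg_of_le_pi (x := d + arg z + 2 * Real.pi)
      (by linarith [hd.1]) (by linarith)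
    rw [Real.sin_add_two_pi] at this
    linarith
  · by_contra h
    have := Real.sin_nonneg_of_nonneg_of_le_pi (x := d + arg z) (by linarith)
      (by linarith [hd.2])
    linarith

/-- Both d + arg(w/τ) and d - arg τ lie in (-π, 0), so their difference arg(w/τ) + arg τ stays in
(-π, π) and no multiple of 2πi appears. -/
lemma log_sub_log_of_ray {d : ℝ} (hd : d ∈ Ioo (-Real.pi) 0) {w τ : ℂ} (hτ : 0 < τ.im)
    (hdτ : 0 < (rayDirection d / τ).re) (h : 0 < (rayDirection d * (w / τ)).re) :
    log w - log τ = log (w / τ) := by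
  have hτ0 : τ ≠ 0 := by rintro rfl; simp at hτ
  have hw : w ≠ 0 := by rintro rfl; simp at h
  have hd0 : 0 < (rayDirection d).re := by
    rw [rayDirection_re]
    linarith [Real.sin_neg_of_neg_of_neg_pi_lt hd.2 hd.1]
  have hslit := slitPlane_of_re_mul_pos hd0 h
  have h1 := rayDirection_arg_bounds hd h (lt_of_le_of_ne (arg_le_pi _)
    (mem_slitPlane_iff_arg.1 hslit).1)
  have h3 := arg_nonneg_iff.2 hτ.le
  have h4 := arg_lt_pi_iff.2 (Or.inr hτ.ne')
  have h5 : arg τ⁻¹ = -arg τ := by rw [arg_inv, if_neg h4.ne]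
  rw [div_eq_mul_inv] at hdτ
  have h2 := rayDirection_arg_bounds hd hdτ (by rw [h5]; linarith [Real.pi_pos])
  rw [h5] at h2
  exact log_sub_log_of_arg hw hτ0 ⟨by linarith [hd.2], by linarith⟩

lemma tprod_exp_of_summable {f : ℕ → ℂ} (hf : Summable f) :
    ∏' k, exp (f k) = exp (∑' k, f k) := hf.hasSum.cexp.tprod_eq

lemma prodE_eq_exp_seriesP_of_mem {d : ℝ} (hd : d ∈ Ioo (-Real.pi) 0) {p : ℂ × ℂ}
    (hp : p ∈ rayDomain d) (hτ : 0 < p.1.im) : prodE p = exp (seriesP p) := by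
  have h := rayAdmissible_of_mem hd hp
  have hre := h.re_pos
  have hs : Summable fun k => pairTerm k p := h.integrable_and_hasSum.2.summable
  rw [prodE, seriesP, ← tprod_exp_of_summable hs]
  exact tprod_congr fun k => ratioFactor_eq_exp (slitPlane_of_re_mul_pos h.1 (hre k).1)
    (slitPlane_of_re_mul_pos h.1 (hre k).2) (log_sub_log_of_ray hd hτ h.2.1 (hre k).1)
    (log_sub_log_of_ray hd hτ h.2.1 (hre k).2)

lemma slitPlane_of_mem_cutPlane {ξ : ℂ} (h : ξ ∈ cutPlane) (k : ℕ) :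
    k + 1 - ξ ∈ slitPlane ∧ k + 1 + ξ ∈ slitPlane := by
  have hk : (0 : ℝ) ≤ k := k.cast_nonneg
  constructor <;> refine slitPlane_of_forall_add_ne fun t ht h0 => ?_
  · have := h (k + 1 + t) (by push_cast; linear_combination -h0)
    linarith [this.2]
  · have := h (-(k + 1 + t)) (by push_cast; linear_combination h0)
    linarith [this.1]

lemma ne_neg_nat_of_mem_continuationDomain {p : ℂ × ℂ} (hp : p ∈ continuationDomain) (k m : ℕ) :
    (k + 1 - p.2) / p.1 ≠ -m ∧ (k + 1 + p.2) / p.1 ≠ -m := by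
  obtain ⟨hτ, hcut, hsing⟩ := hp
  have hτ0 : p.1 ≠ 0 := by intro h; rw [h] at hτ; simp at hτ
  have hk : (0 : ℝ) ≤ k := k.cast_nonneg
  constructor <;> intro h <;> rw [div_eq_iff hτ0] at h
  · rcases Nat.eq_zero_or_pos m with rfl | hm
    · have := hcut (k + 1) (by push_cast at h ⊢; linear_combination -h)
      linarith [this.2]
    · exact hsing ⟨k + 1, m, by omega, hm, Or.inl (by push_cast; linear_combination -h)⟩
  · rcases Nat.eq_zero_or_pos m with rfl | hm
    · have := hcut (-(k + 1)) (by push_cast at h ⊢; linear_combination h)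
      linarith [this.1]
    · exact hsing ⟨k + 1, m, by omega, hm, Or.inr (by push_cast; linear_combination h)⟩

lemma stirlingRatio_ne_zero {w τ : ℂ} (h : ∀ m : ℕ, w / τ ≠ -m) : stirlingRatio w τ ≠ 0 := by
  have h2 : ((Real.sqrt (2 * Real.pi) : ℝ) : ℂ) ≠ 0 := by
    exact_mod_cast (by positivity : Real.sqrt (2 * Real.pi) ≠ 0)
  exact div_ne_zero (mul_ne_zero (Gamma_ne_zero h) (exp_ne_zero _)) h2

lemma differentiableAt_stirlingRatio {f : ℂ × ℂ → ℂ} {p : ℂ × ℂ} (hf : DifferentiableAt ℂ f p)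
    (hfs : f p ∈ slitPlane) (hp : p.1 ∈ slitPlane) (h : ∀ m : ℕ, f p / p.1 ≠ -m) :
    DifferentiableAt ℂ (fun p => stirlingRatio (f p) p.1) p := by
  have h0 := slitPlane_ne_zero hp
  have hdiv : DifferentiableAt ℂ (fun p : ℂ × ℂ => f p / p.1) p := by
    fun_prop (disch := assumption)
  have h1 : DifferentiableAt ℂ (fun p : ℂ × ℂ => Gamma (f p / p.1)) p :=
    DifferentiableAt.comp p (differentiableAt_Gamma _ h) hdiv
  have h2 : DifferentiableAt ℂ (fun p : ℂ × ℂ => log (f p)) p := hf.clog hfs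
  have h3 : DifferentiableAt ℂ (fun p : ℂ × ℂ => log p.1) p := differentiableAt_fst.clog hp
  unfold stirlingRatio
  fun_prop

lemma differentiableAt_ratioFactor {p : ℂ × ℂ} (hp : p ∈ continuationDomain) (k : ℕ) :
    DifferentiableAt ℂ (ratioFactor k) p := by
  have h := ne_neg_nat_of_mem_continuationDomain hp k
  have hs := slitPlane_of_mem_cutPlane hp.2.1 k
  have hτ := mem_slitPlane_of_im_pos hp.1
  have h1 := differentiableAt_stirlingRatio (f := fun p => k + 1 - p.2) (by fun_prop) hs.1 hτ
    fun m => (h m).1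
  have h2 := differentiableAt_stirlingRatio (f := fun p => k + 1 + p.2) (by fun_prop) hs.2 hτ
    fun m => (h m).2
  have h3 : stirlingRatio (k + 1 + p.2) p.1 ≠ 0 := stirlingRatio_ne_zero fun m => (h m).2
  unfold ratioFactor
  fun_prop (disch := assumption)

lemma ratioFactor_ne_zero {p : ℂ × ℂ} (hp : p ∈ continuationDomain) (k : ℕ) :
    ratioFactor k p ≠ 0 :=
  div_ne_zero (stirlingRatio_ne_zero fun m => (ne_neg_nat_of_mem_continuationDomain hp k m).1)
    (stirlingRatio_ne_zero fun m => (ne_neg_nat_of_mem_continuationDomain hp k m).2)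

/-- For large k both (k + 1 ± ξ)/τ lie in the lower half-plane, where log w - log τ = log(w/τ). All
but finitely many factors are therefore exponentials of `pairTerm`. -/
lemma prodE_eq_prod_mul_exp_tailP {p : ℂ × ℂ} {K₀ K : ℕ} (hK : K₀ ≤ K) (h1 : (1 / p.1).im < 0)
    (h2 : |(p.2 / p.1).im| < K₀ * -(1 / p.1).im) (h3 : 0 < p.1.im)
    (hsum : Summable (fun k => pairTerm (k + K) p)) (hslit : ∀ k : ℕ, K ≤ k →
        (k + 1 - p.2) / p.1 ∈ slitPlane ∧ (k + 1 + p.2) / p.1 ∈ slitPlane) :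
    prodE p = (∏ k ∈ Finset.range K, ratioFactor k p) * exp (tailP K p) := by
  have hfac : ∀ k, ratioFactor (k + K) p = exp (pairTerm (k + K) p) := by
    intro k
    have hk : (K₀ : ℝ) ≤ (k + K : ℕ) + 1 := by
      have : K₀ ≤ k + K + 1 := by omega
      exact_mod_cast this
    obtain ⟨hs1, hs2⟩ := hslit (k + K) (by omega)
    have hmul := mul_le_mul_of_nonneg_right hk (by linarith : 0 ≤ -(1 / p.1).im)
    rw [abs_lt] at h2
    have e1 : ∀ ζ : ℂ, (((k + K : ℕ) : ℂ) + 1 + ζ) / p.1 =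
        (((k + K : ℕ) + 1 : ℝ) : ℂ) * (1 / p.1) + ζ / p.1 := fun ζ => by push_cast; ring
    refine ratioFactor_eq_exp hs1 hs2 (log_sub_log_of_im_neg h3 ?_) (log_sub_log_of_im_neg h3 ?_)
    · rw [sub_eq_add_neg, e1, add_im, im_ofReal_mul, neg_div, neg_im]
      linarith
    · rw [e1, add_im, im_ofReal_mul]
      linarith
  have hprod : HasProd (fun k => ratioFactor (k + K) p) (exp (tailP K p)) := by
    simp only [hfac]
    exact hsum.hasSum.cexp
  have hmul : Multipliable (fun k => ratioFactor (k + K) p) := ⟨_, hprod⟩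
  have := hmul.prod_mul_tprod_nat_mul' (f := fun k => ratioFactor k p)
  rw [prodE, ← this, hprod.tprod_eq]

lemma exists_prodE_eq {p₀ : ℂ × ℂ} (hτ : 0 < p₀.1.im) :
    ∃ K, (∀ᶠ p in 𝓝 p₀, DifferentiableAt ℂ (tailP K) p) ∧ ∀ᶠ p in 𝓝 p₀,
      prodE p = (∏ k ∈ Finset.range K, ratioFactor k p) * exp (tailP K p) := by
  have hτ0 : p₀.1 ≠ 0 := by intro h; rw [h] at hτ; simp at hτ
  have him : (1 / p₀.1).im < 0 := by
    rw [one_div, inv_im]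
    exact div_neg_of_neg_of_pos (by linarith) (normSq_pos.2 hτ0)
  obtain ⟨K₀, hK₀⟩ := exists_nat_gt (|(p₀.2 / p₀.1).im| / (-(1 / p₀.1).im))
  rw [div_lt_iff₀ (by linarith)] at hK₀
  obtain ⟨K, hK, hd, hs⟩ := exists_tailP (mem_slitPlane_of_im_pos hτ) K₀
  have hc1 : ContinuousAt (fun p : ℂ × ℂ => (1 / p.1).im) p₀ :=
    continuous_im.continuousAt.comp (continuousAt_const.div continuousAt_fst hτ0)
  have hc2 : ContinuousAt (fun p : ℂ × ℂ => (p.2 / p.1).im) p₀ :=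
    continuous_im.continuousAt.comp (continuousAt_snd.div continuousAt_fst hτ0)
  have ev1 : ∀ᶠ p : ℂ × ℂ in 𝓝 p₀, (1 / p.1).im < 0 := hc1.tendsto.eventually_lt_const him
  have ev2 : ∀ᶠ p : ℂ × ℂ in 𝓝 p₀, |(p.2 / p.1).im| < K₀ * -(1 / p.1).im :=
    hc2.abs.tendsto.eventually_lt (continuousAt_const.mul hc1.neg).tendsto hK₀
  have ev3 : ∀ᶠ p : ℂ × ℂ in 𝓝 p₀, 0 < p.1.im :=
    (continuous_im.comp continuous_fst).continuousAt.eventually_const_lt hτ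
  exact ⟨K, hd, (ev1.and (ev2.and (ev3.and hs))).mono fun p hp =>
    prodE_eq_prod_mul_exp_tailP hK hp.1 hp.2.1 hp.2.2.1 hp.2.2.2.1 hp.2.2.2.2⟩

theorem prodE_ne_zero {p : ℂ × ℂ} (hp : p ∈ continuationDomain) : prodE p ≠ 0 := by
  obtain ⟨K, -, h⟩ := exists_prodE_eq hp.1
  rw [h.self_of_nhds]
  exact mul_ne_zero (Finset.prod_ne_zero_iff.2 fun k _ => ratioFactor_ne_zero hp k)
    (exp_ne_zero _)

lemma differentiableAt_prod_ratioFactor {p : ℂ × ℂ} (hp : p ∈ continuationDomain) (K : ℕ) :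
    DifferentiableAt ℂ (fun p => ∏ k ∈ Finset.range K, ratioFactor k p) p := by
  induction K with
  | zero => simp
  | succ n ih =>
    simp only [Finset.prod_range_succ]
    exact ih.mul (differentiableAt_ratioFactor hp n)

theorem differentiableAt_prodE {p : ℂ × ℂ} (hp : p ∈ continuationDomain) :
    DifferentiableAt ℂ prodE p := by
  obtain ⟨K, hd, h⟩ := exists_prodE_eq hp.1
  exact ((differentiableAt_prod_ratioFactor hp K).mul hd.self_of_nhds.cexp).congr_of_eventuallyEq h

/-- The union of the domains of the ray integrals. -/
def rayUnion : Set (ℂ × ℂ) := ⋃ d ∈ Ioo (-Real.pi) 0, rayDomain d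

open Classical in
/-- A determination of the analytic continuation of the ray integrals. -/
def determinationP (p : ℂ × ℂ) : ℂ := if p ∈ rayUnion then seriesP p else log (prodE p)

lemma mem_rayUnion {p : ℂ × ℂ} :
    p ∈ rayUnion ↔ ∃ d ∈ Ioo (-Real.pi) 0, p ∈ rayDomain d := by
  simp [rayUnion]

theorem exp_determinationP {p : ℂ × ℂ} (hp : p ∈ continuationDomain) :
    exp (determinationP p) = prodE p := by
  rw [determinationP]
  split_ifs with h
  · obtain ⟨d, hd, hpd⟩ := mem_rayUnion.1 h
    exact (prodE_eq_exp_seriesP_of_mem hd hpd hp.1).symm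
  · exact exp_log (prodE_ne_zero hp)

theorem isPMinus_determinationP : IsPMinus determinationP where
  integrable d hd p hp := integrableOn_rayKernel hd hp
  eq_rayP d hd p hp := by
    rw [rayP_eq_seriesP hd hp, determinationP, if_pos (mem_rayUnion.2 ⟨d, hd, hp⟩)]
  holomorphic := by
    refine DifferentiableOn.congr (f := seriesP) (fun p hp => ?_) fun p hp => if_pos hp
    obtain ⟨d, hd, hpd⟩ := mem_rayUnion.1 hp
    have h := rayAdmissible_of_mem hd hpd
    refine (differentiableAt_seriesP ?_ fun k => ⟨slitPlane_of_re_mul_pos h.1 (h.re_pos k).1,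
      slitPlane_of_re_mul_pos h.1 (h.re_pos k).2⟩).differentiableWithinAt
    -- The Ω^d also contain τ outside the upper half-plane; admissibility still keeps τ off the
    -- negative axis.
    have h1 := h.2.1
    rw [div_eq_mul_inv] at h1
    simpa using slitPlane_inv (slitPlane_of_re_mul_pos h.1 h1)
  exp_holomorphic := by
    refine DifferentiableOn.congr (f := prodE) (fun p hp => ?_) fun p hp => exp_determinationP hp
    exact (differentiableAt_prodE hp).differentiableWithinAt

/-! ### The modular expansion of the `q`-product in the upper half-plane -/

/-- The imaginary part of ξ + k + tτ controls 1 + t, and the triangle inequality then controls |k|.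
-/
lemma exists_lattice_bound {τ ξ : ℂ} (hτ : 0 < τ.im) (hξ : 0 < ξ.im) :
    ∃ c : ℝ, 0 < c ∧ ∀ (k : ℤ) (t : ℝ), 0 ≤ t → c * (1 + |(k : ℝ)| + t) ≤ ‖(ξ + k) / τ + t‖ := by
  have hτ0 : τ ≠ 0 := by rintro rfl; simp at hτ
  have hτn : 0 < ‖τ‖ := norm_pos_iff.2 hτ0
  set m := min ξ.im τ.im with hm
  have hm0 : 0 < m := lt_min hξ hτ
  set B := 1 + (1 + ‖ξ‖ + ‖τ‖) / m with hB
  have hB0 : 0 < B := by positivity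
  refine ⟨1 / (B * ‖τ‖), by positivity, fun k t ht => ?_⟩
  have h1 : (ξ + k) / τ + t = (ξ + k + t * τ) / τ := by field_simp
  set N := ‖ξ + k + t * τ‖ with hN
  have h2 : m * (1 + t) ≤ N := by
    have h3 := (le_abs_self _).trans (abs_im_le_norm (ξ + k + t * τ))
    have h4 : (ξ + k + t * τ).im = ξ.im + t * τ.im := by simp
    rw [h4] at h3
    have h5 : m ≤ ξ.im := min_le_left _ _
    have h6 : m ≤ τ.im := min_le_right _ _
    nlinarith
  have h3 : |(k : ℝ)| ≤ N + ‖ξ‖ + t * ‖τ‖ := by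
    have h4 : ((k : ℝ) : ℂ) = (ξ + k + t * τ) - ξ - t * τ := by push_cast; ring
    have h5 : |(k : ℝ)| = ‖((k : ℝ) : ℂ)‖ := by rw [norm_real, Real.norm_eq_abs]
    rw [h5, h4]
    refine (norm_sub_le _ _).trans (add_le_add (norm_sub_le _ _) (le_of_eq ?_))
    rw [norm_mul, norm_real, Real.norm_of_nonneg ht]
  have h4 : 1 + t ≤ N / m := by rw [le_div_iff₀ hm0]; linarith
  rw [h1, norm_div, ← hN, one_div_mul_eq_div, div_le_div_iff₀ (by positivity) hτn]
  have h5 : 1 + |(k : ℝ)| + t ≤ N * B := by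
    have h6 : N * B = N + (1 + ‖ξ‖ + ‖τ‖) * (N / m) := by rw [hB]; ring
    have h7 : (1 + ‖ξ‖ + ‖τ‖) * (1 + t) ≤ (1 + ‖ξ‖ + ‖τ‖) * (N / m) := by gcongr
    rw [h6]
    nlinarith [norm_nonneg ξ, norm_nonneg τ, mul_nonneg ht (norm_nonneg ξ)]
  nlinarith

lemma slitPlane_lattice {τ ξ : ℂ} (hτ : 0 < τ.im) (hξ : 0 < ξ.im) (k : ℤ) :
    (ξ + k) / τ ∈ slitPlane := by
  obtain ⟨c, hc, h⟩ := exists_lattice_bound hτ hξ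
  refine slitPlane_of_forall_add_ne fun t ht h0 => ?_
  have := h k t ht
  rw [h0, norm_zero] at this
  have : 0 < c * (1 + |(k : ℝ)| + t) := by positivity
  linarith

lemma summable_int_rpow : Summable fun k : ℤ => ((1 : ℝ) + |(k : ℝ)|) ^ (-(3 / 2) : ℝ) :=
  .of_nat_of_neg (by simpa using summable_one_add_rpow) (by simpa using summable_one_add_rpow)

lemma summable_gudermannRem_lattice {τ ξ : ℂ} (hτ : 0 < τ.im) (hξ : 0 < ξ.im) :
    Summable (Function.uncurry fun (k : ℤ) (n : ℕ) => gudermannRem ((ξ + k) / τ + n)) := by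
  obtain ⟨c, hc, h⟩ := exists_lattice_bound hτ hξ
  have hs := (summable_int_rpow.mul_of_nonneg summable_one_add_rpow
    (fun k => by positivity) fun n => by positivity).mul_left (1 / c ^ 3)
  refine .of_norm_bounded hs fun p => ?_
  have := norm_gudermannRem_add_nat_le (slitPlane_lattice hτ hξ p.1) hc (abs_nonneg (p.1 : ℝ))
    (h p.1) p.2
  rwa [mul_assoc] at this

lemma norm_e2pi_lt_one {z : ℂ} (hz : 0 < z.im) : ‖e2pi z‖ < 1 := exp_neg_two_pi_lt_one hz

lemma e2pi_add (a b : ℂ) : e2pi (a + b) = e2pi a * e2pi b := by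
  rw [e2pi, e2pi, e2pi, ← exp_add]; congr 1; ring

lemma e2pi_natCast_mul (n : ℕ) (z : ℂ) : e2pi (n * z) = e2pi z ^ n := by
  rw [e2pi, e2pi, ← exp_nat_mul]; congr 1; ring

lemma tsum_one_div_cube {z : ℂ} (hz : 0 < z.im) :
    ∑' k : ℤ, 1 / (z + k) ^ 3 =
      (-2 * Real.pi * I) ^ 3 / 2 * ∑' m : ℕ, (m : ℂ) ^ 2 * e2pi z ^ m := by
  -- Lipschitz's formula; the parameter is one less than the exponent 3.
  have := EisensteinSeries.qExpansion_identity (k := 2) (by norm_num) ⟨z, hz⟩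
  simpa [e2pi] using this

/-- The integrals `∫ p(s) e^{cs} ds` of the Bernoulli kernel. -/
lemma integral_bernoulliKernel_mul_exp {c : ℂ} (hc : c ≠ 0) :
    ∫ s in (0 : ℝ)..1, bernoulliKernel s * exp (c * s) =
      -(1 / c) * ((exp c + 1) / c ^ 2 - 2 * (exp c - 1) / c ^ 3 - (exp c - 1) / (6 * c)) := by
  set a3 : ℂ := -1 / (3 * c) with h3
  set a2 : ℂ := (1 / 2 + 1 / c) / c with h2
  set a1 : ℂ := (-1 / 6 - 2 * a2) / c with h1
  set a0 : ℂ := -a1 / c with h0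
  rw [integral_of_hasDerivAt_ofReal (f := fun s => bernoulliKernel s * exp (c * s))
    (F := fun s => (a3 * s ^ 3 + a2 * s ^ 2 + a1 * s + a0) * exp (c * s))]
  · simp only [h0, h1, h2, h3, mul_one, mul_zero, exp_zero]
    field_simp
    ring
  · intro s _
    have d1 : HasDerivAt (fun w : ℂ => c * w) c (s : ℂ) := by
      simpa using (hasDerivAt_id (s : ℂ)).const_mul c
    have d2 : HasDerivAt (fun w : ℂ => a3 * w ^ 3 + a2 * w ^ 2 + a1 * w + a0)
        (a3 * (3 * s ^ 2) + a2 * (2 * s) + a1) (s : ℂ) := by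
      convert! (((((hasDerivAt_id (s : ℂ)).pow 3).const_mul a3).add
        (((hasDerivAt_id (s : ℂ)).pow 2).const_mul a2)).add
        ((hasDerivAt_id (s : ℂ)).const_mul a1)).add_const a0 using 1
      simp
    convert! d2.mul d1.cexp using 1
    simp only [h0, h1, h2, h3, bernoulliKernel]
    field_simp
    ring
  · unfold bernoulliKernel
    fun_prop

lemma continuous_bernoulliKernel : Continuous fun s : ℝ => bernoulliKernel s := by
  unfold bernoulliKernel
  fun_prop

/-- The sum of Gudermann remainders over a row of the lattice, as an integral. -/
lemma hasSum_row_integral {τ w : ℂ} (hτ : 0 < τ.im) (hw : 0 < w.im) :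
    HasSum (fun k : ℤ => gudermannRem ((w + k) / τ))
      (∫ s in (0 : ℝ)..1, bernoulliKernel s *
        (τ ^ 3 * ((-2 * Real.pi * I) ^ 3 / 2 * ∑' m : ℕ, (m : ℂ) ^ 2 * e2pi (w + s * τ) ^ m))) := by
  have hτ0 : τ ≠ 0 := by rintro rfl; simp at hτ
  obtain ⟨c, hc, h⟩ := exists_lattice_bound hτ hw
  have hbd : ∀ (k : ℤ) (s : ℝ), 0 ≤ s → s ≤ 1 →
      ‖bernoulliKernel s / ((w + k) / τ + s) ^ 3‖ ≤
        1 / c ^ 3 * ((1 : ℝ) + |(k : ℝ)|) ^ (-(3 / 2) : ℝ) := by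
    intro k s h0 h1
    have h2 : c * (1 + |(k : ℝ)|) ≤ ‖(w + k) / τ + s‖ := le_trans (by nlinarith) (h k s h0)
    rw [norm_div, norm_pow]
    calc _ ≤ 1 / (c * (1 + |(k : ℝ)|)) ^ 3 := by
          gcongr
          exact norm_bernoulliKernel_le h0 h1
      _ = 1 / c ^ 3 * (1 / (1 + |(k : ℝ)| + 0) ^ 3) := by
          rw [mul_pow, ← one_div_mul_one_div, add_zero]
      _ ≤ _ := by
          gcongr
          simpa using rpow_three_halves_mul_le (abs_nonneg (k : ℝ)) le_rfl
  have hmem : ∀ (k : ℤ) (s : ℝ), 0 ≤ s → (w + k) / τ + s ≠ 0 := fun k s hs =>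
    slitPlane_ne_zero (slitPlane_add_nonneg (slitPlane_lattice hτ hw k) hs)
  have hsum := summable_int_rpow.mul_left (1 / c ^ 3)
  have := intervalIntegral.hasSum_integral_of_dominated_convergence (a := 0) (b := 1)
    (μ := volume) (F := fun (k : ℤ) (s : ℝ) => bernoulliKernel s / ((w + k) / τ + s) ^ 3)
    (f := fun s : ℝ => bernoulliKernel s *
        (τ ^ 3 * ((-2 * Real.pi * I) ^ 3 / 2 * ∑' m : ℕ, (m : ℂ) ^ 2 * e2pi (w + s * τ) ^ m)))
    (fun k _ => 1 / c ^ 3 * ((1 : ℝ) + |(k : ℝ)|) ^ (-(3 / 2) : ℝ)) (fun k => ?_)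
    (fun k => ae_of_all _ fun s hs => ?_) (ae_of_all _ fun s _ => hsum) (by simp)
    (ae_of_all _ fun s hs => ?_)
  · refine this.congr_fun fun k => ?_
    exact gudermannRem_eq_integral (slitPlane_lattice hτ hw k)
  · refine ContinuousOn.aestronglyMeasurable ?_ measurableSet_uIoc
    refine continuous_bernoulliKernel.continuousOn.div (by fun_prop) fun s hs => ?_
    rw [uIoc_of_le zero_le_one] at hs
    exact pow_ne_zero _ (hmem k s hs.1.le)
  · rw [uIoc_of_le zero_le_one] at hs
    exact hbd k s hs.1.le hs.2
  · rw [uIoc_of_le zero_le_one] at hs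
    have him : 0 < (w + s * τ).im := by
      have : (w + s * τ).im = w.im + s * τ.im := by simp
      rw [this]
      have := hs.1
      positivity
    have h1 : Summable fun k : ℤ => bernoulliKernel s / ((w + k) / τ + s) ^ 3 :=
      .of_norm_bounded hsum fun k => hbd k s hs.1.le hs.2
    rw [← tsum_one_div_cube him, ← tsum_mul_left, ← tsum_mul_left]
    convert! h1.hasSum using 1
    refine tsum_congr fun k => ?_
    have h2 := hmem k s hs.1.le
    have h3 : (w + k) / τ + s = (w + s * τ + k) / τ := by field_simp; ring
    rw [h3] at h2 ⊢
    rw [div_pow, div_div_eq_mul_div]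
    ring

/-- `½ log(1 - X) + Li₂(X)/(2πiτ) + (2πiτ/12) X/(1 - X)`. -/
def rowPotential (τ X : ℂ) : ℂ :=
  1 / 2 * log (1 - X) + dilog X / (2 * Real.pi * I * τ) + 2 * Real.pi * I * τ / 12 * (X / (1 - X))

lemma summable_dilog {X : ℂ} (hX : ‖X‖ ≤ 1) :
    Summable fun n : ℕ => X ^ (n + 1) / ((n : ℂ) + 1) ^ 2 := by
  refine .of_norm_bounded summable_one_div_one_add_sq fun n => ?_
  have : ‖(n : ℂ) + 1‖ = 1 + n := by
    rw [← Nat.cast_add_one, norm_natCast]; push_cast; ring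
  rw [norm_div, norm_pow, norm_pow, this]
  gcongr
  exact pow_le_one₀ (norm_nonneg _) hX

lemma norm_dilog_le {X : ℂ} (hX : ‖X‖ ≤ 1) :
    ‖dilog X‖ ≤ ‖X‖ * ∑' n : ℕ, 1 / ((1 : ℝ) + n) ^ 2 := by
  refine tsum_of_norm_bounded (summable_one_div_one_add_sq.hasSum.mul_left ‖X‖) fun n => ?_
  have : ‖(n : ℂ) + 1‖ = 1 + n := by
    rw [← Nat.cast_add_one, norm_natCast]; push_cast; ring
  rw [norm_div, norm_pow, norm_pow, this, pow_succ, div_eq_mul_one_div, mul_comm (‖X‖ ^ n)]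
  gcongr
  exact mul_le_of_le_one_right (norm_nonneg _) (pow_le_one₀ (norm_nonneg _) hX)

lemma tendsto_dilog_zero : Tendsto dilog (𝓝 0) (𝓝 0) := by
  have h1 : Tendsto (fun X : ℂ => ‖X‖ * ∑' n : ℕ, 1 / ((1 : ℝ) + n) ^ 2) (𝓝 0) (𝓝 0) := by
    have : Continuous fun X : ℂ => ‖X‖ * ∑' n : ℕ, 1 / ((1 : ℝ) + n) ^ 2 := by fun_prop
    simpa using this.tendsto 0
  refine squeeze_zero_norm' ?_ h1
  filter_upwards [Metric.closedBall_mem_nhds (0 : ℂ) one_pos] with X hX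
  exact norm_dilog_le (by simpa using hX)

lemma tendsto_rowPotential_zero (τ : ℂ) : Tendsto (rowPotential τ) (𝓝 0) (𝓝 0) := by
  have h1 : Tendsto (fun X : ℂ => log (1 - X)) (𝓝 0) (𝓝 0) := by
    have : ContinuousAt (fun X : ℂ => log (1 - X)) 0 :=
      ContinuousAt.clog (by fun_prop) (by simp)
    simpa [ContinuousAt] using this
  have h2 : Tendsto (fun X : ℂ => X / (1 - X)) (𝓝 0) (𝓝 0) := by
    have : ContinuousAt (fun X : ℂ => X / (1 - X)) 0 :=
      ContinuousAt.div (by fun_prop) (by fun_prop) (by simp)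
    simpa [ContinuousAt] using this
  have := ((h1.const_mul (1 / 2)).add (tendsto_dilog_zero.div_const (2 * Real.pi * I * τ))).add
    (h2.const_mul (2 * Real.pi * I * τ / 12))
  unfold rowPotential
  simpa using this

/-- Termwise integration of the `q`-expansion of a row. -/
lemma hasSum_row_qExpansion {τ w : ℂ} (hτ : 0 < τ.im) (hw : 0 < w.im) :
    HasSum (fun m : ℕ => ∫ s in (0 : ℝ)..1, bernoulliKernel s *
        (τ ^ 3 * ((-2 * Real.pi * I) ^ 3 / 2 * ((m : ℂ) ^ 2 * e2pi (w + s * τ) ^ m))))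
      (∫ s in (0 : ℝ)..1, bernoulliKernel s *
        (τ ^ 3 * ((-2 * Real.pi * I) ^ 3 / 2 * ∑' m : ℕ, (m : ℂ) ^ 2 * e2pi (w + s * τ) ^ m))) := by
  set A : ℝ := ‖τ ^ 3 * ((-2 * Real.pi * I) ^ 3 / 2)‖ with hA
  have hX : ‖‖e2pi w‖‖ < 1 := by rw [norm_norm]; exact norm_e2pi_lt_one hw
  have hsum : Summable fun m : ℕ => A * ((m : ℝ) ^ 2 * ‖e2pi w‖ ^ m) :=
    (summable_pow_mul_geometric_of_norm_lt_one 2 hX).mul_left A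
  have hle : ∀ s : ℝ, 0 ≤ s → ‖e2pi (w + s * τ)‖ ≤ ‖e2pi w‖ := by
    intro s hs
    rw [e2pi_add, norm_mul]
    refine mul_le_of_le_one_right (norm_nonneg _) ?_
    rw [e2pi, norm_exp, Real.exp_le_one_iff]
    simp
    positivity
  have hterm : ∀ (m : ℕ) (s : ℝ), 0 ≤ s →
      ‖(m : ℂ) ^ 2 * e2pi (w + s * τ) ^ m‖ ≤ (m : ℝ) ^ 2 * ‖e2pi w‖ ^ m := by
    intro m s hs
    rw [norm_mul, norm_pow, norm_pow, norm_natCast]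
    gcongr
    exact hle s hs
  refine intervalIntegral.hasSum_integral_of_dominated_convergence
    (fun m _ => A * ((m : ℝ) ^ 2 * ‖e2pi w‖ ^ m)) (fun m => ?_)
    (fun m => ae_of_all _ fun s hs => ?_) (ae_of_all _ fun s _ => hsum) (by simp)
    (ae_of_all _ fun s hs => ?_)
  · have := continuous_bernoulliKernel
    unfold e2pi
    exact Continuous.aestronglyMeasurable (by fun_prop)
  · rw [uIoc_of_le zero_le_one] at hs
    rw [norm_mul, ← mul_assoc (τ ^ 3), norm_mul _ ((m : ℂ) ^ 2 * _), ← hA]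
    refine (mul_le_of_le_one_left (by positivity) (norm_bernoulliKernel_le hs.1.le hs.2)).trans ?_
    gcongr
    exact hterm m s hs.1.le
  · rw [uIoc_of_le zero_le_one] at hs
    refine ((HasSum.mul_left _ (HasSum.mul_left _ (Summable.hasSum ?_))).mul_left _)
    exact .of_norm_bounded (summable_pow_mul_geometric_of_norm_lt_one 2 hX)
      fun m => hterm m s hs.1.le

/-- With m = n + 1 and c = 2πiτm, the kernel integral contributes c^{-3}, c^{-4} and c^{-2}.
Multiplied by m², these become the coefficients 1/m, 1/m² and 1 of the logarithm, the dilogarithm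
and the geometric series. -/
lemma integral_qExpansion_term {τ w : ℂ} (hτ : τ ≠ 0) (n : ℕ) :
    ∫ s in (0 : ℝ)..1, bernoulliKernel s *
        (τ ^ 3 * ((-2 * Real.pi * I) ^ 3 / 2 * (((n + 1 : ℕ) : ℂ) ^ 2 *
          e2pi (w + s * τ) ^ (n + 1)))) =
      1 / 2 * ((e2pi w * e2pi τ) ^ (n + 1) / (n + 1 : ℕ)) + 1 / 2 * (e2pi w ^ (n + 1) / (n + 1 : ℕ))
      - (1 / (2 * Real.pi * I * τ)) * ((e2pi w * e2pi τ) ^ (n + 1) / ((n : ℂ) + 1) ^ 2)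
      + (1 / (2 * Real.pi * I * τ)) * (e2pi w ^ (n + 1) / ((n : ℂ) + 1) ^ 2)
      - 2 * Real.pi * I * τ / 12 * ((e2pi w * e2pi τ) * (e2pi w * e2pi τ) ^ n)
      + 2 * Real.pi * I * τ / 12 * (e2pi w * e2pi w ^ n) := by
  set b : ℂ := 2 * Real.pi * I * τ with hb
  have hb0 : b ≠ 0 := by
    rw [hb]
    exact mul_ne_zero two_pi_I_ne_zero hτ
  have hn : ((n : ℂ) + 1) ≠ 0 := Nat.cast_add_one_ne_zero n
  have hc0 : ((n : ℂ) + 1) * b ≠ 0 := mul_ne_zero hn hb0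
  have hexp : exp (((n : ℂ) + 1) * b) = e2pi τ ^ (n + 1) := by
    rw [← e2pi_natCast_mul, e2pi, hb]
    congr 1
    push_cast
    ring
  have h1 : ∀ s : ℝ, bernoulliKernel s *
        (τ ^ 3 * ((-2 * Real.pi * I) ^ 3 / 2 * (((n + 1 : ℕ) : ℂ) ^ 2 *
          e2pi (w + s * τ) ^ (n + 1)))) =
      (-b ^ 3 / 2 * ((n : ℂ) + 1) ^ 2 * e2pi w ^ (n + 1)) *
        (bernoulliKernel s * exp (((n : ℂ) + 1) * b * s)) := by
    intro s
    have h2 : e2pi (w + s * τ) ^ (n + 1) =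
        e2pi w ^ (n + 1) * exp (((n : ℂ) + 1) * b * s) := by
      rw [e2pi_add, mul_pow]
      congr 1
      rw [← e2pi_natCast_mul, e2pi, hb]
      congr 1
      push_cast
      ring
    rw [h2, hb]
    push_cast
    ring
  simp only [h1]
  rw [intervalIntegral.integral_const_mul, integral_bernoulliKernel_mul_exp hc0, hexp]
  simp only [mul_pow, pow_succ]
  push_cast
  field_simp
  ring

lemma hasSum_neg_log {X : ℂ} (hX : ‖X‖ < 1) :
    HasSum (fun n : ℕ => X ^ (n + 1) / (n + 1 : ℕ)) (-log (1 - X)) := by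
  have := (hasSum_nat_add_iff' 1).2 (hasSum_taylorSeries_neg_log hX)
  simpa using this

/-- Apart from the logarithm of one factor of the q-product, the row sum is a difference of one
potential at X and at Xq, which makes successive rows telescope. -/
theorem hasSum_row {τ w : ℂ} (hτ : 0 < τ.im) (hw : 0 < w.im) :
    HasSum (fun k : ℤ => gudermannRem ((w + k) / τ))
      (-log (1 - e2pi w) + (rowPotential τ (e2pi w) - rowPotential τ (e2pi (w + τ)))) := by
  have hτ0 : τ ≠ 0 := by rintro rfl; simp at hτ
  have h1 := hasSum_row_integral hτ hw
  -- The m = 0 term vanishes because of the factor m², so the expansion may start at m = 1.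
  have h2 := (hasSum_nat_add_iff' 1).2 (hasSum_row_qExpansion hτ hw)
  simp only [integral_qExpansion_term hτ0] at h2
  have hX := norm_e2pi_lt_one hw
  have hY : ‖e2pi w * e2pi τ‖ < 1 := by
    rw [← e2pi_add]
    exact norm_e2pi_lt_one (by rw [add_im]; positivity)
  have h3 := ((((((hasSum_neg_log hY).mul_left (1 / 2)).add
    ((hasSum_neg_log hX).mul_left (1 / 2))).sub
    ((summable_dilog hY.le).hasSum.mul_left (1 / (2 * Real.pi * I * τ)))).add
    ((summable_dilog hX.le).hasSum.mul_left (1 / (2 * Real.pi * I * τ)))).sub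
    (((hasSum_geometric_of_norm_lt_one hY).mul_left (e2pi w * e2pi τ)).mul_left
      (2 * Real.pi * I * τ / 12))).add
    (((hasSum_geometric_of_norm_lt_one hX).mul_left (e2pi w)).mul_left
      (2 * Real.pi * I * τ / 12))
  have h4 := h2.unique h3
  simp only [Finset.range_one, Finset.sum_singleton, Nat.cast_zero, ne_eq, OfNat.ofNat_ne_zero,
    not_false_eq_true, zero_pow, zero_mul, mul_zero, intervalIntegral.integral_zero,
    sub_zero] at h4
  rw [h4] at h1
  convert! h1 using 1
  rw [rowPotential, rowPotential, e2pi_add, dilog, dilog]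
  ring

lemma add_nat_mul_im_pos {τ ξ : ℂ} (hτ : 0 < τ.im) (hξ : 0 < ξ.im) (n : ℕ) :
    0 < (ξ + n * τ).im := by
  have : (ξ + n * τ).im = ξ.im + n * τ.im := by simp
  rw [this]
  positivity

lemma e2pi_add_nat_mul (ξ τ : ℂ) (n : ℕ) : e2pi (ξ + n * τ) = e2pi ξ * e2pi τ ^ n := by
  rw [e2pi_add, e2pi_natCast_mul]

lemma multipliable_qPoch (x : ℂ) {q : ℂ} (hq : ‖q‖ < 1) :
    Multipliable fun n : ℕ => 1 - x * q ^ n := by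
  simp only [sub_eq_add_neg]
  refine multipliable_one_add_of_summable ?_
  simp only [norm_neg, norm_mul, norm_pow]
  exact (summable_geometric_of_lt_one (norm_nonneg _) hq).mul_left _

/-- The total sum of Gudermann remainders over the half lattice `ξ + ℤ + ℕ τ`. -/
def latticeSum (τ ξ : ℂ) : ℂ := ∑' k : ℤ, binetRho ((ξ + k) / τ)

lemma hasSum_latticeSum {τ ξ : ℂ} (hτ : 0 < τ.im) (hξ : 0 < ξ.im) :
    HasSum (fun k : ℤ => binetRho ((ξ + k) / τ)) (latticeSum τ ξ) := by
  have h := summable_gudermannRem_lattice hτ hξ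
  have := h.hasSum.prod_fiberwise (g := fun k : ℤ => binetRho ((ξ + k) / τ)) fun k =>
    (h.comp_injective (Prod.mk_right_injective k)).hasSum
  exact this.summable.hasSum

/-- The absolutely convergent double sum read in the other order; raising n by one translates ξ by
τ, since (ξ + k)/τ + n = (ξ + nτ + k)/τ. -/
lemma hasSum_rows {τ ξ : ℂ} (hτ : 0 < τ.im) (hξ : 0 < ξ.im) :
    HasSum (fun n : ℕ => -log (1 - e2pi (ξ + n * τ)) + (rowPotential τ (e2pi (ξ + n * τ)) -
      rowPotential τ (e2pi (ξ + n * τ + τ)))) (latticeSum τ ξ) := by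
  have hτ0 : τ ≠ 0 := by rintro rfl; simp at hτ
  have h := summable_gudermannRem_lattice hτ hξ
  have h1 := h.hasSum.prod_fiberwise (g := fun k : ℤ => binetRho ((ξ + k) / τ)) fun k =>
    (h.comp_injective (Prod.mk_right_injective k)).hasSum
  have h2 := ((Equiv.prodComm ℕ ℤ).hasSum_iff.2 h.hasSum).prod_fiberwise
    (g := fun n : ℕ => -log (1 - e2pi (ξ + n * τ)) + (rowPotential τ (e2pi (ξ + n * τ)) -
      rowPotential τ (e2pi (ξ + n * τ + τ)))) fun n => by
    refine (hasSum_row hτ (add_nat_mul_im_pos hτ hξ n)).congr_fun fun k => ?_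
    simp only [Function.comp_apply, Equiv.prodComm_apply, Prod.swap_prod_mk, Function.uncurry]
    congr 1
    field_simp
    ring
  rw [latticeSum, h1.tsum_eq]
  exact h2

/-- Since |xq^n| < 1, principal logarithms suffice throughout, and the telescoping ends because the
potential tends to 0 with its argument xq^N. -/
lemma qPoch_eq_exp_latticeSum {τ ξ : ℂ} (hτ : 0 < τ.im) (hξ : 0 < ξ.im) :
    qPoch (e2pi ξ) (e2pi τ) = exp (rowPotential τ (e2pi ξ) - latticeSum τ ξ) := by
  have h1 := (hasSum_rows hτ hξ).tendsto_sum_nat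
  have h2 := (multipliable_qPoch (e2pi ξ) (norm_e2pi_lt_one hτ)).hasProd.tendsto_prod_nat
  have h3 : Tendsto (fun N : ℕ => rowPotential τ (e2pi (ξ + N * τ))) atTop (𝓝 0) := by
    refine (tendsto_rowPotential_zero τ).comp ?_
    simp only [e2pi_add_nat_mul]
    simpa using (tendsto_pow_atTop_nhds_zero_of_norm_lt_one
      (norm_e2pi_lt_one hτ)).const_mul (e2pi ξ)
  have h4 : ∀ N : ℕ, ∏ n ∈ Finset.range N, (1 - e2pi ξ * e2pi τ ^ n) =
      exp (rowPotential τ (e2pi ξ) - ∑ n ∈ Finset.range N, (-log (1 - e2pi (ξ + n * τ)) +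
        (rowPotential τ (e2pi (ξ + n * τ)) - rowPotential τ (e2pi (ξ + n * τ + τ)))) -
        rowPotential τ (e2pi (ξ + N * τ))) := by
    intro N
    induction N with
    | zero => simp
    | succ N ih =>
      rw [Finset.prod_range_succ, ih, Finset.sum_range_succ, ← e2pi_add_nat_mul]
      have h5 : 1 - e2pi (ξ + N * τ) ≠ 0 :=
        one_sub_e2pi_ne_zero (add_nat_mul_im_pos hτ hξ N)
      have h6 : ξ + N * τ + τ = ξ + (N + 1 : ℕ) * τ := by push_cast; ring
      conv_lhs => rw [← exp_log h5, ← exp_add]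
      rw [h6]
      congr 1
      ring
  have h5 := (continuous_exp.tendsto _).comp ((h1.const_sub (rowPotential τ (e2pi ξ))).sub h3)
  rw [sub_zero] at h5
  exact tendsto_nhds_unique h2 (h5.congr fun N => (h4 N).symm)

/-! ### Restoring the leading terms by symmetric summation. -/

/-- `μ(ξ/τ) + ∑_{k ≥ 1} (μ((ξ + k)/τ) + μ((ξ - k)/τ))`. -/
def symmetricSum (τ ξ : ℂ) : ℂ :=
  binetMu (ξ / τ) +
    ∑' k : ℕ, (binetMu ((ξ + ((k : ℂ) + 1)) / τ) + binetMu ((ξ - ((k : ℂ) + 1)) / τ))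

lemma hasSum_cotTerm {ξ : ℂ} (hξ : 0 < ξ.im) :
    HasSum (fun k : ℕ => 1 / (ξ - (k + 1)) + 1 / (ξ + (k + 1)))
      (Real.pi * cot (Real.pi * ξ) - 1 / ξ) := by
  have h : ξ ∈ integerComplement := UpperHalfPlane.coe_mem_integerComplement ⟨ξ, hξ⟩
  rw [cot_series_rep' h]
  exact (summable_cotTerm h).hasSum

/-- The terms 1/(12z) are not absolutely summable over k ∈ ℤ; pairing k with -k makes them a
cotangent series. -/
lemma hasSum_symmetricSum {τ ξ : ℂ} (hτ : 0 < τ.im) (hξ : 0 < ξ.im) :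
    HasSum (fun k : ℕ => binetMu ((ξ + ((k : ℂ) + 1)) / τ) + binetMu ((ξ - ((k : ℂ) + 1)) / τ))
      (τ / 12 * (Real.pi * cot (Real.pi * ξ)) + latticeSum τ ξ - binetMu (ξ / τ)) := by
  have hs := slitPlane_lattice hτ hξ
  -- `nat_add_neg` counts k = 0 twice; dropping the first pair leaves the lattice sum less `binetRho
  -- (ξ/τ)`.
  have h1 := (hasSum_nat_add_iff' 1).2 (hasSum_latticeSum hτ hξ).nat_add_neg
  have h2 := ((hasSum_cotTerm hξ).mul_left (τ / 12)).add h1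
  have h0 := binetMu_eq_add_binetRho (z := ξ / τ) (by simpa using hs 0)
  convert! h2 using 1
  · funext k
    have h3 := binetMu_eq_add_binetRho (hs (k + 1))
    have h4 := binetMu_eq_add_binetRho (hs (-(k + 1)))
    push_cast at h3 h4 ⊢
    rw [← sub_eq_add_neg] at h4 ⊢
    rw [h3, h4]
    field_simp
    ring
  · simp only [Finset.range_one, Finset.sum_singleton, Int.cast_zero, add_zero, Nat.cast_zero,
      neg_zero]
    rw [h0]
    field_simp
    ring

lemma symmetricSum_eq {τ ξ : ℂ} (hτ : 0 < τ.im) (hξ : 0 < ξ.im) :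
    symmetricSum τ ξ = τ / 12 * (Real.pi * cot (Real.pi * ξ)) + latticeSum τ ξ := by
  rw [symmetricSum, (hasSum_symmetricSum hτ hξ).tsum_eq]
  ring

lemma pi_mul_cot_pi_mul {ξ : ℂ} (hξ : 0 < ξ.im) :
    Real.pi * cot (Real.pi * ξ) =
      -(Real.pi * I) - 2 * Real.pi * I * (e2pi ξ / (1 - e2pi ξ)) := by
  have h1 := pi_mul_cot_pi_q_exp ⟨ξ, hξ⟩
  have h2 := one_sub_e2pi_ne_zero hξ
  have h3 : ∑' n : ℕ, exp (2 * Real.pi * I * ξ) ^ n = (1 - e2pi ξ)⁻¹ :=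
    tsum_geometric_of_norm_lt_one (norm_e2pi_lt_one hξ)
  refine h1.trans ?_
  change _ - _ * ∑' n : ℕ, exp (2 * Real.pi * I * ξ) ^ n = _
  rw [h3]
  field_simp
  ring

/-- In (τ/12) π cot(πξ) the constant -πi yields log q^{-1/24}, and the rest cancels the term with
X/(1 - X) in `rowPotential`. -/
theorem qPoch_eq_exp_symmetricSum {τ ξ : ℂ} (hτ : 0 < τ.im) (hξ : 0 < ξ.im) :
    qPoch (e2pi ξ) (e2pi τ) = e2pi (-τ / 24) * psqrt (1 - e2pi ξ) *
      exp (dilog (e2pi ξ) / (2 * Real.pi * I * τ) - symmetricSum τ ξ) := by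
  have h : e2pi (-τ / 24) = exp (2 * Real.pi * I * (-τ / 24)) := rfl
  rw [qPoch_eq_exp_latticeSum hτ hξ, symmetricSum_eq hτ hξ, pi_mul_cot_pi_mul hξ, h, psqrt,
    ← exp_add, ← exp_add, rowPotential]
  congr 1
  ring

/-! ### Holomorphic branches of log(1 - x), Li₂(x) and √(1 - x) on D_τ. -/

/-- A holomorphic function on an open set which is star-shaped about `0` has a primitive. -/
lemma exists_primitive_of_starConvex {U : Set ℂ} (hU : IsOpen U) (hs : StarConvex ℝ 0 U)
    {f : ℂ → ℂ} (hf : DifferentiableOn ℂ f U) : ∃ F : ℂ → ℂ, ∀ z ∈ U, HasDerivAt F (f z) z := by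
  refine ⟨fun z => ∫ s in (0 : ℝ)..1, z * f (s * z), fun z hz => ?_⟩
  have hseg : segment ℝ 0 z ⊆ U := hs.segment_subset hz
  have hcomp : IsCompact (segment ℝ 0 z) := by
    rw [← convexHull_pair]
    exact ((Set.finite_singleton z).insert 0).isCompact_convexHull (𝕜 := ℝ)
  -- A thickening of the segment is convex and so carries a primitive; near z the integral from 0
  -- agrees with it up to a constant.
  obtain ⟨δ, hδ, hδU⟩ := hcomp.exists_thickening_subset_open hU hseg
  set V := Metric.thickening δ (segment ℝ 0 z) with hV
  have hVo : IsOpen V := Metric.isOpen_thickening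
  have hVc : Convex ℝ V := (convex_segment 0 z).thickening δ
  obtain ⟨g, hg⟩ := hVc.exists_forall_hasDerivWithinAt (hf.mono hδU)
  have hg' : ∀ w ∈ V, HasDerivAt g (f w) w := fun w hw => (hg w hw).hasDerivAt (hVo.mem_nhds hw)
  have h0V : (0 : ℂ) ∈ V := Metric.self_subset_thickening hδ _ (left_mem_segment ℝ 0 z)
  have hzV : z ∈ V := Metric.self_subset_thickening hδ _ (right_mem_segment ℝ 0 z)
  refine ((hg' z hzV).sub_const (g 0)).congr_of_eventuallyEq ?_
  filter_upwards [hVo.mem_nhds hzV] with w hw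
  have hmem : ∀ s ∈ Icc (0 : ℝ) 1, (s : ℂ) * w ∈ V := fun s hs => by
    have := hVc.starConvex h0V |>.smul_mem hw hs.1 hs.2
    simpa using this
  have := integral_of_hasDerivAt_ofReal (f := fun s => w * f (s * w)) (F := fun s => g (s * w))
    (fun s hs => ?_) ?_
  · simpa using this
  · have h1 : HasDerivAt (fun s : ℂ => s * w) w (s : ℂ) := by
      simpa using (hasDerivAt_id (s : ℂ)).mul_const w
    simpa [mul_comm, Function.comp_def] using (hg' _ (hmem s (by rwa [uIcc_of_le zero_le_one] at hs))).comp (s : ℂ) h1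
  · refine continuousOn_const.mul ((hf.mono hδU).continuousOn.comp (by fun_prop) fun s hs => ?_)
    exact hmem s (by rwa [uIcc_of_le zero_le_one] at hs)

lemma isOpen_cutPlane : IsOpen cutPlane := by
  have : cutPlane = {ξ | 1 - ξ ∈ slitPlane ∧ 1 + ξ ∈ slitPlane} := by
    ext ξ
    refine ⟨fun h => by simpa using slitPlane_of_mem_cutPlane h 0, fun h r hr => ?_⟩
    subst hr
    obtain ⟨h1, h2⟩ := h
    norm_cast at h1 h2
    rw [ofReal_mem_slitPlane] at h1 h2
    constructor <;> linarith
  rw [this]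
  exact (isOpen_slitPlane.preimage (by fun_prop)).inter (isOpen_slitPlane.preimage (by fun_prop))

lemma starConvex_cutPlane : StarConvex ℝ 0 cutPlane := by
  refine starConvex_zero_iff.2 fun z hz a ha0 ha1 r hr => ?_
  rcases ha0.eq_or_lt with rfl | ha
  · have : r = 0 := by simpa using hr.symm
    subst this
    norm_num
  · have h := hz (r / a) (by
      have : (a : ℂ) ≠ 0 := ofReal_ne_zero.2 ha.ne'
      rw [real_smul] at hr
      push_cast
      rw [← hr]
      field_simp)
    rw [lt_div_iff₀ ha, div_lt_iff₀ ha] at h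
    constructor <;> nlinarith [h.1, h.2]

lemma isOpen_xiDomain {τ : ℂ} : IsOpen (xiDomain τ) :=
  isOpen_cutPlane.inter (isOpen_slitPlane.preimage (by fun_prop))

lemma mem_xiDomain_of_im_pos {τ ξ : ℂ} (hτ : 0 < τ.im) (hξ : 0 < ξ.im) : ξ ∈ xiDomain τ := by
  refine ⟨fun r hr => ?_, by simpa using slitPlane_lattice hτ hξ 0⟩
  rw [hr, ofReal_im] at hξ
  exact absurd hξ (lt_irrefl _)

lemma exp_pi_mul_sin {ξ : ℂ} :
    exp (Real.pi * I * ξ) * sin (Real.pi * ξ) = (1 - e2pi ξ) * (I / 2) := by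
  have h1 : exp (2 * Real.pi * I * ξ) = exp (Real.pi * I * ξ) * exp (Real.pi * I * ξ) := by
    rw [← exp_add]; congr 1; ring
  have h2 : exp (Real.pi * I * ξ) * exp (-(Real.pi * ξ) * I) = 1 := by
    rw [← exp_add, ← exp_zero]; congr 1; ring
  have h3 : Real.pi * ξ * I = Real.pi * I * ξ := by ring
  rw [e2pi, h1, sin, h3]
  linear_combination I / 2 * h2

/-- The regular part of the logarithm of `1 - e^{2πiξ}`. -/
def logOneSubReg (ξ : ℂ) : ℂ := Real.pi * I * ξ - logGammaBinet (1 + ξ) - logGammaBinet (1 - ξ)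

lemma differentiableOn_logOneSubReg : DifferentiableOn ℂ logOneSubReg cutPlane := by
  intro ξ hξ
  have h := slitPlane_of_mem_cutPlane hξ 0
  simp only [Nat.cast_zero, zero_add] at h
  have h1 : DifferentiableAt ℂ (fun ξ => logGammaBinet (1 + ξ)) ξ :=
    (differentiableAt_logGammaBinet h.2).comp ξ (by fun_prop : DifferentiableAt ℂ (1 + ·) ξ)
  have h2 : DifferentiableAt ℂ (fun ξ => logGammaBinet (1 - ξ)) ξ :=
    (differentiableAt_logGammaBinet h.1).comp ξ (by fun_prop : DifferentiableAt ℂ (1 - ·) ξ)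
  unfold logOneSubReg
  exact (((by fun_prop : DifferentiableAt ℂ (fun ξ : ℂ => Real.pi * I * ξ) ξ).sub h1).sub
    h2).differentiableWithinAt

/-- In the cut plane 1 - e^{2πiξ} vanishes only at 0. The identity Γ(1 + ξ) Γ(1 - ξ) sin(πξ) = πξ
splits this zero off as log(ξ/τ), whose cut is the one removed from D_τ. -/
lemma exp_log_add_logOneSubReg {τ ξ : ℂ} (hτ : τ ≠ 0) (hξ : ξ ∈ xiDomain τ) :
    exp (log (ξ / τ) + logOneSubReg ξ) = (1 - e2pi ξ) * (I / (2 * Real.pi * τ)) := by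
  have h := slitPlane_of_mem_cutPlane hξ.1 0
  simp only [Nat.cast_zero, zero_add] at h
  have h0 := slitPlane_ne_zero hξ.2
  have hξ0 : ξ ≠ 0 := by rintro rfl; simp at h0
  have h1 : Gamma (1 + ξ) * Gamma (1 - ξ) * sin (Real.pi * ξ) = ξ * Real.pi := by
    have hG : Gamma (1 + ξ) ≠ 0 := by
      rw [← exp_logGammaBinet h.2]; exact exp_ne_zero _
    have hG2 : Gamma (1 - ξ) ≠ 0 := by
      rw [← exp_logGammaBinet h.1]; exact exp_ne_zero _
    have h2 := Complex.Gamma_mul_Gamma_one_sub ξ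
    rw [add_comm, Gamma_add_one ξ hξ0] at hG ⊢
    have hs : sin (Real.pi * ξ) ≠ 0 := by
      intro hs
      rw [hs, div_zero] at h2
      exact mul_ne_zero (right_ne_zero_of_mul hG) hG2 h2
    rw [eq_div_iff hs] at h2
    linear_combination ξ * h2
  have hpi : (Real.pi : ℂ) ≠ 0 := ofReal_ne_zero.2 Real.pi_ne_zero
  have h3 : Gamma (1 + ξ) * Gamma (1 - ξ) ≠ 0 := by
    intro h3
    rw [h3, zero_mul] at h1
    exact mul_ne_zero hξ0 hpi h1.symm
  rw [logOneSubReg, exp_add, exp_log h0, exp_sub, exp_sub, exp_logGammaBinet h.2,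
    exp_logGammaBinet h.1, div_div]
  have h4 := exp_pi_mul_sin (ξ := ξ)
  generalize exp (Real.pi * I * ξ) = E at h4 ⊢
  generalize sin (Real.pi * ξ) = σ at h1 h4
  generalize Gamma (1 + ξ) * Gamma (1 - ξ) = G at h1 h3 ⊢
  have h5 : (1 - e2pi ξ) * (I / (2 * Real.pi * τ)) = E * σ / (Real.pi * τ) := by
    rw [h4]; field_simp
  rw [h5]
  field_simp
  linear_combination -E * h1

lemma hasDerivAt_e2pi (ξ : ℂ) : HasDerivAt e2pi (2 * Real.pi * I * e2pi ξ) ξ := by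
  have := ((hasDerivAt_id ξ).const_mul (2 * (Real.pi : ℂ) * I)).cexp
  have h : exp (2 * Real.pi * I * id ξ) * (2 * Real.pi * I * 1) = 2 * Real.pi * I * e2pi ξ := by
    rw [e2pi, id]; ring
  rw [← h]
  exact this

lemma differentiable_e2pi : Differentiable ℂ e2pi := fun ξ => (hasDerivAt_e2pi ξ).differentiableAt

lemma one_sub_mem_slitPlane {X : ℂ} (hX : ‖X‖ < 1) : 1 - X ∈ slitPlane := by
  left
  have := (re_le_norm X).trans_lt hX
  simpa using this

/-- A holomorphic branch of `log (1 - e^{2πiξ})` on `xiDomain τ`. -/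
lemma exists_logOneSub {τ : ℂ} (hτ : 0 < τ.im) :
    ∃ c : ℂ, ∀ ξ : ℂ, 0 < ξ.im → log (ξ / τ) + (logOneSubReg ξ + c) = log (1 - e2pi ξ) := by
  have hτ0 : τ ≠ 0 := by rintro rfl; simp at hτ
  have hpi : (Real.pi : ℂ) ≠ 0 := ofReal_ne_zero.2 Real.pi_ne_zero
  have hk : I / (2 * Real.pi * τ) ≠ 0 :=
    div_ne_zero I_ne_zero (mul_ne_zero (mul_ne_zero two_ne_zero hpi) hτ0)
  set g : ℂ → ℂ := fun ξ => log (1 - e2pi ξ) - (log (ξ / τ) + logOneSubReg ξ) +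
    log (I / (2 * Real.pi * τ)) with hg
  have hd : DifferentiableOn ℂ g {z | 0 < z.im} := by
    intro ξ hξ
    have h1 := mem_xiDomain_of_im_pos hτ hξ
    have h2 := differentiableOn_logOneSubReg.differentiableAt (isOpen_cutPlane.mem_nhds h1.1)
    have h3 := one_sub_mem_slitPlane (norm_e2pi_lt_one hξ)
    have h4 := differentiable_e2pi ξ
    have h5 : DifferentiableAt ℂ (fun ξ => log (1 - e2pi ξ)) ξ :=
      (h4.const_sub 1).clog h3
    have h6 : DifferentiableAt ℂ (fun ξ => log (ξ / τ)) ξ :=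
      DifferentiableAt.clog (by fun_prop) h1.2
    exact ((h5.sub (h6.add h2)).add_const _).differentiableWithinAt
  have he : ∀ z ∈ {z : ℂ | 0 < z.im}, exp (g z) = 1 := by
    intro ξ hξ
    have h1 := one_sub_e2pi_ne_zero hξ
    rw [hg]
    simp only
    rw [exp_add, exp_sub, exp_log h1, exp_log hk,
      exp_log_add_logOneSubReg hτ0 (mem_xiDomain_of_im_pos hτ hξ)]
    field_simp
  refine ⟨g I + -log (I / (2 * Real.pi * τ)), fun ξ hξ => ?_⟩
  rw [const_of_exp_eq_one isOpen_upperHalf isPreconnected_upperHalf hd he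
    (show I ∈ {z : ℂ | 0 < z.im} by simp) hξ]
  simp only [hg]
  ring

lemma hasDerivAt_dilog_e2pi {ξ : ℂ} (hξ : 0 < ξ.im) :
    HasDerivAt (fun ξ => dilog (e2pi ξ)) (-(2 * Real.pi * I) * log (1 - e2pi ξ)) ξ := by
  have hX := norm_e2pi_lt_one hξ
  obtain ⟨r, hr0, hr1⟩ := exists_between hX
  have hrr : 0 < r := (norm_nonneg _).trans_lt hr0
  have hd : HasDerivAt dilog (∑' n : ℕ, e2pi ξ ^ n / (n + 1)) (e2pi ξ) := by
    refine hasDerivAt_tsum_of_isPreconnected (u := fun n : ℕ => r ^ n)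
      (g := fun n y => y ^ (n + 1) / ((n : ℂ) + 1) ^ 2) (g' := fun n y => y ^ n / ((n : ℂ) + 1))
      (t := Metric.ball 0 r) (y₀ := 0) (summable_geometric_of_lt_one hrr.le hr1)
      Metric.isOpen_ball (convex_ball _ _).isPreconnected (fun n y hy => ?_) (fun n y hy => ?_)
      (by simpa using hrr) (summable_dilog (by simp)) (by simpa using hr0)
    · have hn : (n : ℂ) + 1 ≠ 0 := Nat.cast_add_one_ne_zero n
      have h := (hasDerivAt_pow (n + 1) y).div_const (((n : ℂ) + 1) ^ 2)
      have h' : ((n + 1 : ℕ) : ℂ) * y ^ (n + 1 - 1) / ((n : ℂ) + 1) ^ 2 = y ^ n / (n + 1) := by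
        rw [Nat.add_sub_cancel]
        push_cast
        field_simp
      rwa [h'] at h
    · have hn : ‖(n : ℂ) + 1‖ = n + 1 := by
        rw [← Nat.cast_add_one, norm_natCast]; push_cast; ring
      rw [norm_div, norm_pow, hn]
      have : ‖y‖ ≤ r := by simpa using (Metric.mem_ball.1 hy).le
      refine (div_le_self (by positivity) (by simp)).trans ?_
      gcongr
  have hs : e2pi ξ * ∑' n : ℕ, e2pi ξ ^ n / (n + 1) = -log (1 - e2pi ξ) := by
    rw [← (hasSum_neg_log hX).tsum_eq, ← tsum_mul_left]
    refine tsum_congr fun n => ?_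
    push_cast
    ring
  convert! hd.comp ξ (hasDerivAt_e2pi ξ) using 1
  linear_combination (-2 * Real.pi * I) * hs

/-- The derivative of Li₂(e^{2πiξ}) is -2πi log(1 - e^{2πiξ}). As 0 is not in D_τ, the part log(ξ/τ)
is integrated explicitly, and only the regular part needs the star-shaped cut plane. -/
theorem exists_branches {τ : ℂ} (hτ : 0 < τ.im) :
    ∃ L S : ℂ → ℂ, IsDilogBranch τ L ∧ IsSqrtBranch τ S := by
  have hτ0 : τ ≠ 0 := by rintro rfl; simp at hτ
  obtain ⟨c, hc⟩ := exists_logOneSub hτ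
  have hreg : DifferentiableOn ℂ (fun ξ => logOneSubReg ξ + c) cutPlane :=
    differentiableOn_logOneSubReg.add_const c
  have hlog : ∀ ξ ∈ xiDomain τ, HasDerivAt (fun ξ => log (ξ / τ)) (1 / ξ) ξ := by
    intro ξ hξ
    have h0 := slitPlane_ne_zero hξ.2
    have hξ0 : ξ ≠ 0 := by rintro rfl; simp at h0
    convert! ((hasDerivAt_id ξ).div_const τ).clog hξ.2 using 1
    simp only [id]
    field_simp
  obtain ⟨Λ, hΛ⟩ := exists_primitive_of_starConvex isOpen_cutPlane starConvex_cutPlane hreg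
  set M : ℂ → ℂ := fun ξ => -(2 * Real.pi * I) * (ξ * (log (ξ / τ) - 1) + Λ ξ) with hM
  have hMd : ∀ ξ ∈ xiDomain τ, HasDerivAt M
      (-(2 * Real.pi * I) * (log (ξ / τ) + (logOneSubReg ξ + c))) ξ := by
    intro ξ hξ
    have h0 := slitPlane_ne_zero hξ.2
    have hξ0 : ξ ≠ 0 := by rintro rfl; simp at h0
    convert! (((hasDerivAt_id ξ).mul ((hlog ξ hξ).sub_const 1)).add (hΛ ξ hξ.1)).const_mul
      (-(2 * Real.pi * I)) using 1
    simp only [id]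
    field_simp
    ring
  refine ⟨fun ξ => M ξ + (dilog (e2pi I) - M I),
    fun ξ => exp ((log (ξ / τ) + (logOneSubReg ξ + c)) / 2), ⟨?_, ?_⟩, ⟨?_, ?_⟩⟩
  · exact fun ξ hξ => ((hMd ξ hξ).differentiableAt.add_const _).differentiableWithinAt
  · intro ξ hξ
    have hd : ∀ z ∈ {z : ℂ | 0 < z.im}, HasDerivAt (fun z => dilog (e2pi z) - M z) 0 z := by
      intro z hz
      convert! (hasDerivAt_dilog_e2pi hz).sub (hMd z (mem_xiDomain_of_im_pos hτ hz)) using 1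
      rw [hc z hz, sub_self]
    have := isOpen_upperHalf.is_const_of_deriv_eq_zero isPreconnected_upperHalf
      (fun z hz => (hd z hz).differentiableAt.differentiableWithinAt)
      (fun z hz => (hd z hz).deriv) (show I ∈ {z : ℂ | 0 < z.im} by simp) hξ
    linear_combination this
  · intro ξ hξ
    have h1 := (hlog ξ hξ).differentiableAt
    have h2 := hreg.differentiableAt (isOpen_cutPlane.mem_nhds hξ.1)
    exact ((h1.add h2).div_const 2).cexp.differentiableWithinAt
  · intro ξ hξ
    rw [hc ξ hξ, psqrt]

/-! ### Continuation in `ξ` and the product formula -/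

lemma im_neg_one_div_pos {τ : ℂ} (hτ : 0 < τ.im) : 0 < (-1 / τ).im := by
  have hτ0 : τ ≠ 0 := by rintro rfl; simp at hτ
  rw [neg_div, neg_im, one_div, inv_im, neg_div, neg_neg]
  exact div_pos hτ (normSq_pos.2 hτ0)

lemma differentiable_qPoch {q : ℂ} (hq : ‖q‖ < 1) : Differentiable ℂ fun x => qPoch x q := by
  intro x
  have hs : Summable fun n : ℕ => (‖x‖ + 1) * ‖q‖ ^ n :=
    (summable_geometric_of_lt_one (norm_nonneg _) hq).mul_left _
  have h := hs.hasProdLocallyUniformlyOn_nat_one_add (f := fun n y => -(y * q ^ n))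
    (Metric.isOpen_ball (x := (0 : ℂ)) (ε := ‖x‖ + 1)) (.of_forall fun n y hy => by
      rw [norm_neg, norm_mul, norm_pow]
      gcongr
      simpa using (Metric.mem_ball.1 hy).le) (fun n => by fun_prop)
  have h2 := h.differentiableOn (.of_forall fun s => by
    simpa [Finset.prod_fn] using DifferentiableOn.finsetProd (fun _ _ => by fun_prop))
    Metric.isOpen_ball
  simp only [← sub_eq_add_neg] at h2
  exact h2.differentiableAt (Metric.isOpen_ball.mem_nhds (by simp))

lemma qPoch_eq_one_sub_mul (x : ℂ) {q : ℂ} (hq : ‖q‖ < 1) :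
    qPoch x q = (1 - x) * qPoch (x * q) q := by
  have h : Multipliable fun n : ℕ => 1 - x * q ^ (n + 1) :=
    (multipliable_qPoch (x * q) hq).congr fun n => by rw [mul_assoc, ← pow_succ']
  have h1 := tprod_eq_zero_mul' (f := fun n : ℕ => 1 - x * q ^ n) h
  have h2 : ∏' n : ℕ, (1 - x * q ^ (n + 1)) = qPoch (x * q) q :=
    tprod_congr fun n => by rw [mul_assoc, ← pow_succ']
  rw [h2, pow_zero, mul_one] at h1
  exact h1

lemma summable_pairTerm {p : ℂ × ℂ} (hτ : p.1 ∈ slitPlane) : Summable fun k => pairTerm k p := by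
  obtain ⟨K, -, -, h⟩ := exists_tailP hτ 0
  exact (summable_nat_add_iff K).1 h.self_of_nhds.1

/-- The product formula in the region `Im ξ > 0`, `Im (ξ/τ) > 0`. -/
lemma prodE_mul_qPoch {τ ξ : ℂ} (hτ : 0 < τ.im) (hξ : 0 < ξ.im) (hz : 0 < (ξ / τ).im) :
    exp (-binetMu (ξ / τ)) * prodE (τ, ξ) *
      qPoch (e2pi (ξ / τ) * e2pi (-1 / τ)) (e2pi (-1 / τ)) = exp (-symmetricSum τ ξ) := by
  have him := im_neg_one_div_pos hτ
  have hq := norm_e2pi_lt_one him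
  have hpos : ∀ k : ℕ, 0 < ((ξ - (k + 1)) / τ).im := by
    intro k
    have h1 : (ξ - (k + 1)) / τ = ξ / τ + ((k + 1 : ℝ) : ℂ) * (-1 / τ) := by push_cast; ring
    rw [h1, add_im, im_ofReal_mul]
    positivity
  have hfac : ∀ k, ratioFactor k (τ, ξ) = exp (pairTerm k (τ, ξ)) := by
    intro k
    have h1 : ((k + 1 - ξ) / τ).im < 0 := by
      have h2 : (k + 1 - ξ) / τ = -((ξ - (k + 1)) / τ) := by ring
      rw [h2, neg_im]
      linarith [hpos k]
    have h3 : 0 < (k + 1 + ξ).im := by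
      have : (k + 1 + ξ : ℂ).im = ξ.im := by simp
      rwa [this]
    refine ratioFactor_eq_exp (Or.inr h1.ne) ?_ (log_sub_log_of_im_neg hτ h1)
      (log_sub_log_of_im_pos hτ h3)
    have := slitPlane_lattice hτ hξ (k + 1)
    push_cast at this
    rwa [add_comm] at this
  have hP : HasProd (fun k => ratioFactor k (τ, ξ)) (prodE (τ, ξ)) := by
    have : Multipliable fun k => ratioFactor k (τ, ξ) := by
      simp only [hfac]
      exact ⟨_, (summable_pairTerm (p := (τ, ξ)) (mem_slitPlane_of_im_pos hτ)).hasSum.cexp⟩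
    exact this.hasProd
  have hQ := (multipliable_qPoch (e2pi (ξ / τ) * e2pi (-1 / τ)) hq).hasProd
  have hT := (hasSum_symmetricSum hτ hξ).summable.hasSum.neg.cexp
  have hPQ := (hP.mul hQ).unique (hT.congr_fun fun k => ?_)
  · rw [symmetricSum, neg_add, exp_add, ← hPQ, qPoch]
    ring
  · have h1 : e2pi (ξ / τ) * e2pi (-1 / τ) * e2pi (-1 / τ) ^ k = e2pi ((ξ - (k + 1)) / τ) := by
      rw [mul_assoc, ← pow_succ', ← e2pi_natCast_mul, ← e2pi_add]
      congr 1
      push_cast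
      ring
    -- Reflection at (ξ - (k+1))/τ: the factor 1 - x^*q^{*(k+1)} exchanges μ((k+1-ξ)/τ) for
    -- -μ((ξ-(k+1))/τ).
    have h2 := exp_binetMu_add_neg (hpos k)
    have h3 : -((ξ - (k + 1)) / τ) = (k + 1 - ξ) / τ := by ring
    rw [h3] at h2
    simp only [Function.comp_apply]
    rw [hfac, h1, pairTerm]
    simp only
    have h4 : binetMu ((k + 1 - ξ) / τ) - binetMu ((k + 1 + ξ) / τ) =
        (binetMu ((ξ - (k + 1)) / τ) + binetMu ((k + 1 - ξ) / τ)) +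
        -(binetMu ((ξ + (k + 1)) / τ) + binetMu ((ξ - (k + 1)) / τ)) := by
      rw [add_comm ξ]; ring
    rw [h4, exp_add, mul_right_comm, h2, one_mul]

/-- Scaling towards 0 brings any point into the unit disc without leaving D_τ; there D_τ is a disc
slit along a radius, and a segment leads to a positive multiple of τ. -/
lemma isConnected_xiDomain {τ : ℂ} (hτ : 0 < τ.im) : IsConnected (xiDomain τ) := by
  have hτ0 : τ ≠ 0 := by rintro rfl; simp at hτ
  have hτn : 0 < ‖τ‖ := norm_pos_iff.2 hτ0
  have hball : ∀ ξ : ℂ, ‖ξ‖ < 1 → ξ ∈ cutPlane := by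
    rintro _ h r rfl
    rw [norm_real, Real.norm_eq_abs, abs_lt] at h
    exact h
  have hscale : ∀ a : ℝ, 0 < a → ∀ z ∈ slitPlane, (a : ℂ) * z ∈ slitPlane := by
    rintro a ha z (h | h)
    · left
      rw [re_ofReal_mul]
      positivity
    · right
      rw [im_ofReal_mul]
      exact mul_ne_zero ha.ne' h
  set δ : ℝ := 1 / (2 * ‖τ‖) with hδ
  have hδ0 : 0 < δ := by positivity
  have hx0 : ‖(δ : ℂ) * τ‖ < 1 := by
    rw [norm_mul, norm_real, Real.norm_of_nonneg hδ0.le, hδ]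
    field_simp
    norm_num
  refine IsPathConnected.isConnected ⟨δ * τ, ⟨hball _ hx0, ?_⟩, fun {ξ} hξ => ?_⟩
  · rw [mul_div_cancel_right₀ _ hτ0, ofReal_mem_slitPlane]
    exact hδ0
  set ε : ℝ := 1 / (2 * (1 + ‖ξ‖)) with hε
  have hε0 : 0 < ε := by positivity
  have hε1 : ε ≤ 1 := by
    rw [hε, div_le_one (by positivity)]
    linarith [norm_nonneg ξ]
  have hx1 : ‖(ε : ℂ) * ξ‖ < 1 := by
    rw [norm_mul, norm_real, Real.norm_of_nonneg hε0.le, hε]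
    rw [one_div_mul_eq_div, div_lt_one (by positivity)]
    linarith [norm_nonneg ξ]
  have hseg1 : segment ℝ ((δ : ℂ) * τ) (ε * ξ) ⊆ xiDomain τ := by
    rintro _ ⟨a, b, ha, hb, hab, rfl⟩
    refine ⟨hball _ ?_, ?_⟩
    · have := (convex_ball (0 : ℂ) 1) (by simpa using hx0 : (δ : ℂ) * τ ∈ _)
        (by simpa using hx1 : (ε : ℂ) * ξ ∈ _) ha hb hab
      simpa using this
    · rcases hb.eq_or_lt with rfl | hb
      · have : a = 1 := by simpa using hab
        subst this
        simp only [one_smul, zero_smul, add_zero]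
        rw [mul_div_cancel_right₀ _ hτ0, ofReal_mem_slitPlane]
        exact hδ0
      · have h1 : (a • ((δ : ℂ) * τ) + b • ((ε : ℂ) * ξ)) / τ =
            ((b * ε : ℝ) : ℂ) * (ξ / τ) + ((a * δ : ℝ) : ℂ) := by
          rw [real_smul, real_smul]
          push_cast
          field_simp
          ring
        rw [h1]
        exact slitPlane_add_nonneg (hscale _ (by positivity) _ hξ.2) (by positivity)
  have hseg2 : segment ℝ ((ε : ℂ) * ξ) ξ ⊆ xiDomain τ := by
    rintro _ ⟨a, b, ha, hb, hab, rfl⟩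
    have hc : 0 < a * ε + b := by
      rcases ha.eq_or_lt with rfl | ha
      · linarith
      · positivity
    have h1 : a • ((ε : ℂ) * ξ) + b • ξ = (a * ε + b) • ξ := by
      rw [real_smul, real_smul, real_smul]
      push_cast
      ring
    rw [h1]
    refine ⟨starConvex_cutPlane.smul_mem hξ.1 hc.le (by nlinarith), ?_⟩
    rw [real_smul, mul_div_assoc]
    exact hscale _ hc _ hξ.2
  exact (JoinedIn.of_segment_subset hseg1).trans (JoinedIn.of_segment_subset hseg2)

lemma meromorphicAt_stirlingRatio {f : ℂ → ℂ} {ξ : ℂ} (hf : AnalyticAt ℂ f ξ)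
    (hs : f ξ ∈ slitPlane) (τ : ℂ) : MeromorphicAt (fun ξ => stirlingRatio (f ξ) τ) ξ := by
  have h1 : MeromorphicAt (fun ξ => Gamma (f ξ / τ)) ξ :=
    (Meromorphic.Gamma _).comp_analyticAt (g := fun ξ => f ξ / τ) hf.div_const
  have h2 : AnalyticAt ℂ (fun ξ => exp (f ξ / τ + (1 / 2 - f ξ / τ) * (log (f ξ) - log τ))) ξ := by
    have := hf.clog hs
    fun_prop
  exact (h1.mul h2.meromorphicAt).div (.const _ _)

/-- Meromorphy across the points ±(m + nτ) lets the identity theorem run on D_τ itself, without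
showing that D_τ stays connected when they are removed. -/
lemma meromorphicAt_prodE {τ ξ : ℂ} (hτ : 0 < τ.im) (hξ : ξ ∈ cutPlane) :
    MeromorphicAt (fun ξ => prodE (τ, ξ)) ξ := by
  obtain ⟨K, hd, h⟩ := exists_prodE_eq (p₀ := (τ, ξ)) hτ
  have hc : Tendsto (fun ξ : ℂ => (τ, ξ)) (𝓝 ξ) (𝓝 (τ, ξ)) :=
    (by fun_prop : Continuous fun ξ : ℂ => (τ, ξ)).tendsto ξ
  have h1 : ∀ k, MeromorphicAt (fun ξ => ratioFactor k (τ, ξ)) ξ := fun k =>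
    (meromorphicAt_stirlingRatio (f := fun ξ => k + 1 - ξ) (by fun_prop)
      (slitPlane_of_mem_cutPlane hξ k).1 τ).div
    (meromorphicAt_stirlingRatio (f := fun ξ => k + 1 + ξ) (by fun_prop)
      (slitPlane_of_mem_cutPlane hξ k).2 τ)
  have h2 : AnalyticAt ℂ (fun ξ => exp (tailP K (τ, ξ))) ξ := by
    refine analyticAt_iff_eventually_differentiableAt.2 ((hc.eventually hd).mono fun ζ hζ => ?_)
    have : DifferentiableAt ℂ (fun ζ : ℂ => tailP K (τ, ζ)) ζ :=
      DifferentiableAt.comp ζ hζ (by fun_prop : DifferentiableAt ℂ (fun ζ : ℂ => (τ, ζ)) ζ)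
    exact this.cexp
  refine ((MeromorphicAt.fun_prod (s := Finset.range K) fun k _ => h1 k).mul
    h2.meromorphicAt).congr ?_
  exact ((hc.eventually h).filter_mono nhdsWithin_le_nhds).mono fun ζ hζ => hζ.symm

/-- A meromorphic function on a connected open set that vanishes near one point vanishes at every
point where it is continuous. -/
lemma eq_zero_of_meromorphicOn {U : Set ℂ} (hU : IsConnected U) {h : ℂ → ℂ}
    (hm : MeromorphicOn h U) {z₀ z : ℂ} (hz₀ : z₀ ∈ U) (h0 : ∀ᶠ w in 𝓝 z₀, h w = 0) (hz : z ∈ U)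
    (hc : ContinuousAt h z) : h z = 0 := by
  have h1 : meromorphicOrderAt h z₀ = ⊤ :=
    meromorphicOrderAt_eq_top_iff.2 (h0.filter_mono nhdsWithin_le_nhds)
  have h2 : meromorphicOrderAt h z = ⊤ := by
    by_contra hne
    exact hm.meromorphicOrderAt_ne_top_of_isPreconnected hU.isPreconnected hz hz₀ hne h1
  have h3 := meromorphicOrderAt_eq_top_iff.1 h2
  refine tendsto_nhds_unique (hc.tendsto.mono_left (nhdsWithin_le_nhds (s := {z}ᶜ))) ?_
  exact tendsto_const_nhds.congr' (h3.mono fun w hw => hw.symm)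

theorem qPoch_eq_mul_prodE {τ : ℂ} (hτ : 0 < τ.im) {L S : ℂ → ℂ} (hL : IsDilogBranch τ L)
    (hS : IsSqrtBranch τ S) {ξ : ℂ} (hξ : ξ ∈ xiDomain τ) (hsing : ξ ∉ singularPoints τ) :
    qPoch (e2pi ξ) (e2pi τ) = e2pi (-τ / 24) * S ξ *
      qPoch (e2pi (ξ / τ) * e2pi (-1 / τ)) (e2pi (-1 / τ)) *
      exp (L ξ / (2 * Real.pi * I * τ) - binetMu (ξ / τ)) * prodE (τ, ξ) := by
  set A : ℂ → ℂ := fun ξ => qPoch (e2pi ξ) (e2pi τ) with hA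
  set B : ℂ → ℂ := fun ξ => e2pi (-τ / 24) * S ξ *
      qPoch (e2pi (ξ / τ) * e2pi (-1 / τ)) (e2pi (-1 / τ)) *
      exp (L ξ / (2 * Real.pi * I * τ) - binetMu (ξ / τ)) with hB
  have hAd : Differentiable ℂ A :=
    (differentiable_qPoch (norm_e2pi_lt_one hτ)).comp differentiable_e2pi
  have hBd : DifferentiableOn ℂ B (xiDomain τ) := by
    intro ζ hζ
    have hn := isOpen_xiDomain.mem_nhds hζ
    have h1 := hS.holomorphic.differentiableAt hn
    have h2 := hL.holomorphic.differentiableAt hn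
    have h3 : DifferentiableAt ℂ (fun ζ : ℂ => binetMu (ζ / τ)) ζ :=
      DifferentiableAt.comp (f := fun ζ : ℂ => ζ / τ) ζ (differentiableAt_binetMu hζ.2)
        (by fun_prop : DifferentiableAt ℂ (fun ζ : ℂ => ζ / τ) ζ)
    have h4 : DifferentiableAt ℂ (fun ζ : ℂ => e2pi (ζ / τ) * e2pi (-1 / τ)) ζ :=
      ((differentiable_e2pi (ζ / τ)).comp ζ
        (by fun_prop : DifferentiableAt ℂ (fun ζ : ℂ => ζ / τ) ζ)).mul_const _
    have h5 : DifferentiableAt ℂ (fun ζ : ℂ =>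
        qPoch (e2pi (ζ / τ) * e2pi (-1 / τ)) (e2pi (-1 / τ))) ζ :=
      (differentiable_qPoch (norm_e2pi_lt_one (im_neg_one_div_pos hτ)) _).comp ζ h4
    exact (((h1.const_mul _).mul h5).mul
      ((h2.div_const _).sub h3).cexp).differentiableWithinAt
  -- A base point with Im ξ and Im(ξ/τ) both positive: (τ - 1)/τ = 1 - 1/τ.
  have hmem : τ - 1 ∈ {ζ : ℂ | 0 < ζ.im ∧ 0 < (ζ / τ).im} := by
    have hτ0 : τ ≠ 0 := by rintro rfl; simp at hτ
    have h1 : (τ - 1) / τ = 1 + -1 / τ := by field_simp; ring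
    refine ⟨by simpa using hτ, ?_⟩
    rw [h1, add_im, one_im, zero_add]
    exact im_neg_one_div_pos hτ
  have hopen : IsOpen {ζ : ℂ | 0 < ζ.im ∧ 0 < (ζ / τ).im} :=
    (isOpen_lt continuous_const continuous_im).inter
      (isOpen_lt continuous_const (by fun_prop : Continuous fun ζ : ℂ => (ζ / τ).im))
  have h0 : ∀ᶠ ζ in 𝓝 (τ - 1), A ζ - B ζ * prodE (τ, ζ) = 0 := by
    filter_upwards [hopen.mem_nhds hmem] with ζ hζ
    have h1 := prodE_mul_qPoch hτ hζ.1 hζ.2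
    simp only [hA, hB]
    rw [qPoch_eq_exp_symmetricSum hτ hζ.1, hL.eq_dilog ζ hζ.1, hS.eq_psqrt ζ hζ.1,
      sub_eq_add_neg (_ / _), sub_eq_add_neg (_ / _), exp_add, exp_add, ← h1]
    ring
  have hm : MeromorphicOn (fun ζ => A ζ - B ζ * prodE (τ, ζ)) (xiDomain τ) := fun ζ hζ =>
    (hAd.analyticAt ζ).meromorphicAt.sub
      (((hBd.analyticAt (isOpen_xiDomain.mem_nhds hζ)).meromorphicAt).mul
        (meromorphicAt_prodE hτ hζ.1))
  have hP : ContinuousAt (fun ζ : ℂ => prodE (τ, ζ)) ξ :=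
    ContinuousAt.comp (f := fun ζ : ℂ => (τ, ζ))
      (differentiableAt_prodE (p := (τ, ξ)) ⟨hτ, hξ.1, hsing⟩).continuousAt (by fun_prop)
  have hc : ContinuousAt (fun ζ => A ζ - B ζ * prodE (τ, ζ)) ξ :=
    hAd.continuous.continuousAt.sub
      ((hBd.differentiableAt (isOpen_xiDomain.mem_nhds hξ)).continuousAt.mul hP)
  exact sub_eq_zero.1 (eq_zero_of_meromorphicOn (isConnected_xiDomain hτ) hm
    (mem_xiDomain_of_im_pos hτ hmem.1) h0 hξ hc)

/-! ### The symmetric form with G^*. -/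

lemma stirlingGStar_eq {τ ξ : ℂ} (h : (ξ / τ).im ≠ 0) :
    stirlingGStar τ ξ = (binetMu (-(ξ / τ)) - binetMu (ξ / τ)) / 2 := by
  have h1 : -ξ / τ = -(ξ / τ) := neg_div τ ξ
  rw [stirlingGStar, stirlingG_eq_neg_binetMu (Or.inr h),
    stirlingG_eq_neg_binetMu (Or.inr (by rwa [h1, neg_im, neg_ne_zero])), h1]
  ring

/-- Reflection removes μ(-ξ/τ) at the cost of half a logarithm, which becomes the principal root in
κ. -/
lemma stirlingGStar_of_im_pos {τ ξ : ℂ} (h : 0 < (ξ / τ).im) :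
    stirlingGStar τ ξ = -binetMu (ξ / τ) - log (1 - e2pi (ξ / τ)) / 2 := by
  rw [stirlingGStar_eq h.ne']
  linear_combination binetMu_add_neg h / 2

lemma e2pi_neg (z : ℂ) : e2pi (-z) = 1 / e2pi z := by
  rw [e2pi, e2pi, mul_neg, exp_neg, one_div]

lemma stirlingGStar_of_im_neg {τ ξ : ℂ} (h : (ξ / τ).im < 0) :
    stirlingGStar τ ξ = -binetMu (ξ / τ) - log (1 - 1 / e2pi (ξ / τ)) / 2 := by
  have h1 := binetMu_add_neg (z := -(ξ / τ)) (by rw [neg_im]; linarith)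
  rw [neg_neg, e2pi_neg] at h1
  rw [stirlingGStar_eq h.ne]
  linear_combination h1 / 2

lemma psqrt_ne_zero (z : ℂ) : psqrt z ≠ 0 := exp_ne_zero _

lemma psqrt_mul_self {z : ℂ} (hz : z ≠ 0) : psqrt z * psqrt z = z := by
  rw [psqrt, ← exp_add, add_halves, exp_log hz]

lemma exp_add_stirlingGStar {a g b x : ℂ} (P : ℂ) (hg : g = b - log x / 2) :
    exp (a + g + P) = exp (a + b) * exp P / psqrt x := by
  rw [psqrt, ← exp_add, ← exp_sub, hg]
  congr 1
  ring

end QProduct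

end

theorem theorem3p2 :
    ∃ P : ℂ × ℂ → ℂ, QProduct.IsPMinus P ∧
      ∀ τ : ℂ, 0 < τ.im →
        ∃ L S : ℂ → ℂ, QProduct.IsDilogBranch τ L ∧ QProduct.IsSqrtBranch τ S ∧
          ∀ ξ ∈ QProduct.xiDomain τ, ξ ∉ QProduct.singularPoints τ →
            ∀ x q xs qs : ℂ,
              x = QProduct.e2pi ξ → q = QProduct.e2pi τ →
              xs = QProduct.e2pi (ξ / τ) → qs = QProduct.e2pi (-1 / τ) →
              QProduct.qPoch x q =
                  QProduct.e2pi (-τ / 24) * S ξ * QProduct.qPoch (xs * qs) qs *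
                    Complex.exp (L ξ / (2 * (Real.pi : ℂ) * Complex.I * τ)
                      + QProduct.stirlingG τ ξ + P (τ, ξ)) ∧
              (0 < (ξ / τ).im →
                QProduct.qPoch x q =
                  (QProduct.e2pi (-τ / 24) * (S ξ / QProduct.psqrt (1 - xs)) *
                    Complex.exp (L ξ / (2 * (Real.pi : ℂ) * Complex.I * τ)
                      + QProduct.stirlingGStar τ ξ + P (τ, ξ))) * QProduct.qPoch xs qs) ∧
              ((ξ / τ).im < 0 →
                QProduct.qPoch x q =
                  (QProduct.e2pi (-τ / 24) * (S ξ * QProduct.psqrt (1 - 1 / xs) / (1 - xs)) *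
                    Complex.exp (L ξ / (2 * (Real.pi : ℂ) * Complex.I * τ)
                      + QProduct.stirlingGStar τ ξ + P (τ, ξ))) * QProduct.qPoch xs qs) := by
  refine ⟨QProduct.determinationP, QProduct.isPMinus_determinationP, fun τ hτ => ?_⟩
  obtain ⟨L, S, hL, hS⟩ := QProduct.exists_branches hτ
  refine ⟨L, S, hL, hS, fun ξ hξ hsing x q xs qs hx hq hxs hqs => ?_⟩
  subst hx hq hxs hqs
  have hP := QProduct.exp_determinationP (p := (τ, ξ)) ⟨hτ, hξ.1, hsing⟩
  have hq := QProduct.norm_e2pi_lt_one (QProduct.im_neg_one_div_pos hτ)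
  -- All three formulas rest on one identity; splitting 1 - x^* off (x^*;q^*)_∞ gives them the
  -- common factor (x^*q^*;q^*)_∞.
  rw [QProduct.qPoch_eq_mul_prodE hτ hL hS hξ hsing,
    QProduct.qPoch_eq_one_sub_mul (QProduct.e2pi (ξ / τ)) hq, ← hP]
  refine ⟨?_, fun h => ?_, fun h => ?_⟩
  · rw [QProduct.stirlingG_eq_neg_binetMu hξ.2, ← sub_eq_add_neg, Complex.exp_add]
    ring
  · have h1 := QProduct.one_sub_e2pi_ne_zero h
    have h2 := QProduct.psqrt_mul_self h1
    have h3 := QProduct.psqrt_ne_zero (1 - QProduct.e2pi (ξ / τ))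
    rw [QProduct.exp_add_stirlingGStar _ (QProduct.stirlingGStar_of_im_pos h), ← sub_eq_add_neg]
    generalize QProduct.psqrt (1 - QProduct.e2pi (ξ / τ)) = s at h2 h3 ⊢
    rw [← h2]
    field_simp
  · have h1 := QProduct.one_sub_e2pi_ne_zero (z := -(ξ / τ)) (by rw [Complex.neg_im]; linarith)
    rw [QProduct.e2pi_neg] at h1
    have h3 := QProduct.psqrt_ne_zero (1 - 1 / QProduct.e2pi (ξ / τ))
    have h4 : 1 - QProduct.e2pi (ξ / τ) ≠ 0 := by
      intro h4
      rw [← sub_eq_zero.1 h4] at h1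
      simp at h1
    rw [QProduct.exp_add_stirlingGStar _ (QProduct.stirlingGStar_of_im_neg h), ← sub_eq_add_neg]
    generalize QProduct.psqrt (1 - 1 / QProduct.e2pi (ξ / τ)) = s at h3 ⊢
    field_simp
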